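/- Fix integers $k_1,k_2$ and consider a sequence of experiments (asymptotics are along this sequence) with $n\to\infty$, $p_1\to\infty$, $p_2\to\infty$; "w.h.p." means with probability tending to one, and all constants below do not depend on the experiment. Let $R^*\in\mathbb R^{p_1\times k_1}$, $C^*\in\mathbb R^{p_2\times k_2}$, $B^*\in\mathbb R^{p_1\times p_2}$ be deterministic, and for $i\in[n]$ let $$X_i=R^*F_iC^{*\top}+U_i,\qquad y_i=\langle X_i,B^*\rangle+\varepsilon_i ,\qquad \langle M,N\rangle=\operatorname{Tr}(M^\top N).$$ Put $A^*=R^{*\top}B^*C^*$, $\theta^*=(\operatorname{vec}(B^*)^\top,\operatorname{vec}(A^*)^\top)^\top$, $S=\operatorname{supp}(\theta^*)$, $S_2=S^c$. Let $\mathbb F,\mathbb U,\mathbb X$ be the matrices whose $i$-th rows are $\operatorname{vec}(F_i)^\top,\operatorname{vec}(U_i)^\top,\operatorname{vec}(X_i)^\top$, and let $W=[\mathbb U\ \mathbb F]$. Assume the following. 1. The triples $(F_i,U_i,\varepsilon_i)$, $i\in[n]$, are independent. $F_i=L Z Q$ and $U_i=L'Z'Q'$, where $Z,Z'$ have independent mean-zero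 entries that are sub-Gaussian with a common parameter, and $L,Q,L',Q'$ are nonzero square matrices of spectral norm less than a constant. The entries of $F_i$ and $U_i$ satisfy $|\mathbb E[f_{i,ab}u_{i,cd}]|\le c/\sqrt n$ (in particular this holds when they are uncorrelated). 2. $\varepsilon_i$ is $\sigma$-sub-Gaussian and $\mathbb E[\varepsilon_iF_i]=0$, $\mathbb E[\varepsilon_iU_i]=0$. 3. The entries of $R^*$ and $C^*$ are bounded by a constant, and for constants $0<c_F\le C_F$ the eigenvalues of $\mathbb F^\top\mathbb F/n$ lie in $[c_F,C_F]$ w.h.p. 4. $W_1\in\mathbb R^{p_1\times k_1}$, $W_2\in\mathbb R^{p_2\times k_2}$ are (possibly random) projection matrices, independent of $\{(F_i,U_i,\varepsilon_i)\}_{i\le n}$, with entries bounded by a constant w.h.p., such that with $H_1=p_1^{-1}W_1^\top R^*$, $H_2=p_2^{-1}W_2^\top C^*$ the matrix $H_2\otimes H_1$ converges in probability to an invertible matrix. 5. For constants $\kappa_2>\kappa_\infty>0$ and $\tau\in(0,1)$, w.h.p. $W_S^\top W_S$ is invertible, $\|n(W_S^\top W_S)^{-1}\|_\infty\le\frac1{2\kappa_\infty}$,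 $\|n(W_S^\top W_S)^{-1}\|_2\le\frac1{2\kappa_2}$ and $\|W_{S_2}^\top W_S(W_S^\top W_S)^{-1}\|_\infty\le1-\tau$ (here $\|\cdot\|_\infty$ is the maximal absolute row sum). 6. $|S|\big(\frac{\log(p_1p_2)}n+\frac1{p_1p_2}\big)\to0$. Let $\hat F_i=\frac1{p_1p_2}W_1^\top X_iW_2$, let $\hat{\mathbb F}$ have rows $\operatorname{vec}(\hat F_i)^\top$, let $\tilde\Gamma=\mathbb X^\top\hat{\mathbb F}(\hat{\mathbb F}^\top\hat{\mathbb F})^{-1}$ with entries $\tilde\Gamma_{(a,b),(\alpha,\beta)}$, $a\in[p_1],b\in[p_2],\alpha\in[k_1],\beta\in[k_2]$, and put $$\hat R_{a\alpha}=\frac1{p_2k_2}\sum_{b,\beta}\tilde\Gamma_{(a,b),(\alpha,\beta)},\quad \hat C_{b\beta}=\frac1{p_1k_1}\sum_{a,\alpha}\tilde\Gamma_{(a,b),(\alpha,\beta)},$$ with $\hat r_s,\hat c_s$ the averages of the entries of $\hat R,\hat C$. The estimated idiosyncratic components $\hat U_i$ are either the block-averaging residuals $\hat U_i=X_i-\frac1{\hat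 c_s\hat r_s}\hat R\hat F_i\hat C^\top$ (with the convention $1/0=0$) or the projection residuals $\hat{\mathbb U}=(I-\hat P)\mathbb X$, $\hat P=\hat{\mathbb F}(\hat{\mathbb F}^\top\hat{\mathbb F})^{-1}\hat{\mathbb F}^\top$; the result holds for both. W.h.p. let $$(\hat A,\hat B)\in\arg\min_{A,B}\Big\{\frac1{2n}\sum_{i=1}^n\big(y_i-\langle A,\hat F_i\rangle-\langle B,\hat U_i\rangle\big)^2+\lambda\|\operatorname{vec}(B)\|_1\Big\}.$$ Let $\bar W=[(I-\hat P)\mathbb X\ \ \bar{\mathbb F}]$, where $\bar{\mathbb F}$ has rows $\operatorname{vec}(H_1^{-1}\hat F_i(H_2^\top)^{-1})^\top$, and let $\delta=\|n^{-1}\bar W^\top\varepsilon\|_\infty$ be the largest absolute entry of $n^{-1}\bar W^\top\varepsilon$, $\varepsilon=(\varepsilon_1,\dots,\varepsilon_n)^\top$. Suppose that the (possibly data-dependent) tuning parameter $\lambda$ satisfies $\lambda>14\delta/\tau$ w.h.p. and $\lambda=O_p(\delta)$. Then the entrywise sup norm of the error satisfies $$\|\hat B-B^*\|_\infty=O_p\left(\frac{|S|\log(p_1p_2)}{n}+|S|\sqrt{\frac{\log(p_1p_2)}{n}}\Big(\frac{p_1}{p_2}\vee\frac{p_2}{p_1}\Big)^{1/2}\right).$$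 -/

import Mathlib

open MeasureTheory ProbabilityTheory Filter Topology Matrix
open scoped NNReal ENNReal Kronecker

noncomputable section

namespace FAMAR

/-! ### Norms and stochastic orders -/

section Norms

open scoped Matrix.Norms.L2Operator

/-- Spectral norm (largest singular value) of a real matrix. -/
def specNorm {a b : Type*} [Fintype a] [Fintype b] [DecidableEq b]
    (A : Matrix a b ℝ) : ℝ := ‖A‖

end Norms

/-- Maximal absolute row sum: the operator norm induced by the sup norm of vectors. -/
def rowSumNorm {a b : Type*} [Fintype b] (A : Matrix a b ℝ) : ℝ := ⨆ i, ∑ j, |A i j|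

/-- Entrywise sup norm, i.e. the sup norm of the vectorised matrix. -/
def maxNorm {a b : Type*} [Fintype a] [Fintype b] (A : Matrix a b ℝ) : ℝ :=
  ‖fun q : a × b => A q.1 q.2‖

/-- Trace inner product `⟨A, B⟩ = Tr (Aᵀ B)`. -/
def trInner {a b : Type*} [Fintype a] [Fintype b] (A B : Matrix a b ℝ) : ℝ := (Aᵀ * B).trace

/-- The events `P ν` have probability tending to one (stated through outer measure, so that no
measurability of the event is needed). -/
def WHP {Ω : ℕ → Type*} [∀ ν, MeasurableSpace (Ω ν)] (μ : ∀ ν, Measure (Ω ν))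
    (P : ∀ ν, Ω ν → Prop) : Prop :=
  Tendsto (fun ν => μ ν {ω | ¬ P ν ω}) atTop (𝓝 0)

/-- `Y ν = O_p (r ν)`. -/
def IsBigOp {Ω : ℕ → Type*} [∀ ν, MeasurableSpace (Ω ν)] (μ : ∀ ν, Measure (Ω ν))
    (Y r : ∀ ν, Ω ν → ℝ) : Prop :=
  ∀ η : ℝ≥0∞, 0 < η → ∃ M : ℝ, ∀ᶠ ν in atTop, μ ν {ω | M * r ν ω < |Y ν ω|} ≤ η

/-! ### Distributional assumption -/

/-- A random matrix with sub-Gaussian, mean zero, weakly correlated entries: `V = L Z Q` almost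
surely, where `Z` has independent `K`-sub-Gaussian entries (the bound on the moment generating
function forces mean zero) and `L`, `Q` are deterministic with `0 < ‖L‖₂, ‖Q‖₂ < c`. -/
def WeaklyCorrelatedSubGaussian {Ω : Type*} [MeasurableSpace Ω] (μ : Measure Ω) {a b : ℕ}
    (K : ℝ≥0) (c : ℝ) (V : Ω → Matrix (Fin a) (Fin b) ℝ) : Prop :=
  ∃ (L : Matrix (Fin a) (Fin a) ℝ) (Q : Matrix (Fin b) (Fin b) ℝ)
    (Z : Ω → Matrix (Fin a) (Fin b) ℝ),
    (0 < specNorm L ∧ specNorm L < c) ∧ (0 < specNorm Q ∧ specNorm Q < c) ∧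
    (∀ i j, HasSubgaussianMGF (fun ω => Z ω i j) K μ) ∧
    iIndepFun (fun (q : Fin a × Fin b) (ω : Ω) => Z ω q.1 q.2) μ ∧
    ∀ᵐ ω ∂μ, V ω = L * Z ω * Q

/-! ### Model, projected factors, block-averaged loadings, residuals (for one fixed sample) -/

section Sample

variable {n p₁ p₂ k₁ k₂ : ℕ}

/-- Matrix factor model `X_i = R F_i Cᵀ + U_i`. -/
def covariate (R : Matrix (Fin p₁) (Fin k₁) ℝ) (C : Matrix (Fin p₂) (Fin k₂) ℝ)
    (F : Fin n → Matrix (Fin k₁) (Fin k₂) ℝ) (U : Fin n → Matrix (Fin p₁) (Fin p₂) ℝ) :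
    Fin n → Matrix (Fin p₁) (Fin p₂) ℝ :=
  fun i => R * F i * Cᵀ + U i

/-- Matrix regression `y_i = ⟨X_i, B⟩ + ε_i`. -/
def response (X : Fin n → Matrix (Fin p₁) (Fin p₂) ℝ) (B : Matrix (Fin p₁) (Fin p₂) ℝ)
    (ε : Fin n → ℝ) : Fin n → ℝ :=
  fun i => trInner (X i) B + ε i

/-- Stack a sample of matrices: the `i`-th row is the vectorised `i`-th matrix. -/
def stack {a b : ℕ} (V : Fin n → Matrix (Fin a) (Fin b) ℝ) :
    Matrix (Fin n) (Fin a × Fin b) ℝ :=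
  Matrix.of fun i q => V i q.1 q.2

/-- Transformation matrix `H = p⁻¹ Wᵀ R`. -/
def transf {p k : ℕ} (W R : Matrix (Fin p) (Fin k) ℝ) : Matrix (Fin k) (Fin k) ℝ :=
  (1 / (p : ℝ)) • (Wᵀ * R)

/-- Projected factors `F̂_i = (p₁ p₂)⁻¹ W₁ᵀ X_i W₂`. -/
def factorHat (W₁ : Matrix (Fin p₁) (Fin k₁) ℝ) (W₂ : Matrix (Fin p₂) (Fin k₂) ℝ)
    (X : Fin n → Matrix (Fin p₁) (Fin p₂) ℝ) : Fin n → Matrix (Fin k₁) (Fin k₂) ℝ :=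
  fun i => (1 / ((p₁ : ℝ) * p₂)) • (W₁ᵀ * X i * W₂)

/-- Least squares loadings `Γ̃ = 𝕏ᵀ F̂ (F̂ᵀ F̂)⁻¹` of the vectorised model. -/
def gammaTilde (X : Fin n → Matrix (Fin p₁) (Fin p₂) ℝ)
    (Fh : Fin n → Matrix (Fin k₁) (Fin k₂) ℝ) :
    Matrix (Fin p₁ × Fin p₂) (Fin k₁ × Fin k₂) ℝ :=
  (stack X)ᵀ * stack Fh * ((stack Fh)ᵀ * stack Fh)⁻¹

/-- Block average estimating the row loadings (average over the `p₂ k₂` blocks of size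
`p₁ × k₁`). -/
def rowLoadingHat (G : Matrix (Fin p₁ × Fin p₂) (Fin k₁ × Fin k₂) ℝ) :
    Matrix (Fin p₁) (Fin k₁) ℝ :=
  Matrix.of fun a α => (1 / ((p₂ : ℝ) * k₂)) * ∑ b, ∑ β, G (a, b) (α, β)

/-- Block average estimating the column loadings (average over the `p₁ k₁` blocks of size
`p₂ × k₂` of the shuffled matrix). -/
def colLoadingHat (G : Matrix (Fin p₁ × Fin p₂) (Fin k₁ × Fin k₂) ℝ) :
    Matrix (Fin p₂) (Fin k₂) ℝ :=
  Matrix.of fun b β => (1 / ((p₁ : ℝ) * k₁)) * ∑ a, ∑ α, G (a, b) (α, β)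

/-- Average of all entries of a matrix. -/
def entryMean {a b : ℕ} (M : Matrix (Fin a) (Fin b) ℝ) : ℝ :=
  (1 / ((a : ℝ) * b)) * ∑ i, ∑ j, M i j

/-- Residuals `Û_i = X_i - (ĉ_s r̂_s)⁻¹ R̂ F̂_i Ĉᵀ` built from the block-averaged loadings. -/
def blockResidual (X : Fin n → Matrix (Fin p₁) (Fin p₂) ℝ)
    (Fh : Fin n → Matrix (Fin k₁) (Fin k₂) ℝ) : Fin n → Matrix (Fin p₁) (Fin p₂) ℝ :=
  fun i =>
    X i - (1 / (entryMean (colLoadingHat (gammaTilde X Fh)) *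
        entryMean (rowLoadingHat (gammaTilde X Fh)))) •
      (rowLoadingHat (gammaTilde X Fh) * Fh i * (colLoadingHat (gammaTilde X Fh))ᵀ)

/-- Residuals `Û = (I - P̂) 𝕏`, with `P̂ = F̂ (F̂ᵀ F̂)⁻¹ F̂ᵀ`. -/
def projResidual (X : Fin n → Matrix (Fin p₁) (Fin p₂) ℝ)
    (Fh : Fin n → Matrix (Fin k₁) (Fin k₂) ℝ) : Fin n → Matrix (Fin p₁) (Fin p₂) ℝ :=
  fun i => Matrix.of fun a b =>
    (stack X - stack Fh * ((stack Fh)ᵀ * stack Fh)⁻¹ * (stack Fh)ᵀ * stack X) i (a, b)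

/-- The `ℓ₁`-penalised least squares criterion. -/
def objective (y : Fin n → ℝ) (Fh : Fin n → Matrix (Fin k₁) (Fin k₂) ℝ)
    (Uh : Fin n → Matrix (Fin p₁) (Fin p₂) ℝ) (lam : ℝ)
    (θ : Matrix (Fin k₁) (Fin k₂) ℝ × Matrix (Fin p₁) (Fin p₂) ℝ) : ℝ :=
  (1 / (2 * (n : ℝ))) * ∑ i, (y i - trInner θ.1 (Fh i) - trInner θ.2 (Uh i)) ^ 2
    + lam * ∑ a, ∑ b, |θ.2 a b|

/-- Rotated factors `H₁⁻¹ F̂_i (H₂ᵀ)⁻¹`. -/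
def rotatedFactor (H₁ : Matrix (Fin k₁) (Fin k₁) ℝ) (H₂ : Matrix (Fin k₂) (Fin k₂) ℝ)
    (Fh : Fin n → Matrix (Fin k₁) (Fin k₂) ℝ) : Fin n → Matrix (Fin k₁) (Fin k₂) ℝ :=
  fun i => H₁⁻¹ * Fh i * (H₂ᵀ)⁻¹

/-- Joint design `[𝕌 𝔽]`, an `n × (p₁p₂ + k₁k₂)` matrix. -/
def design (U : Fin n → Matrix (Fin p₁) (Fin p₂) ℝ) (F : Fin n → Matrix (Fin k₁) (Fin k₂) ℝ) :
    Matrix (Fin n) ((Fin p₁ × Fin p₂) ⊕ (Fin k₁ × Fin k₂)) ℝ :=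
  Matrix.fromCols (stack U) (stack F)

/-- The noise level `δ = ‖n⁻¹ Wᵀ ε‖_∞` of a design `W`. -/
def noiseLevel {d : Type*} [Fintype d] (W : Matrix (Fin n) d ℝ) (ε : Fin n → ℝ) : ℝ :=
  ‖fun j => (1 / (n : ℝ)) * ∑ i, W i j * ε i‖

/-- The true parameter `θ* = (vec B*, vec A*)` with `A* = R*ᵀ B* C*`. -/
def thetaStar (R : Matrix (Fin p₁) (Fin k₁) ℝ) (C : Matrix (Fin p₂) (Fin k₂) ℝ)
    (B : Matrix (Fin p₁) (Fin p₂) ℝ) : (Fin p₁ × Fin p₂) ⊕ (Fin k₁ × Fin k₂) → ℝ :=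
  Sum.elim (fun q => B q.1 q.2) (fun q => (Rᵀ * B * C) q.1 q.2)

/-- Support `S` of a parameter vector. -/
def supp {d : Type*} [Fintype d] (θ : d → ℝ) : Finset d :=
  Finset.univ.filter fun j => θ j ≠ 0

end Sample

section Design

variable {n : ℕ} {d : Type*} [Fintype d] [DecidableEq d]

/-- Columns of `W` indexed by `S`. -/
def cols (W : Matrix (Fin n) d ℝ) (S : Finset d) : Matrix (Fin n) {j // j ∈ S} ℝ :=
  W.submatrix id Subtype.val

/-- Restricted strong convexity: `W_Sᵀ W_S` is invertible with `‖n (W_Sᵀ W_S)⁻¹‖_∞ ≤ 1/(2κ_∞)`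
and `‖n (W_Sᵀ W_S)⁻¹‖₂ ≤ 1/(2κ₂)`. -/
def RestrictedStrongConvexity (W : Matrix (Fin n) d ℝ) (S : Finset d) (κinf κ₂ : ℝ) : Prop :=
  IsUnit ((cols W S)ᵀ * cols W S).det ∧
  rowSumNorm ((n : ℝ) • ((cols W S)ᵀ * cols W S)⁻¹) ≤ 1 / (2 * κinf) ∧
  specNorm ((n : ℝ) • ((cols W S)ᵀ * cols W S)⁻¹) ≤ 1 / (2 * κ₂)

/-- Irrepresentable condition: `‖W_{S₂}ᵀ W_S (W_Sᵀ W_S)⁻¹‖_∞ ≤ 1 - τ`, with `S₂` the complement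
of `S`. -/
def Irrepresentable (W : Matrix (Fin n) d ℝ) (S : Finset d) (τ : ℝ) : Prop :=
  rowSumNorm ((cols W Sᶜ)ᵀ * cols W S * ((cols W S)ᵀ * cols W S)⁻¹) ≤ 1 - τ

end Design

/-- The rate `s log(p₁p₂)/n + s √(log(p₁p₂)/n) (p₁/p₂ ∨ p₂/p₁)^{1/2}`. -/
def rate (s n p₁ p₂ : ℕ) : ℝ :=
  s * Real.log ((p₁ : ℝ) * p₂) / n +
    s * Real.sqrt (Real.log ((p₁ : ℝ) * p₂) / n) *
      Real.sqrt (max ((p₁ : ℝ) / p₂) ((p₂ : ℝ) / p₁))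

end FAMAR

end

namespace FAMAR

/-! ### Sub-exponential concentration for products of sub-Gaussian variables -/

/-! Write H = H₁ ⊗ H₂, Γ = R ⊗ C, and let E be the projection of the idiosyncratic parts, so that F̂
= 𝔽Hᵀ + E and 𝕏 = 𝔽Γᵀ + 𝕌 in stacked form. Both residual constructions have the form 𝕏 - F̂G for
some matrix G (`exists_stack_residual`), and A is unpenalised. Profiling A out removes G, so in
either case the error Δ = B̂ - B satisfies the basic inequality of a lasso with design (I - P̂)𝕏
(`lasso_basic_inequality`), hence a cone condition (`lasso_cone`).

The curvature comes from the true design. Irrepresentability together with restricted strong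
convexity yields a compatibility inequality for [𝕌 𝔽] (`compatibility`). Applied to Δ padded by
zeros on the factor coordinates, it bounds the ℓ₁ norm of Δ on the support by ‖𝕌Δ‖.

The two designs are close. Since 𝔽Γᵀ = (F̂ - E)(ΓH⁻¹)ᵀ and I - P̂ kills F̂, the adjusted design
equals (I - P̂)(𝕌 - E(ΓH⁻¹)ᵀ). Here E is small by a second-moment bound conditional on the weights,
of order 1/(p₁p₂) for the mean square of a column. The part P̂𝕌 is small because the cross moments
𝕌ᵀ𝔽/n are of order √(log(p₁p₂)/n), by a Bernstein bound for products of sub-Gaussian variables and a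
union bound. So ‖𝕌Δ‖ exceeds ‖(I - P̂)𝕏Δ‖ by at most √n·ω‖Δ‖₁, with √|S|·ω small by the sparsity
condition (`eucl_idiosyncratic_le`), and this excess is absorbed.

The outcome is ‖Δ‖₁ ≤ const·|S|·λ (`sum_abs_le_of_compatibility`). The same cross-moment bounds give
δ ≲ √(log(p₁p₂)/n) (`noiseLevel_estimated_le`), and λ = O_p(δ). The sup norm is at most the ℓ₁ norm,
and the stated rate dominates |S|√(log(p₁p₂)/n). If S is empty, the cone inequality alone forces Δ =
0, and no moment bound is needed. -/

lemma lintegral_exp_sq_div_four_gaussianReal :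
    ∫⁻ g, ENNReal.ofReal (Real.exp (g ^ 2 / 4)) ∂(gaussianReal 0 1) ≤ 2 := by
  rw [gaussianReal_of_var_ne_zero 0 one_ne_zero,
    lintegral_withDensity_eq_lintegral_mul _ (measurable_gaussianPDF 0 1) (by fun_prop)]
  have h1 : ∀ g : ℝ, (gaussianPDF 0 1 * fun g => ENNReal.ofReal (Real.exp (g ^ 2 / 4))) g =
      ENNReal.ofReal ((√(2 * Real.pi))⁻¹ * Real.exp (-(1 / 4) * g ^ 2)) := by
    intro g
    simp only [Pi.mul_apply, gaussianPDF, gaussianPDFReal]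
    rw [← ENNReal.ofReal_mul (by positivity), mul_assoc, ← Real.exp_add]
    congr 3
    · simp
    · simp; ring
  rw [lintegral_congr h1, ← ofReal_integral_eq_lintegral_ofReal
    ((integrable_exp_neg_mul_sq (by norm_num)).const_mul _)
    (ae_of_all _ fun g => by positivity), integral_const_mul, integral_gaussian]
  rw [show (2 : ℝ≥0∞) = ENNReal.ofReal 2 by simp]
  apply ENNReal.ofReal_le_ofReal
  rw [inv_mul_eq_div, ← Real.sqrt_div (by positivity)]
  apply Real.sqrt_le_iff.2
  refine ⟨by norm_num, ?_⟩
  have := Real.pi_pos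
  rw [show Real.pi / (1 / 4) / (2 * Real.pi) = 2 by field_simp; norm_num]
  norm_num

variable {Ω : Type*} [MeasurableSpace Ω] {μ : Measure Ω}

/-- Gaussian linearisation: it turns the exponential of a square into an average of exponentials of
linear functions, to which a bound on the moment generating function applies. -/
lemma ofReal_exp_sq_eq_lintegral_gaussianReal {a : ℝ} (ha : 0 ≤ a) (x : ℝ) :
    ENNReal.ofReal (Real.exp (a * x ^ 2)) =
      ∫⁻ g, ENNReal.ofReal (Real.exp (√(2 * a) * g * x)) ∂(gaussianReal 0 1) := by
  have h := congrFun (mgf_id_gaussianReal (μ := 0) (v := 1)) (√(2 * a) * x)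
  rw [← ofReal_integral_eq_lintegral_ofReal]
  · congr 1
    simp only [mgf, id] at h
    rw [show (fun g : ℝ => Real.exp (√(2 * a) * g * x)) =
      fun g => Real.exp (√(2 * a) * x * g) by ext g; congr 1; ring, h]
    congr 1
    rw [mul_pow, Real.sq_sqrt (by positivity)]
    simp; ring
  · refine (integrable_exp_mul_gaussianReal (μ := 0) (v := 1) (√(2 * a) * x)).congr
      (ae_of_all _ fun g => ?_)
    simp only
    congr 1; ring
  · exact ae_of_all _ fun g => (Real.exp_pos _).le

/-- After exchanging the two integrals, the sub-Gaussian bound at √(2a)g leaves exp(a c g²) ≤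
exp(g²/4) under the Gaussian integral. -/
lemma lintegral_exp_sq_le [IsProbabilityMeasure μ] {X : Ω → ℝ} {c : ℝ≥0}
    (hX : HasSubgaussianMGF X c μ) {a : ℝ} (ha : 0 ≤ a) (hac : a * c ≤ 1 / 4) :
    ∫⁻ ω, ENNReal.ofReal (Real.exp (a * X ω ^ 2)) ∂μ ≤ 2 := by
  simp_rw [ofReal_exp_sq_eq_lintegral_gaussianReal ha]
  have hm : AEMeasurable (Function.uncurry fun (ω : Ω) (g : ℝ) =>
      ENNReal.ofReal (Real.exp (√(2 * a) * g * X ω))) (μ.prod (gaussianReal 0 1)) := by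
    have : AEMeasurable (fun z : Ω × ℝ => X z.1) (μ.prod (gaussianReal 0 1)) :=
      hX.aemeasurable.comp_fst
    simp only [Function.uncurry_def]
    exact (Real.measurable_exp.comp_aemeasurable ((AEMeasurable.mul
      (measurable_snd.const_mul _).aemeasurable this))).ennreal_ofReal
  rw [lintegral_lintegral_swap hm]
  refine le_trans (lintegral_mono fun g => ?_) lintegral_exp_sq_div_four_gaussianReal
  rw [← ofReal_integral_eq_lintegral_ofReal (hX.integrable_exp_mul _)
    (ae_of_all _ fun _ => (Real.exp_pos _).le)]
  apply ENNReal.ofReal_le_ofReal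
  refine (hX.mgf_le _).trans (Real.exp_le_exp.2 ?_)
  rw [mul_pow, Real.sq_sqrt (by positivity)]
  nlinarith [mul_le_mul_of_nonneg_right hac (sq_nonneg g)]

lemma integrable_exp_sq [IsProbabilityMeasure μ] {X : Ω → ℝ} {c : ℝ≥0}
    (hX : HasSubgaussianMGF X c μ) {a : ℝ} (ha : 0 ≤ a) (hac : a * c ≤ 1 / 4) :
    Integrable (fun ω => Real.exp (a * X ω ^ 2)) μ := by
  have := hX.aemeasurable
  refine ⟨by fun_prop, ?_⟩
  rw [hasFiniteIntegral_iff_ofReal (ae_of_all _ fun _ => (Real.exp_pos _).le)]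
  exact (lintegral_exp_sq_le hX ha hac).trans_lt (by simp)

lemma integral_exp_sq_le [IsProbabilityMeasure μ] {X : Ω → ℝ} {c : ℝ≥0}
    (hX : HasSubgaussianMGF X c μ) {a : ℝ} (ha : 0 ≤ a) (hac : a * c ≤ 1 / 4) :
    ∫ ω, Real.exp (a * X ω ^ 2) ∂μ ≤ 2 := by
  rw [integral_eq_lintegral_of_nonneg_ae (ae_of_all _ fun _ => (Real.exp_pos _).le)
    (integrable_exp_sq hX ha hac).1]
  exact ENNReal.toReal_le_of_le_ofReal (by norm_num) (by simpa using lintegral_exp_sq_le hX ha hac)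

lemma _root_.ProbabilityTheory.HasSubgaussianMGF.mono {X : Ω → ℝ} {c c' : ℝ≥0}
    (h : HasSubgaussianMGF X c μ) (hc : c ≤ c') : HasSubgaussianMGF X c' μ where
  integrable_exp_mul := h.integrable_exp_mul
  mgf_le t := (h.mgf_le t).trans (Real.exp_le_exp.2 (by
    have : (c : ℝ) ≤ c' := by exact_mod_cast hc
    gcongr))

/-- The second moment of a sub-Gaussian variable. -/
lemma integral_sq_le [IsProbabilityMeasure μ] {X : Ω → ℝ} {c : ℝ≥0}
    (hX : HasSubgaussianMGF X c μ) : ∫ ω, X ω ^ 2 ∂μ ≤ 8 * c := by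
  rcases eq_or_ne c 0 with rfl | hc
  · have h0 := hX.ae_eq_zero_of_hasSubgaussianMGF_zero
    rw [integral_congr_ae (g := fun _ => (0 : ℝ)) (h0.mono fun ω h => by simp [h])]
    simp
  have hc' : (0 : ℝ) < c := by positivity
  have ha : (0 : ℝ) ≤ 1 / (4 * c) := by positivity
  have hac : 1 / (4 * (c : ℝ)) * c ≤ 1 / 4 := by field_simp; norm_num
  calc ∫ ω, X ω ^ 2 ∂μ ≤ ∫ ω, 4 * c * Real.exp (1 / (4 * c) * X ω ^ 2) ∂μ := by
        refine integral_mono_of_nonneg (ae_of_all _ fun _ => sq_nonneg _)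
          ((integrable_exp_sq hX ha hac).const_mul _) (ae_of_all _ fun ω => ?_)
        have := Real.add_one_le_exp (1 / (4 * (c : ℝ)) * X ω ^ 2)
        calc X ω ^ 2 = 4 * c * (1 / (4 * (c : ℝ)) * X ω ^ 2) := by field_simp
          _ ≤ _ := mul_le_mul_of_nonneg_left (by linarith) (by positivity)
    _ ≤ 4 * c * 2 := by
        rw [integral_const_mul]
        gcongr
        exact integral_exp_sq_le hX ha hac
    _ = 8 * c := by ring

/-- Second-order Taylor expansion whose quadratic remainder (θv)² exp|θv| is absorbed into an
exponential moment, using (bv)² ≤ 2 exp(b|v|). The linear term is kept so that the mean of v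
survives in `mgf_mul_le`. -/
lemma exp_mul_le_one_add_add {b θ v : ℝ} (hb : 0 < b) (hθ : |θ| ≤ b) :
    Real.exp (θ * v) ≤ 1 + θ * v + 2 / b ^ 2 * θ ^ 2 * Real.exp (2 * b * |v|) := by
  have h1 : Real.exp (θ * v) - (1 + θ * v) ≤ (θ * v) ^ 2 * Real.exp |θ * v| := by
    have h := Complex.norm_exp_sub_sum_le_norm_mul_exp (θ * v : ℝ) 2
    simp only [Finset.sum_range_succ, Finset.sum_range_zero, Complex.norm_real] at h
    norm_num at h
    rw [← Complex.ofReal_mul, ← Complex.ofReal_exp, ← Complex.ofReal_one, ← Complex.ofReal_add,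
      ← Complex.ofReal_sub, Complex.norm_real, Real.norm_eq_abs, ← abs_mul] at h
    refine (le_abs_self _).trans (h.trans (le_of_eq ?_))
    rw [sq_abs]
  have h2 : (b * v) ^ 2 ≤ 2 * Real.exp (b * |v|) := by
    have h := Real.quadratic_le_exp_of_nonneg (x := b * |v|) (by positivity)
    have h3 : (b * |v|) ^ 2 = (b * v) ^ 2 := by rw [mul_pow, sq_abs, mul_pow]
    have : 0 ≤ b * |v| := by positivity
    nlinarith
  have h3 : Real.exp |θ * v| ≤ Real.exp (b * |v|) := by
    rw [abs_mul]
    gcongr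
  have h4 : Real.exp (2 * b * |v|) = Real.exp (b * |v|) * Real.exp (b * |v|) := by
    rw [← Real.exp_add]; ring_nf
  have h5 : (θ * v) ^ 2 * Real.exp |θ * v| ≤
      2 / b ^ 2 * θ ^ 2 * Real.exp (2 * b * |v|) := by
    calc (θ * v) ^ 2 * Real.exp |θ * v| = θ ^ 2 / b ^ 2 * ((b * v) ^ 2 * Real.exp |θ * v|) := by
          field_simp
      _ ≤ θ ^ 2 / b ^ 2 * (2 * Real.exp (b * |v|) * Real.exp (b * |v|)) := by gcongr
      _ = _ := by rw [h4]; ring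
  linarith

lemma exp_abs_mul_le (a x y : ℝ) (ha : 0 ≤ a) :
    Real.exp (a * |x * y|) ≤ Real.exp (a * x ^ 2) + Real.exp (a * y ^ 2) := by
  rw [abs_mul]
  rcases le_total |x| |y| with h | h
  · have : |x| * |y| ≤ y ^ 2 := by rw [← sq_abs y, sq]; gcongr
    have : Real.exp (a * (|x| * |y|)) ≤ Real.exp (a * y ^ 2) := by gcongr
    linarith [Real.exp_pos (a * x ^ 2)]
  · have : |x| * |y| ≤ x ^ 2 := by rw [← sq_abs x, sq]; gcongr
    have : Real.exp (a * (|x| * |y|)) ≤ Real.exp (a * x ^ 2) := by gcongr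
    linarith [Real.exp_pos (a * y ^ 2)]

lemma integrable_mul_of_subgaussian {X Y : Ω → ℝ} {c : ℝ≥0} (hX : HasSubgaussianMGF X c μ)
    (hY : HasSubgaussianMGF Y c μ) : Integrable (fun ω => X ω * Y ω) μ :=
  MemLp.integrable_mul (p := 2) (q := 2) (hX.memLp 2) (hY.memLp 2)

section Product

variable [IsProbabilityMeasure μ] {X Y : Ω → ℝ} {c : ℝ≥0}

lemma integrable_exp_abs_mul (hX : HasSubgaussianMGF X c μ) (hY : HasSubgaussianMGF Y c μ)
    {a : ℝ} (ha : 0 ≤ a) (hac : a * c ≤ 1 / 4) :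
    Integrable (fun ω => Real.exp (a * |X ω * Y ω|)) μ := by
  have h1 := hX.aemeasurable
  have h2 := hY.aemeasurable
  refine ((integrable_exp_sq hX ha hac).add (integrable_exp_sq hY ha hac)).mono' ?_
    (ae_of_all _ fun ω => ?_)
  · have : AEMeasurable (fun ω => |X ω * Y ω|) μ := (h1.mul h2).abs
    exact (Real.measurable_exp.comp_aemeasurable (this.const_mul a)).aestronglyMeasurable
  · rw [Real.norm_eq_abs, Real.abs_exp]
    exact exp_abs_mul_le a _ _ ha

lemma integral_exp_abs_mul_le (hX : HasSubgaussianMGF X c μ) (hY : HasSubgaussianMGF Y c μ)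
    {a : ℝ} (ha : 0 ≤ a) (hac : a * c ≤ 1 / 4) :
    ∫ ω, Real.exp (a * |X ω * Y ω|) ∂μ ≤ 4 := by
  calc ∫ ω, Real.exp (a * |X ω * Y ω|) ∂μ
      ≤ ∫ ω, (Real.exp (a * X ω ^ 2) + Real.exp (a * Y ω ^ 2)) ∂μ :=
        integral_mono (integrable_exp_abs_mul hX hY ha hac)
          ((integrable_exp_sq hX ha hac).add (integrable_exp_sq hY ha hac))
          fun ω => exp_abs_mul_le a _ _ ha
    _ ≤ 2 + 2 := by
        rw [integral_add (integrable_exp_sq hX ha hac) (integrable_exp_sq hY ha hac)]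
        exact add_le_add (integral_exp_sq_le hX ha hac) (integral_exp_sq_le hY ha hac)
    _ = 4 := by norm_num

lemma abs_integral_mul_le (hX : HasSubgaussianMGF X c μ) (hY : HasSubgaussianMGF Y c μ) :
    |∫ ω, X ω * Y ω ∂μ| ≤ 8 * c := by
  have hX2 : Integrable (fun ω => X ω ^ 2) μ := (hX.memLp 2).integrable_sq
  have hY2 : Integrable (fun ω => Y ω ^ 2) μ := (hY.memLp 2).integrable_sq
  have h : ∫ ω, |X ω * Y ω| ∂μ ≤ ∫ ω, (X ω ^ 2 / 2 + Y ω ^ 2 / 2) ∂μ := by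
    refine integral_mono (integrable_mul_of_subgaussian hX hY).abs
      ((hX2.div_const 2).add (hY2.div_const 2)) fun ω => ?_
    simp only [abs_mul]
    nlinarith [sq_nonneg (|X ω| - |Y ω|), sq_abs (X ω), sq_abs (Y ω)]
  rw [integral_add (hX2.div_const 2) (hY2.div_const 2), integral_div, integral_div] at h
  linarith [abs_integral_le_integral_abs (f := fun ω => X ω * Y ω) (μ := μ),
    integral_sq_le hX, integral_sq_le hY]

lemma integrable_exp_mul_mul (hX : HasSubgaussianMGF X c μ) (hY : HasSubgaussianMGF Y c μ)
    (hc : 0 < c) {θ : ℝ} (hθ : |θ| ≤ 1 / (8 * c)) :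
    Integrable (fun ω => Real.exp (θ * (X ω * Y ω))) μ := by
  have hc' : (0 : ℝ) < c := hc
  have h1 := hX.aemeasurable
  have h2 := hY.aemeasurable
  refine (integrable_exp_abs_mul hX hY (a := |θ|) (abs_nonneg _) ?_).mono' ?_
    (ae_of_all _ fun ω => ?_)
  · calc |θ| * (c : ℝ) ≤ 1 / (8 * c) * c := by gcongr
      _ ≤ 1 / 4 := by field_simp; norm_num
  · exact (Real.measurable_exp.comp_aemeasurable ((h1.mul h2).const_mul θ)).aestronglyMeasurable
  · rw [Real.norm_eq_abs, Real.abs_exp, ← abs_mul]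
    exact Real.exp_le_exp.2 (le_abs_self _)

/-- A product of sub-Gaussian variables is sub-exponential, even when they are dependent. With b =
1/(8c) the exponent 2b is exactly the largest one for which the exponential moment of |XY| is
bounded by 4, and 512c² is 4 · 2/b². -/
lemma mgf_mul_le (hX : HasSubgaussianMGF X c μ) (hY : HasSubgaussianMGF Y c μ) (hc : 0 < c)
    {m : ℝ} (hm : |∫ ω, X ω * Y ω ∂μ| ≤ m) {θ : ℝ} (hθ : |θ| ≤ 1 / (8 * c)) :
    mgf (fun ω => X ω * Y ω) μ θ ≤ Real.exp (|θ| * m + 512 * c ^ 2 * θ ^ 2) := by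
  have hc' : (0 : ℝ) < c := hc
  set b : ℝ := 1 / (8 * c) with hb
  have hb0 : 0 < b := by positivity
  have hbc : 2 * b * c ≤ 1 / 4 := by rw [hb]; field_simp; norm_num
  have hi := integrable_exp_abs_mul hX hY (a := 2 * b) (by positivity) hbc
  have hi' := integral_exp_abs_mul_le hX hY (a := 2 * b) (by positivity) hbc
  have hXY := integrable_mul_of_subgaussian hX hY
  have hXYθ : Integrable (fun ω => 1 + θ * (X ω * Y ω)) μ :=
    (integrable_const 1).add (hXY.const_mul θ)
  calc mgf (fun ω => X ω * Y ω) μ θ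
      ≤ ∫ ω, (1 + θ * (X ω * Y ω) + 2 / b ^ 2 * θ ^ 2 * Real.exp (2 * b * |X ω * Y ω|)) ∂μ :=
        integral_mono (integrable_exp_mul_mul hX hY hc hθ) (hXYθ.add (hi.const_mul _))
          fun ω => exp_mul_le_one_add_add hb0 hθ
    _ = 1 + θ * ∫ ω, X ω * Y ω ∂μ +
          2 / b ^ 2 * θ ^ 2 * ∫ ω, Real.exp (2 * b * |X ω * Y ω|) ∂μ := by
        rw [integral_add hXYθ (hi.const_mul _), integral_const_mul,
          integral_add (integrable_const 1) (hXY.const_mul θ), integral_const_mul]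
        simp
    _ ≤ 1 + |θ| * m + 2 / b ^ 2 * θ ^ 2 * 4 := by
        have h : θ * ∫ ω, X ω * Y ω ∂μ ≤ |θ| * m := by
          refine (le_abs_self _).trans ?_
          rw [abs_mul]
          gcongr
        gcongr ?_ + ?_ * ?_
        linarith
    _ = |θ| * m + 512 * c ^ 2 * θ ^ 2 + 1 := by rw [hb]; field_simp; ring
    _ ≤ _ := Real.add_one_le_exp _

end Product

section Sum

variable {n : ℕ} {X Y : Fin n → Ω → ℝ} {c : ℝ≥0}

lemma measure_sum_mul_ge_le (hXm : ∀ i, Measurable (X i))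
    (hYm : ∀ i, Measurable (Y i)) (hX : ∀ i, HasSubgaussianMGF (X i) c μ)
    (hY : ∀ i, HasSubgaussianMGF (Y i) c μ) (hc : 0 < c)
    (hind : iIndepFun (fun i ω => X i ω * Y i ω) μ)
    {m t : ℝ} (hm : ∀ i, |∫ ω, X i ω * Y i ω ∂μ| ≤ m) (ht : 0 ≤ t) (htc : t ≤ 128 * c) :
    μ.real {ω | n * (m + t) ≤ ∑ i, X i ω * Y i ω} ≤ Real.exp (-(n * t ^ 2 / (2048 * c ^ 2))) := by
  have : IsProbabilityMeasure μ := hind.isProbabilityMeasure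
  have hc' : (0 : ℝ) < c := hc
  -- The minimiser of -θt + 512c²θ² in the Chernoff exponent. The condition t ≤ 128c keeps it in the
  -- range |θ| ≤ 1/(8c).
  set θ : ℝ := t / (1024 * c ^ 2) with hθ
  have hθ0 : 0 ≤ θ := by positivity
  have hθc : |θ| ≤ 1 / (8 * c) := by
    rw [abs_of_nonneg hθ0, hθ, div_le_div_iff₀ (by positivity) (by positivity)]
    nlinarith
  have hmeas : ∀ i, Measurable (fun ω => X i ω * Y i ω) := fun i =>
    (hXm i).mul (hYm i)
  have hint : Integrable (fun ω => Real.exp (θ * (∑ i, fun ω => X i ω * Y i ω) ω)) μ := by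
    refine hind.integrable_exp_mul_sum hmeas fun i _ => ?_
    exact integrable_exp_mul_mul (hX i) (hY i) hc hθc
  have h1 := measure_ge_le_exp_mul_mgf (μ := μ) (X := ∑ i, fun ω => X i ω * Y i ω)
    (n * (m + t)) hθ0 hint
  rw [hind.mgf_sum hmeas Finset.univ] at h1
  have h2 : ∏ i, mgf (fun ω => X i ω * Y i ω) μ θ ≤
      ∏ _i : Fin n, Real.exp (|θ| * m + 512 * c ^ 2 * θ ^ 2) :=
    Finset.prod_le_prod (fun i _ => mgf_nonneg) fun i _ => mgf_mul_le (hX i) (hY i) hc (hm i) hθc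
  rw [Finset.prod_const, Finset.card_univ, Fintype.card_fin, ← Real.exp_nat_mul,
    abs_of_nonneg hθ0] at h2
  simp only [Finset.sum_apply] at h1
  refine h1.trans ((mul_le_mul_of_nonneg_left h2 (Real.exp_pos _).le).trans (le_of_eq ?_))
  rw [← Real.exp_add]
  congr 1
  rw [hθ]
  field_simp
  ring

lemma measure_abs_sum_mul_ge_le (hXm : ∀ i, Measurable (X i))
    (hYm : ∀ i, Measurable (Y i)) (hX : ∀ i, HasSubgaussianMGF (X i) c μ)
    (hY : ∀ i, HasSubgaussianMGF (Y i) c μ) (hc : 0 < c)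
    (hind : iIndepFun (fun i ω => X i ω * Y i ω) μ)
    {m t : ℝ} (hm : ∀ i, |∫ ω, X i ω * Y i ω ∂μ| ≤ m) (ht : 0 ≤ t) (htc : t ≤ 128 * c) :
    μ.real {ω | n * (m + t) ≤ |∑ i, X i ω * Y i ω|} ≤
      2 * Real.exp (-(n * t ^ 2 / (2048 * c ^ 2))) := by
  have : IsProbabilityMeasure μ := hind.isProbabilityMeasure
  have h1 := measure_sum_mul_ge_le hXm hYm hX hY hc hind hm ht htc
  have hind' : iIndepFun (fun i ω => (-X i) ω * Y i ω) μ := by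
    have := hind.comp (fun _ x => -x) fun _ => measurable_neg
    convert this using 2 with i
    ext ω
    simp
  have h2 := measure_sum_mul_ge_le (X := fun i => -X i) (fun i => (hXm i).neg) hYm (fun i => (hX i).neg) hY hc hind'
    (fun i => by simpa [integral_neg] using hm i) ht htc
  refine (measureReal_mono (s₂ := {ω | n * (m + t) ≤ ∑ i, X i ω * Y i ω} ∪
    {ω | n * (m + t) ≤ ∑ i, (-X i) ω * Y i ω}) ?_).trans ((measureReal_union_le _ _).trans ?_)
  · intro ω hω
    simp only [Set.mem_ofPred_eq, Set.mem_union, Pi.neg_apply, neg_mul,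
      Finset.sum_neg_distrib] at hω ⊢
    exact le_abs.1 hω
  · linarith

end Sum

/-! ### Bilinear forms of weakly correlated matrices -/

lemma euclidean_norm_sq_eq_dotProduct {b : Type*} [Fintype b] (v : b → ℝ) :
    ‖WithLp.toLp 2 v‖ ^ 2 = v ⬝ᵥ v := by
  rw [EuclideanSpace.norm_sq_eq]
  simp [dotProduct, sq]

lemma norm_mulVec_le_specNorm {a b : Type*} [Fintype a] [Fintype b] [DecidableEq b]
    (A : Matrix a b ℝ) (v : b → ℝ) :
    ‖WithLp.toLp 2 (A *ᵥ v)‖ ≤ specNorm A * ‖WithLp.toLp 2 v‖ :=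
  Matrix.l2_opNorm_mulVec A (WithLp.toLp 2 v)

lemma specNorm_transpose {a b : Type*} [Fintype a] [Fintype b] [DecidableEq a] [DecidableEq b]
    (A : Matrix a b ℝ) : specNorm Aᵀ = specNorm A := by
  have := Matrix.l2_opNorm_conjTranspose A
  rwa [Matrix.conjTranspose_eq_transpose_of_trivial] at this

open scoped Matrix.Norms.L2Operator in
lemma specNorm_nonneg {a b : Type*} [Fintype a] [Fintype b] [DecidableEq b]
    (A : Matrix a b ℝ) : 0 ≤ specNorm A := by
  exact norm_nonneg A

lemma dotProduct_mulVec_self_le {a b : Type*} [Fintype a] [Fintype b] [DecidableEq b]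
    (A : Matrix a b ℝ) (v : b → ℝ) {c : ℝ} (hc : specNorm A ≤ c) :
    A *ᵥ v ⬝ᵥ A *ᵥ v ≤ c ^ 2 * (v ⬝ᵥ v) := by
  rw [← euclidean_norm_sq_eq_dotProduct, ← euclidean_norm_sq_eq_dotProduct, ← mul_pow]
  have := specNorm_nonneg A
  have := norm_mulVec_le_specNorm A v
  gcongr
  exact this.trans (by gcongr)

variable {Ω : Type*} [MeasurableSpace Ω] {μ : Measure Ω}

lemma dotProduct_self_nonneg' {a : Type*} [Fintype a] (v : a → ℝ) : 0 ≤ v ⬝ᵥ v := by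
  simpa using dotProduct_star_self_nonneg v

/-- The form uᵀLZQv is a linear combination of the independent entries of Z with coefficients
(Lᵀu)_i (Qv)_j. Their squares sum to ‖Lᵀu‖²‖Qv‖² ≤ c⁴‖u‖²‖v‖², so the bound involves no dimension
beyond the norms of u and v. -/
lemma WeaklyCorrelatedSubGaussian.bilin {a b : ℕ} {K : ℝ≥0} {c : ℝ}
    {V : Ω → Matrix (Fin a) (Fin b) ℝ} (hV : WeaklyCorrelatedSubGaussian μ K c V)
    (u : Fin a → ℝ) (v : Fin b → ℝ) :
    HasSubgaussianMGF (fun ω => u ⬝ᵥ V ω *ᵥ v)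
      (K * Real.toNNReal (c ^ 4 * (u ⬝ᵥ u) * (v ⬝ᵥ v))) μ := by
  obtain ⟨L, Q, Z, hL, hQ, hZ, hind, hae⟩ := hV
  set r : Fin a × Fin b → ℝ := fun q => (Lᵀ *ᵥ u) q.1 * (Q *ᵥ v) q.2 with hr
  have hq : ∀ q, HasSubgaussianMGF ((fun x => r q * x) ∘ fun ω => Z ω q.1 q.2)
      (⟨r q ^ 2, sq_nonneg (r q)⟩ * K) μ := fun q => (hZ q.1 q.2).const_mul (r q)
  have h1 := HasSubgaussianMGF.sum_of_iIndepFun (s := Finset.univ)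
    (hind.comp (fun q x => r q * x) fun q => by fun_prop)
    fun q _ => hq q
  refine (h1.mono ?_).congr ?_
  · rw [← NNReal.coe_le_coe]
    push_cast
    have h2 : ∑ q, r q ^ 2 = (Lᵀ *ᵥ u ⬝ᵥ Lᵀ *ᵥ u) * (Q *ᵥ v ⬝ᵥ Q *ᵥ v) := by
      simp only [dotProduct, Finset.sum_mul_sum, ← Finset.univ_product_univ, Finset.sum_product, hr]
      exact Finset.sum_congr rfl fun i _ => Finset.sum_congr rfl fun j _ => by ring
    have h3 : ∑ q, r q ^ 2 ≤ c ^ 4 * (u ⬝ᵥ u) * (v ⬝ᵥ v) := by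
      rw [h2]
      calc _ ≤ (c ^ 2 * (u ⬝ᵥ u)) * (c ^ 2 * (v ⬝ᵥ v)) :=
            mul_le_mul (dotProduct_mulVec_self_le _ _ ((specNorm_transpose L).trans_le hL.2.le))
              (dotProduct_mulVec_self_le _ _ hQ.2.le) (dotProduct_self_nonneg' _)
              (mul_nonneg (sq_nonneg _) (dotProduct_self_nonneg' _))
        _ = _ := by ring
    calc _ = (∑ q, r q ^ 2) * K := by
            rw [Finset.sum_mul]; exact Finset.sum_congr rfl fun q _ => rfl
      _ ≤ (c ^ 4 * (u ⬝ᵥ u) * (v ⬝ᵥ v)) * K := by gcongr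
      _ ≤ K * (Real.toNNReal (c ^ 4 * (u ⬝ᵥ u) * (v ⬝ᵥ v)) : ℝ) := by
            rw [mul_comm]
            gcongr
            exact Real.le_coe_toNNReal _
  · filter_upwards [hae] with ω hω
    rw [hω, ← mulVec_mulVec, ← mulVec_mulVec, dotProduct_mulVec, ← mulVec_transpose]
    rw [← Finset.univ_product_univ, Finset.sum_product, dotProduct]
    refine Finset.sum_congr rfl fun i _ => ?_
    rw [show (Z ω *ᵥ Q *ᵥ v) i = ∑ j, Z ω i j * (Q *ᵥ v) j from rfl, Finset.mul_sum]
    refine Finset.sum_congr rfl fun j _ => ?_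
    simp only [hr, Function.comp_apply]
    ring

lemma WeaklyCorrelatedSubGaussian.entry {a b : ℕ} {K : ℝ≥0} {c : ℝ}
    {V : Ω → Matrix (Fin a) (Fin b) ℝ} (hV : WeaklyCorrelatedSubGaussian μ K c V)
    (i : Fin a) (j : Fin b) :
    HasSubgaussianMGF (fun ω => V ω i j) (K * Real.toNNReal (c ^ 4)) μ := by
  simpa using hV.bilin (Pi.single i 1) (Pi.single j 1)

lemma WeaklyCorrelatedSubGaussian.integral_bilin_sq_le [IsProbabilityMeasure μ]
    {a b : ℕ} {K : ℝ≥0} {c : ℝ}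
    {V : Ω → Matrix (Fin a) (Fin b) ℝ} (hV : WeaklyCorrelatedSubGaussian μ K c V)
    (u : Fin a → ℝ) (v : Fin b → ℝ) :
    ∫ ω, (u ⬝ᵥ V ω *ᵥ v) ^ 2 ∂μ ≤ 8 * K * c ^ 4 * (u ⬝ᵥ u) * (v ⬝ᵥ v) := by
  refine (integral_sq_le (hV.bilin u v)).trans (le_of_eq ?_)
  rw [NNReal.coe_mul, Real.coe_toNNReal]
  · ring
  · have := dotProduct_self_nonneg' u
    have := dotProduct_self_nonneg' v
    positivity

/-! ### Events of probability tending to one -/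

section WHP

variable {Ω : ℕ → Type*} [∀ ν, MeasurableSpace (Ω ν)] {μ : ∀ ν, Measure (Ω ν)}

lemma WHP.of_measure_le {P : ∀ ν, Ω ν → Prop} {b : ℕ → ℝ≥0∞}
    (h : ∀ᶠ ν in atTop, μ ν {ω | ¬ P ν ω} ≤ b ν) (hb : Tendsto b atTop (𝓝 0)) : WHP μ P :=
  tendsto_of_tendsto_of_tendsto_of_le_of_le' tendsto_const_nhds hb
    (Eventually.of_forall fun _ => zero_le) h

lemma WHP.mono' {P Q : ∀ ν, Ω ν → Prop} (h : WHP μ P)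
    (hPQ : ∀ᶠ ν in atTop, ∀ ω, P ν ω → Q ν ω) : WHP μ Q :=
  WHP.of_measure_le (hPQ.mono fun _ hν => measure_mono fun _ hω hP => hω (hν _ hP)) h

lemma WHP.and {P Q : ∀ ν, Ω ν → Prop} (hP : WHP μ P) (hQ : WHP μ Q) :
    WHP μ fun ν ω => P ν ω ∧ Q ν ω := by
  refine WHP.of_measure_le (b := fun ν => μ ν {ω | ¬ P ν ω} + μ ν {ω | ¬ Q ν ω})
    (Eventually.of_forall fun ν => ?_) ?_
  · refine (measure_mono fun ω hω => ?_).trans (measure_union_le _ _)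
    simp only [Set.mem_ofPred_eq, Set.mem_union] at hω ⊢
    tauto
  · simpa using Tendsto.add hP hQ

lemma WHP.all {ι : Type*} [Finite ι] {P : ι → ∀ ν, Ω ν → Prop} (h : ∀ i, WHP μ (P i)) :
    WHP μ fun ν ω => ∀ i, P i ν ω := by
  cases nonempty_fintype ι
  refine WHP.of_measure_le (b := fun ν => ∑ i, μ ν {ω | ¬ P i ν ω})
    (Eventually.of_forall fun ν => ?_) ?_
  · refine (measure_mono fun ω hω => ?_).trans (measure_iUnion_fintype_le (μ ν)
      fun i => {ω | ¬ P i ν ω})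
    simpa using hω
  · simpa using tendsto_finsetSum Finset.univ fun i _ => h i

end WHP

/-! ### Uniform concentration of averages of products -/

/-- Bernstein bound and union bound. The deterministic switch `A` restricts the claim to the indices
at which log p / n ≤ 1, where the deviation stays in the sub-Gaussian regime; it is used with `A`
saying that the support is nonempty. -/
lemma whp_forall_abs_sum_mul_le {Ω : ℕ → Type*} [∀ ν, MeasurableSpace (Ω ν)]
    {μ : ∀ ν, Measure (Ω ν)} [∀ ν, IsProbabilityMeasure (μ ν)]
    {n : ℕ → ℕ} {p : ℕ → ℝ} (hn : Tendsto n atTop atTop) (hp : Tendsto p atTop atTop)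
    {Q : ℕ → Type*} [∀ ν, Fintype (Q ν)] {k : ℝ}
    (hQ : ∀ᶠ ν in atTop, (Fintype.card (Q ν) : ℝ) ≤ k * p ν)
    {X Y : ∀ ν, Q ν → Fin (n ν) → Ω ν → ℝ} {c : ℝ≥0} (hc : 0 < c)
    (hXm : ∀ ν q i, Measurable (X ν q i)) (hYm : ∀ ν q i, Measurable (Y ν q i))
    (hX : ∀ ν q i, HasSubgaussianMGF (X ν q i) c (μ ν))
    (hY : ∀ ν q i, HasSubgaussianMGF (Y ν q i) c (μ ν))
    (hind : ∀ ν q, iIndepFun (fun i ω => X ν q i ω * Y ν q i ω) (μ ν))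
    {m : ℕ → ℝ} (hm : ∀ ν q i, |∫ ω, X ν q i ω * Y ν q i ω ∂(μ ν)| ≤ m ν)
    {A : ℕ → Prop} (hA : ∀ᶠ ν in atTop, A ν → Real.log (p ν) / n ν ≤ 1) :
    WHP μ fun ν ω => A ν → ∀ q, |∑ i, X ν q i ω * Y ν q i ω| ≤
      n ν * (m ν + 64 * c * √(Real.log (p ν) / n ν)) := by
  have hc' : (0 : ℝ) < c := hc
  refine WHP.of_measure_le (b := fun ν => ENNReal.ofReal (2 * k / p ν)) ?_ ?_
  swap
  · rw [← ENNReal.ofReal_zero]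
    exact (ENNReal.continuous_ofReal.tendsto 0).comp (hp.const_div_atTop (2 * k))
  filter_upwards [hA, hQ, hp.eventually_ge_atTop 1, hn.eventually_ge_atTop 1] with ν hA hQ hp1 hn1
  by_cases hAν : A ν
  swap
  · simp [hAν]
  specialize hA hAν
  have hn0 : (0 : ℝ) < n ν := by exact_mod_cast hn1
  have hlog : 0 ≤ Real.log (p ν) := Real.log_nonneg hp1
  set t : ℝ := 64 * c * √(Real.log (p ν) / n ν) with ht
  have ht0 : 0 ≤ t := by positivity
  have htc : t ≤ 128 * c := by
    have : √(Real.log (p ν) / n ν) ≤ 1 := Real.sqrt_le_one.2 hA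
    nlinarith
  -- The factor 64 makes the exponent 2 log p, since 64² = 2 · 2048. A union over at most kp indices
  -- then leaves 2k/p.
  have hexp : Real.exp (-(n ν * t ^ 2 / (2048 * c ^ 2))) = 1 / p ν ^ 2 := by
    have h1 : (n ν : ℝ) * t ^ 2 / (2048 * c ^ 2) = Real.log (p ν ^ 2) := by
      rw [ht, mul_pow, Real.sq_sqrt (by positivity), Real.log_pow]
      field_simp
      push_cast
      ring
    rw [h1, Real.exp_neg, Real.exp_log (by positivity), one_div]
  have hq : ∀ q, μ ν {ω | n ν * (m ν + t) ≤ |∑ i, X ν q i ω * Y ν q i ω|} ≤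
      ENNReal.ofReal (2 / p ν ^ 2) := fun q => by
    have h := measure_abs_sum_mul_ge_le (hXm ν q) (hYm ν q) (hX ν q) (hY ν q) hc (hind ν q)
      (hm ν q) ht0 htc
    rw [hexp, mul_one_div] at h
    rw [← ofReal_measureReal]
    exact ENNReal.ofReal_le_ofReal h
  calc μ ν {ω | ¬ (A ν → ∀ q, |∑ i, X ν q i ω * Y ν q i ω| ≤ n ν * (m ν + t))}
      ≤ μ ν (⋃ q, {ω | n ν * (m ν + t) ≤ |∑ i, X ν q i ω * Y ν q i ω|}) := by
        refine measure_mono fun ω hω => ?_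
        simp only [Set.mem_ofPred_eq, Classical.not_imp, not_forall, not_le] at hω
        obtain ⟨_, q, hq⟩ := hω
        exact Set.mem_iUnion.2 ⟨q, hq.le⟩
    _ ≤ ∑ q, μ ν {ω | n ν * (m ν + t) ≤ |∑ i, X ν q i ω * Y ν q i ω|} :=
        measure_iUnion_fintype_le _ _
    _ ≤ ∑ _q : Q ν, ENNReal.ofReal (2 / p ν ^ 2) := Finset.sum_le_sum fun q _ => hq q
    _ = ENNReal.ofReal (Fintype.card (Q ν) * (2 / p ν ^ 2)) := by
        rw [Finset.sum_const, Finset.card_univ, nsmul_eq_mul, ENNReal.ofReal_mul (by positivity),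
          ENNReal.ofReal_natCast]
    _ ≤ ENNReal.ofReal (2 * k / p ν) := by
        apply ENNReal.ofReal_le_ofReal
        calc (Fintype.card (Q ν) : ℝ) * (2 / p ν ^ 2) ≤ k * p ν * (2 / p ν ^ 2) := by
              gcongr
          _ = 2 * k / p ν := by field_simp

/-! ### Projected idiosyncratic components -/

section Projection

variable {Ω : Type*} [MeasurableSpace Ω] {μ : Measure Ω} [IsProbabilityMeasure μ]

lemma dotProduct_self_le_of_abs_le {a : ℕ} {u : Fin a → ℝ} {w : ℝ} (hu : ∀ i, |u i| ≤ w) :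
    u ⬝ᵥ u ≤ a * w ^ 2 := by
  calc u ⬝ᵥ u ≤ ∑ _i : Fin a, w ^ 2 := Finset.sum_le_sum fun i _ => by
        rw [← sq, ← sq_abs]
        have := hu i
        gcongr
    _ = a * w ^ 2 := by simp

/-- Independence allows freezing the weights u, v by Tonelli, after which the second-moment bound
for deterministic vectors applies. The indicator truncates to bounded weights because boundedness is
only assumed with high probability. -/
lemma setLIntegral_bilin_sq_le {a b : ℕ} {K : ℝ≥0} {c w : ℝ}
    {V : Ω → Matrix (Fin a) (Fin b) ℝ} (hV : WeaklyCorrelatedSubGaussian μ K c V)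
    (hVm : ∀ i j, Measurable fun ω => V ω i j)
    {u : Ω → Fin a → ℝ} {v : Ω → Fin b → ℝ} (hum : Measurable u) (hvm : Measurable v)
    (hind : IndepFun (fun ω => (u ω, v ω)) (fun ω (q : Fin a × Fin b) => V ω q.1 q.2) μ) :
    ∫⁻ ω, {ω | (∀ i, |u ω i| ≤ w) ∧ ∀ j, |v ω j| ≤ w}.indicator
      (fun ω => ENNReal.ofReal ((u ω ⬝ᵥ V ω *ᵥ v ω) ^ 2)) ω ∂μ ≤
      ENNReal.ofReal (8 * K * c ^ 4 * (a * w ^ 2) * (b * w ^ 2)) := by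
  set G : Set ((Fin a → ℝ) × (Fin b → ℝ)) := {x | (∀ i, |x.1 i| ≤ w) ∧ ∀ j, |x.2 j| ≤ w} with hG
  have hGm : MeasurableSet G := by
    have h : G = (⋂ i, {x | |x.1 i| ≤ w}) ∩ ⋂ j, {x | |x.2 j| ≤ w} := by
      ext x
      simp [hG]
    rw [h]
    have h1 : ∀ i, MeasurableSet {x : (Fin a → ℝ) × (Fin b → ℝ) | |x.1 i| ≤ w} := fun i =>
      measurableSet_le (((measurable_pi_apply i).comp measurable_fst).abs) measurable_const
    have h2 : ∀ j, MeasurableSet {x : (Fin a → ℝ) × (Fin b → ℝ) | |x.2 j| ≤ w} := fun j =>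
      measurableSet_le (((measurable_pi_apply j).comp measurable_snd).abs) measurable_const
    exact (MeasurableSet.iInter h1).inter (MeasurableSet.iInter h2)
  set Vv : Ω → (Fin a × Fin b → ℝ) := fun ω q => V ω q.1 q.2 with hVv
  have hVvm : Measurable Vv := measurable_pi_lambda _ fun q => hVm q.1 q.2
  have huvm : Measurable fun ω => (u ω, v ω) := hum.prodMk hvm
  set g : ((Fin a → ℝ) × (Fin b → ℝ)) → (Fin a × Fin b → ℝ) → ℝ≥0∞ := fun x z =>
    ENNReal.ofReal ((∑ i, ∑ j, x.1 i * (z (i, j) * x.2 j)) ^ 2) with hg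
  have hgm : Measurable fun y : ((Fin a → ℝ) × (Fin b → ℝ)) × (Fin a × Fin b → ℝ) =>
      G.indicator (fun x => g x y.2) y.1 := by
    have : (fun y : ((Fin a → ℝ) × (Fin b → ℝ)) × (Fin a × Fin b → ℝ) =>
      G.indicator (fun x => g x y.2) y.1) = (Prod.fst ⁻¹' G).indicator fun y => g y.1 y.2 := by
      ext y
      simp only [Set.indicator, Set.mem_preimage]
    rw [this]
    refine Measurable.indicator ?_ (measurable_fst hGm)
    simp only [hg]
    fun_prop
  have hgV : ∀ x ω, g x (Vv ω) = ENNReal.ofReal ((x.1 ⬝ᵥ V ω *ᵥ x.2) ^ 2) := fun x ω => by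
    simp only [hg, hVv, dotProduct, mulVec, Finset.mul_sum]
  have hmap := (indepFun_iff_map_prod_eq_prod_map_map huvm.aemeasurable hVvm.aemeasurable).1 hind
  calc _ = ∫⁻ ω, G.indicator (fun x => g x (Vv ω)) (u ω, v ω) ∂μ := by
        refine lintegral_congr fun ω => ?_
        simp only [Set.indicator, hG, Set.mem_ofPred_eq, hgV]
    _ = ∫⁻ y, G.indicator (fun x => g x y.2) y.1 ∂(μ.map fun ω => ((u ω, v ω), Vv ω)) := by
        rw [lintegral_map hgm (huvm.prodMk hVvm)]
    _ = ∫⁻ x, ∫⁻ z, G.indicator (fun x => g x z) x ∂(μ.map Vv) ∂(μ.map fun ω => (u ω, v ω)) := by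
        have := Measure.isProbabilityMeasure_map (μ := μ) hVvm.aemeasurable
        have := Measure.isProbabilityMeasure_map (μ := μ) huvm.aemeasurable
        rw [hmap, lintegral_prod _ hgm.aemeasurable]
    _ ≤ ∫⁻ _x, ENNReal.ofReal (8 * K * c ^ 4 * (a * w ^ 2) * (b * w ^ 2))
          ∂(μ.map fun ω => (u ω, v ω)) := by
        refine lintegral_mono fun x => ?_
        by_cases hx : x ∈ G
        swap
        · simp [hx]
        simp only [hx, Set.indicator_of_mem]
        have hgx : Measurable (g x) := by simp only [hg]; fun_prop
        rw [lintegral_map hgx hVvm]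
        simp only [hgV]
        rw [← ofReal_integral_eq_lintegral_ofReal ((hV.bilin x.1 x.2).memLp 2).integrable_sq
          (ae_of_all _ fun _ => sq_nonneg _)]
        apply ENNReal.ofReal_le_ofReal
        refine (hV.integral_bilin_sq_le x.1 x.2).trans ?_
        have h1 := dotProduct_self_le_of_abs_le hx.1
        have h2 := dotProduct_self_le_of_abs_le hx.2
        have h3 := dotProduct_self_nonneg' x.1
        have h4 := dotProduct_self_nonneg' x.2
        gcongr
    _ = _ := by
        have := Measure.isProbabilityMeasure_map (μ := μ) huvm.aemeasurable
        simp

lemma factorHat_apply {n p₁ p₂ k₁ k₂ : ℕ} (W₁ : Matrix (Fin p₁) (Fin k₁) ℝ)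
    (W₂ : Matrix (Fin p₂) (Fin k₂) ℝ) (X : Fin n → Matrix (Fin p₁) (Fin p₂) ℝ) (i : Fin n)
    (α : Fin k₁) (β : Fin k₂) :
    factorHat W₁ W₂ X i α β =
      1 / ((p₁ : ℝ) * p₂) * ((fun a => W₁ a α) ⬝ᵥ X i *ᵥ fun b => W₂ b β) := by
  rw [factorHat, Matrix.smul_apply, smul_eq_mul, Matrix.mul_assoc]
  rfl

/-- Markov's inequality. The normalisation (p₁p₂)⁻² meets a second moment of order p₁p₂, which
leaves the factor 1/(p₁p₂): projecting averages the idiosyncratic components out. -/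
lemma measure_sum_factorHat_sq_le {n p₁ p₂ k₁ k₂ : ℕ} {K : ℝ≥0} {c w : ℝ}
    (hp₁ : 0 < p₁) (hp₂ : 0 < p₂)
    {U : Ω → Fin n → Matrix (Fin p₁) (Fin p₂) ℝ}
    (hU : ∀ i, WeaklyCorrelatedSubGaussian μ K c fun ω => U ω i)
    (hUm : ∀ i a b, Measurable fun ω => U ω i a b)
    {W₁ : Ω → Matrix (Fin p₁) (Fin k₁) ℝ} {W₂ : Ω → Matrix (Fin p₂) (Fin k₂) ℝ}
    (hW₁m : ∀ a b, Measurable fun ω => W₁ ω a b) (hW₂m : ∀ a b, Measurable fun ω => W₂ ω a b)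
    (hind : ∀ i, IndepFun (fun ω => ((fun q : Fin p₁ × Fin k₁ => W₁ ω q.1 q.2),
        (fun q : Fin p₂ × Fin k₂ => W₂ ω q.1 q.2)))
      (fun ω (q : Fin p₁ × Fin p₂) => U ω i q.1 q.2) μ)
    (α : Fin k₁) (β : Fin k₂) {t : ℝ} (ht : 0 < t) :
    μ {ω | ((∀ a α, |W₁ ω a α| ≤ w) ∧ ∀ b β, |W₂ ω b β| ≤ w) ∧
      t < ∑ i, factorHat (W₁ ω) (W₂ ω) (U ω) i α β ^ 2} ≤
      ENNReal.ofReal (n * (8 * K * c ^ 4 * w ^ 4 / ((p₁ : ℝ) * p₂)) / t) := by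
  set u : Ω → Fin p₁ → ℝ := fun ω a => W₁ ω a α with hu
  set v : Ω → Fin p₂ → ℝ := fun ω b => W₂ ω b β with hv
  have hum : Measurable u := measurable_pi_lambda _ fun a => hW₁m a α
  have hvm : Measurable v := measurable_pi_lambda _ fun b => hW₂m b β
  set G : Set Ω := {ω | (∀ i, |u ω i| ≤ w) ∧ ∀ j, |v ω j| ≤ w} with hG
  have hGm : MeasurableSet G := by
    have h : G = (⋂ i, {ω | |u ω i| ≤ w}) ∩ ⋂ j, {ω | |v ω j| ≤ w} := by
      ext x
      simp [hG]
    rw [h]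
    exact (MeasurableSet.iInter fun i => measurableSet_le (hW₁m i α).abs measurable_const).inter
      (MeasurableSet.iInter fun j => measurableSet_le (hW₂m j β).abs measurable_const)
  have hbm : ∀ i, Measurable fun ω => u ω ⬝ᵥ U ω i *ᵥ v ω := fun i => by
    simp only [dotProduct, mulVec]
    refine Finset.measurable_fun_sum _ fun a _ => (hW₁m a α).mul ?_
    exact Finset.measurable_fun_sum _ fun b _ => (hUm i a b).mul (hW₂m b β)
  have hfm : ∀ i, Measurable (G.indicator fun ω => ENNReal.ofReal ((u ω ⬝ᵥ U ω i *ᵥ v ω) ^ 2)) :=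
    fun i => (((hbm i).pow_const 2).ennreal_ofReal).indicator hGm
  have hint : ∀ i, ∫⁻ ω, G.indicator (fun ω => ENNReal.ofReal ((u ω ⬝ᵥ U ω i *ᵥ v ω) ^ 2)) ω ∂μ ≤
      ENNReal.ofReal (8 * K * c ^ 4 * (p₁ * w ^ 2) * (p₂ * w ^ 2)) := fun i =>
    setLIntegral_bilin_sq_le (hU i) (hUm i) hum hvm
      ((hind i).comp (φ := fun x : (Fin p₁ × Fin k₁ → ℝ) × (Fin p₂ × Fin k₂ → ℝ) =>
        ((fun a => x.1 (a, α)), fun b => x.2 (b, β))) (ψ := id) (by fun_prop) measurable_id)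
  set f : Ω → ℝ≥0∞ := fun ω => ∑ i,
    G.indicator (fun ω => ENNReal.ofReal ((u ω ⬝ᵥ U ω i *ᵥ v ω) ^ 2)) ω with hf
  have hp : (0 : ℝ) < (p₁ : ℝ) * p₂ := by positivity
  have hfint : ∫⁻ ω, f ω ∂μ ≤
      ENNReal.ofReal (n * (8 * K * c ^ 4 * (p₁ * w ^ 2) * (p₂ * w ^ 2))) := by
    simp only [hf]
    rw [lintegral_finsetSum _ fun i _ => hfm i]
    refine (Finset.sum_le_sum fun i _ => hint i).trans (le_of_eq ?_)
    rw [Finset.sum_const, Finset.card_univ, nsmul_eq_mul, Fintype.card_fin,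
      ENNReal.ofReal_mul (p := (n : ℝ)) (by positivity), ENNReal.ofReal_natCast]
  have ht' : 0 < t * ((p₁ : ℝ) * p₂) ^ 2 := by positivity
  calc _ ≤ μ {ω | ENNReal.ofReal (t * ((p₁ : ℝ) * p₂) ^ 2) ≤ f ω} := by
        refine measure_mono fun ω hω => ?_
        simp only [Set.mem_ofPred_eq] at hω ⊢
        have hωG : ω ∈ G := ⟨fun a => hω.1.1 a α, fun b => hω.1.2 b β⟩
        simp only [hf, Set.indicator_of_mem hωG]
        rw [← ENNReal.ofReal_sum_of_nonneg fun _ _ => sq_nonneg _]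
        apply ENNReal.ofReal_le_ofReal
        have h := hω.2.le
        simp only [factorHat_apply, mul_pow] at h
        rw [← Finset.mul_sum, one_div, inv_pow, inv_mul_eq_div, le_div_iff₀ (by positivity)] at h
        simpa [mul_pow] using h
    _ ≤ (∫⁻ ω, f ω ∂μ) / ENNReal.ofReal (t * ((p₁ : ℝ) * p₂) ^ 2) :=
        meas_ge_le_lintegral_div (Finset.measurable_fun_sum _ fun i _ => hfm i).aemeasurable
          (by simpa using ht') (by simp)
    _ ≤ ENNReal.ofReal (n * (8 * K * c ^ 4 * (p₁ * w ^ 2) * (p₂ * w ^ 2))) /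
          ENNReal.ofReal (t * ((p₁ : ℝ) * p₂) ^ 2) := by gcongr
    _ = _ := by
        rw [← ENNReal.ofReal_div_of_pos ht']
        congr 1
        field_simp

end Projection

lemma abs_le_maxNorm {a b : Type*} [Fintype a] [Fintype b] (A : Matrix a b ℝ) (i : a) (j : b) :
    |A i j| ≤ maxNorm A :=
  norm_le_pi_norm (fun q : a × b => A q.1 q.2) (i, j)

lemma whp_factorHat_sq_le {Ω : ℕ → Type*} [∀ ν, MeasurableSpace (Ω ν)]
    {μ : ∀ ν, Measure (Ω ν)} [∀ ν, IsProbabilityMeasure (μ ν)]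
    {k₁ k₂ : ℕ} {n p₁ p₂ : ℕ → ℕ} (hn : Tendsto n atTop atTop)
    (hp₁ : Tendsto p₁ atTop atTop) (hp₂ : Tendsto p₂ atTop atTop) {K : ℝ≥0} {c w : ℝ}
    {U : ∀ ν, Ω ν → Fin (n ν) → Matrix (Fin (p₁ ν)) (Fin (p₂ ν)) ℝ}
    (hU : ∀ ν i, WeaklyCorrelatedSubGaussian (μ ν) K c fun ω => U ν ω i)
    (hUm : ∀ ν i a b, Measurable fun ω => U ν ω i a b)
    {W₁ : ∀ ν, Ω ν → Matrix (Fin (p₁ ν)) (Fin k₁) ℝ}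
    {W₂ : ∀ ν, Ω ν → Matrix (Fin (p₂ ν)) (Fin k₂) ℝ}
    (hW₁m : ∀ ν a b, Measurable fun ω => W₁ ν ω a b)
    (hW₂m : ∀ ν a b, Measurable fun ω => W₂ ν ω a b)
    (hind : ∀ ν i, IndepFun (fun ω => ((fun q : Fin (p₁ ν) × Fin k₁ => W₁ ν ω q.1 q.2),
        (fun q : Fin (p₂ ν) × Fin k₂ => W₂ ν ω q.1 q.2)))
      (fun ω (q : Fin (p₁ ν) × Fin (p₂ ν)) => U ν ω i q.1 q.2) (μ ν))
    (hW : WHP μ fun ν ω => maxNorm (W₁ ν ω) < w ∧ maxNorm (W₂ ν ω) < w)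
    {r : ℕ → ℝ} (hr : ∀ ν, 0 < r ν)
    (hrp : Tendsto (fun ν => r ν / ((p₁ ν : ℝ) * p₂ ν)) atTop (𝓝 0)) {e : ℝ} (he : 0 < e) :
    WHP μ fun ν ω => ∀ (α : Fin k₁) (β : Fin k₂),
      r ν * ((1 / (n ν : ℝ)) * ∑ i, factorHat (W₁ ν ω) (W₂ ν ω) (U ν ω) i α β ^ 2) ≤ e := by
  refine WHP.all fun α => WHP.all fun β => ?_
  refine WHP.of_measure_le (b := fun ν => μ ν {ω | ¬ (maxNorm (W₁ ν ω) < w ∧ maxNorm (W₂ ν ω) < w)}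
    + ENNReal.ofReal (8 * K * c ^ 4 * w ^ 4 / e * (r ν / ((p₁ ν : ℝ) * p₂ ν)))) ?_ ?_
  swap
  · have h2 := (ENNReal.continuous_ofReal.tendsto _).comp (hrp.const_mul (8 * K * c ^ 4 * w ^ 4 / e))
    rw [mul_zero, ENNReal.ofReal_zero] at h2
    simpa using Tendsto.add hW h2
  filter_upwards [hn.eventually_ge_atTop 1, hp₁.eventually_ge_atTop 1, hp₂.eventually_ge_atTop 1]
    with ν hn1 hp1 hp2
  have hn0 : (0 : ℝ) < n ν := by exact_mod_cast hn1
  have hr0 := hr ν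
  have ht : 0 < e * n ν / r ν := by positivity
  refine (measure_mono fun ω hω => ?_).trans ((measure_union_le _ _).trans
    (add_le_add le_rfl ((measure_sum_factorHat_sq_le (w := w) hp1 hp2 (hU ν) (hUm ν) (hW₁m ν)
      (hW₂m ν) (hind ν) α β ht).trans (le_of_eq ?_))))
  · simp only [Set.mem_ofPred_eq, Set.mem_union, not_le] at hω ⊢
    by_cases h : maxNorm (W₁ ν ω) < w ∧ maxNorm (W₂ ν ω) < w
    · refine Or.inr ⟨⟨fun a α => (abs_le_maxNorm _ _ _).trans h.1.le,
        fun a α => (abs_le_maxNorm _ _ _).trans h.2.le⟩, ?_⟩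
      rw [div_lt_iff₀ hr0]
      rw [← mul_assoc, mul_one_div, div_mul_eq_mul_div, lt_div_iff₀ hn0] at hω
      linarith
    · exact Or.inl h
  · congr 1
    field_simp

/-! ### Euclidean norms and orthogonal projections -/

/-- Euclidean norm of a vector. -/
noncomputable def eucl {ι : Type*} [Fintype ι] (v : ι → ℝ) : ℝ := ‖WithLp.toLp 2 v‖

section Euclidean

variable {ι κ : Type*} [Fintype ι] [Fintype κ]

lemma eucl_nonneg (v : ι → ℝ) : 0 ≤ eucl v := norm_nonneg _

lemma eucl_sq (v : ι → ℝ) : eucl v ^ 2 = v ⬝ᵥ v := euclidean_norm_sq_eq_dotProduct v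

lemma eucl_add_le (v w : ι → ℝ) : eucl (v + w) ≤ eucl v + eucl w :=
  norm_add_le (WithLp.toLp 2 v) (WithLp.toLp 2 w)

lemma eucl_sub_le (v w : ι → ℝ) : eucl (v - w) ≤ eucl v + eucl w :=
  norm_sub_le (WithLp.toLp 2 v) (WithLp.toLp 2 w)

lemma eucl_eq_zero {v : ι → ℝ} (h : eucl v = 0) : v = 0 := by
  have := norm_eq_zero.1 h
  simpa using this

lemma abs_dotProduct_le (v w : ι → ℝ) : |v ⬝ᵥ w| ≤ eucl v * eucl w := by
  have := abs_real_inner_le_norm (WithLp.toLp 2 w) (WithLp.toLp 2 v)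
  rw [mul_comm]
  simpa [EuclideanSpace.inner_eq_star_dotProduct, eucl] using this

lemma eucl_mulVec_le (A : Matrix ι κ ℝ) (x : κ → ℝ) {e : ℝ} (hA : ∀ k, eucl (fun i => A i k) ≤ e) :
    eucl (A *ᵥ x) ≤ e * ∑ k, |x k| := by
  have h : WithLp.toLp 2 (A *ᵥ x) = ∑ k, x k • WithLp.toLp 2 fun i => A i k := by
    ext i
    simp [mulVec, dotProduct, mul_comm]
  unfold eucl
  rw [h, Finset.mul_sum]
  refine (norm_sum_le _ _).trans (Finset.sum_le_sum fun k _ => ?_)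
  rw [norm_smul, mul_comm, Real.norm_eq_abs]
  exact mul_le_mul_of_nonneg_right (hA k) (abs_nonneg _)

lemma sum_abs_le_sqrt_card_mul_eucl (x : κ → ℝ) : ∑ k, |x k| ≤ √(Fintype.card κ) * eucl x := by
  have h := sq_sum_le_card_mul_sum_sq (s := Finset.univ) (f := fun k => |x k|)
  refine abs_le_of_sq_le_sq' ?_ (mul_nonneg (Real.sqrt_nonneg _) (eucl_nonneg _)) |>.2
  rw [mul_pow, Real.sq_sqrt (by positivity), eucl_sq]
  simpa [dotProduct, ← sq] using h

lemma eucl_le_sqrt_card_mul (x : κ → ℝ) {r : ℝ} (hr : 0 ≤ r) (hx : ∀ k, |x k| ≤ r) :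
    eucl x ≤ √(Fintype.card κ) * r := by
  refine abs_le_of_sq_le_sq' ?_ (mul_nonneg (Real.sqrt_nonneg _) hr) |>.2
  rw [mul_pow, Real.sq_sqrt (by positivity), eucl_sq, dotProduct]
  calc ∑ k, x k * x k ≤ ∑ _k : κ, r ^ 2 := Finset.sum_le_sum fun k _ => by
        rw [← sq, ← sq_abs]
        have := hx k
        gcongr
    _ = _ := by simp

variable [DecidableEq κ]

/-- Orthogonal projection onto the column space of a matrix of full column rank. -/
noncomputable def hatMatrix (A : Matrix ι κ ℝ) : Matrix ι ι ℝ := A * (Aᵀ * A)⁻¹ * Aᵀ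

lemma hatMatrix_transpose (A : Matrix ι κ ℝ) : (hatMatrix A)ᵀ = hatMatrix A := by
  simp [hatMatrix, transpose_nonsing_inv, Matrix.mul_assoc]

lemma hatMatrix_mulVec (A : Matrix ι κ ℝ) (v : ι → ℝ) :
    hatMatrix A *ᵥ v = A *ᵥ ((Aᵀ * A)⁻¹ *ᵥ (Aᵀ *ᵥ v)) := by
  simp [hatMatrix, mulVec_mulVec, Matrix.mul_assoc]

lemma dotProduct_hatMatrix_mulVec (A : Matrix ι κ ℝ) (v w : ι → ℝ) :
    v ⬝ᵥ hatMatrix A *ᵥ w = hatMatrix A *ᵥ v ⬝ᵥ w := by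
  rw [dotProduct_mulVec, ← mulVec_transpose, hatMatrix_transpose]

variable {A : Matrix ι κ ℝ} (hA : IsUnit (Aᵀ * A).det)
include hA

lemma hatMatrix_mul_self : hatMatrix A * A = A := by
  rw [hatMatrix, Matrix.mul_assoc, Matrix.mul_assoc, nonsing_inv_mul _ hA, Matrix.mul_one]

lemma hatMatrix_mulVec_mulVec (x : κ → ℝ) : hatMatrix A *ᵥ (A *ᵥ x) = A *ᵥ x := by
  rw [mulVec_mulVec, hatMatrix_mul_self hA]

lemma hatMatrix_mulVec_idem (v : ι → ℝ) :
    hatMatrix A *ᵥ (hatMatrix A *ᵥ v) = hatMatrix A *ᵥ v := by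
  rw [hatMatrix_mulVec A v, hatMatrix_mulVec_mulVec hA]

lemma hatMatrix_dotProduct (v w : ι → ℝ) :
    hatMatrix A *ᵥ v ⬝ᵥ hatMatrix A *ᵥ w = hatMatrix A *ᵥ v ⬝ᵥ w := by
  rw [dotProduct_hatMatrix_mulVec, hatMatrix_mulVec_idem hA]

lemma sub_hatMatrix_dotProduct (v w : ι → ℝ) :
    (v - hatMatrix A *ᵥ v) ⬝ᵥ (w - hatMatrix A *ᵥ w) = v ⬝ᵥ (w - hatMatrix A *ᵥ w) := by
  rw [sub_dotProduct, dotProduct_sub (hatMatrix A *ᵥ v), hatMatrix_dotProduct hA, sub_self,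
    sub_zero]

lemma eucl_hatMatrix_sq_add (v : ι → ℝ) :
    eucl (hatMatrix A *ᵥ v) ^ 2 + eucl (v - hatMatrix A *ᵥ v) ^ 2 = eucl v ^ 2 := by
  rw [eucl_sq, eucl_sq, eucl_sq, hatMatrix_dotProduct hA, sub_hatMatrix_dotProduct hA,
    dotProduct_sub, dotProduct_comm (hatMatrix A *ᵥ v)]
  ring

lemma eucl_hatMatrix_le (v : ι → ℝ) : eucl (hatMatrix A *ᵥ v) ≤ eucl v := by
  refine abs_le_of_sq_le_sq' ?_ (eucl_nonneg _) |>.2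
  nlinarith [eucl_hatMatrix_sq_add hA v, sq_nonneg (eucl (v - hatMatrix A *ᵥ v))]

lemma eucl_sub_hatMatrix_le (v : ι → ℝ) : eucl (v - hatMatrix A *ᵥ v) ≤ eucl v := by
  refine abs_le_of_sq_le_sq' ?_ (eucl_nonneg _) |>.2
  nlinarith [eucl_hatMatrix_sq_add hA v, sq_nonneg (eucl (hatMatrix A *ᵥ v))]

/-- With Pv = Ax one has ‖Pv‖² = ⟨x, Aᵀv⟩ ≤ ‖x‖‖Aᵀv‖ and ‖x‖ ≤ ‖Pv‖/c. A vector nearly orthogonal to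
the columns of a well-conditioned A thus has a small projection. -/
lemma eucl_hatMatrix_le_of_lower_bound {c : ℝ} (hc : 0 < c)
    (hAc : ∀ x, c * eucl x ≤ eucl (A *ᵥ x)) (v : ι → ℝ) :
    eucl (hatMatrix A *ᵥ v) ≤ eucl (Aᵀ *ᵥ v) / c := by
  set x := (Aᵀ * A)⁻¹ *ᵥ (Aᵀ *ᵥ v) with hx
  have h1 : hatMatrix A *ᵥ v = A *ᵥ x := hatMatrix_mulVec A v
  have h2 : eucl (A *ᵥ x) ^ 2 ≤ eucl x * eucl (Aᵀ *ᵥ v) := by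
    rw [eucl_sq, ← h1, hatMatrix_dotProduct hA, h1]
    refine le_trans (le_of_eq ?_) ((le_abs_self _).trans (abs_dotProduct_le x (Aᵀ *ᵥ v)))
    rw [dotProduct_mulVec x, ← mulVec_transpose, transpose_transpose]
  rw [h1, le_div_iff₀ hc]
  have h3 := hAc x
  have h4 := eucl_nonneg (Aᵀ *ᵥ v)
  have h5 := eucl_nonneg (A *ᵥ x)
  rcases h5.eq_or_lt with h | h
  · rw [← h]; simpa using h4
  · have : eucl (A *ᵥ x) * (eucl (A *ᵥ x) * c) ≤ eucl (A *ᵥ x) * eucl (Aᵀ *ᵥ v) := by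
      calc eucl (A *ᵥ x) * (eucl (A *ᵥ x) * c) = c * eucl (A *ᵥ x) ^ 2 := by ring
        _ ≤ c * (eucl x * eucl (Aᵀ *ᵥ v)) := by gcongr
        _ = c * eucl x * eucl (Aᵀ *ᵥ v) := by ring
        _ ≤ _ := by gcongr
    exact le_of_mul_le_mul_left this h

end Euclidean

lemma isUnit_det_gram_of_lower_bound {ι κ : Type*} [Fintype ι] [Fintype κ] [DecidableEq κ]
    {A : Matrix ι κ ℝ} {c : ℝ} (hc : 0 < c) (hAc : ∀ x, c * eucl x ≤ eucl (A *ᵥ x)) :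
    IsUnit (Aᵀ * A).det := by
  rw [← Matrix.isUnit_iff_isUnit_det, ← Matrix.mulVec_injective_iff_isUnit]
  rw [← Matrix.coe_mulVecLin, ← LinearMap.ker_eq_bot, LinearMap.ker_eq_bot']
  intro x hx
  rw [Matrix.mulVecLin_apply] at hx
  have h : eucl (A *ᵥ x) ^ 2 = 0 := by
    rw [eucl_sq, dotProduct_mulVec, ← mulVec_transpose, mulVec_mulVec, hx, zero_dotProduct]
  have h' := hAc x
  rw [pow_eq_zero_iff two_ne_zero |>.1 h] at h'
  exact eucl_eq_zero (le_antisymm (nonpos_of_mul_nonpos_right h' hc) (eucl_nonneg x))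

/-! ### The lasso after profiling out the unpenalised coefficients -/

/-- The unpenalised coefficient is profiled out by projecting orthogonally to the range of A, where
the arbitrary matrix G disappears. One inequality therefore serves both residual constructions. -/
lemma lasso_basic_inequality {ι κ d : Type*} [Fintype ι] [Fintype κ] [DecidableEq κ] [Fintype d]
    {A : Matrix ι κ ℝ} (hA : IsUnit (Aᵀ * A).det) (X : Matrix ι d ℝ) (G : Matrix κ d ℝ)
    (b bh : d → ℝ) (ah : κ → ℝ) (ε : ι → ℝ) {r lam : ℝ} (hr : 0 ≤ r)
    (hmin : ∀ a b', r / 2 * eucl (X *ᵥ b + ε - A *ᵥ ah - (X - A * G) *ᵥ bh) ^ 2 +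
        lam * ∑ j, |bh j| ≤
      r / 2 * eucl (X *ᵥ b + ε - A *ᵥ a - (X - A * G) *ᵥ b') ^ 2 + lam * ∑ j, |b' j|) :
    r / 2 * eucl ((X - hatMatrix A * X) *ᵥ (bh - b)) ^ 2 + lam * ∑ j, |bh j| ≤
      r * ((X - hatMatrix A * X) *ᵥ (bh - b) ⬝ᵥ ε) + lam * ∑ j, |b j| := by
  -- Competitor: the true b, with the unpenalised part correcting for G and fitting the noise by
  -- least squares, so that its residual is exactly (I - P)ε.
  have h := hmin (G *ᵥ b + (Aᵀ * A)⁻¹ *ᵥ (Aᵀ *ᵥ ε)) b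
  have h1 : X *ᵥ b + ε - A *ᵥ (G *ᵥ b + (Aᵀ * A)⁻¹ *ᵥ (Aᵀ *ᵥ ε)) - (X - A * G) *ᵥ b =
      ε - hatMatrix A *ᵥ ε := by
    rw [mulVec_add, ← hatMatrix_mulVec, sub_mulVec, mulVec_mulVec]
    abel
  set ρ := X *ᵥ b + ε - A *ᵥ ah - (X - A * G) *ᵥ bh with hρ
  set x := (X - hatMatrix A * X) *ᵥ (bh - b) with hx
  have hx' : x = X *ᵥ (bh - b) - hatMatrix A *ᵥ (X *ᵥ (bh - b)) := by
    rw [hx, sub_mulVec, mulVec_mulVec]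
  -- On the estimator's side only the component of the residual orthogonal to the range of A is
  -- kept; it depends neither on `ah` nor on G.
  have h2 : ρ - hatMatrix A *ᵥ ρ = (ε - hatMatrix A *ᵥ ε) - x := by
    have h3 : ρ = ε - X *ᵥ (bh - b) - A *ᵥ (ah - G *ᵥ bh) := by
      rw [hρ, sub_mulVec, mulVec_sub, mulVec_sub, mulVec_mulVec]
      abel
    rw [h3, mulVec_sub (hatMatrix A), mulVec_sub (hatMatrix A), hatMatrix_mulVec_mulVec hA, hx']
    abel
  have h4 := eucl_sub_hatMatrix_le hA ρ
  have h5 : eucl ((ε - hatMatrix A *ᵥ ε) - x) ^ 2 =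
      eucl (ε - hatMatrix A *ᵥ ε) ^ 2 - 2 * (x ⬝ᵥ ε) + eucl x ^ 2 := by
    have h6 : (ε - hatMatrix A *ᵥ ε) ⬝ᵥ x = x ⬝ᵥ ε := by
      rw [hx', sub_hatMatrix_dotProduct hA, dotProduct_comm]
    rw [eucl_sq, eucl_sq, eucl_sq, sub_dotProduct, dotProduct_sub _ _ x, dotProduct_sub x,
      dotProduct_comm x (ε - _), h6]
    ring
  rw [h2] at h4
  have h7 : eucl ((ε - hatMatrix A *ᵥ ε) - x) ^ 2 ≤ eucl ρ ^ 2 :=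
    pow_le_pow_left₀ (eucl_nonneg _) h4 2
  rw [h1] at h
  have h8 := mul_le_mul_of_nonneg_left h7 (by positivity : 0 ≤ r / 2)
  rw [h5] at h8
  linarith

lemma lasso_cone {d : Type*} [Fintype d] [DecidableEq d] {b bh : d → ℝ} {S : Finset d}
    (hS : ∀ j ∉ S, b j = 0) {q lam δ : ℝ} (hlam : 0 ≤ lam)
    (h : q + lam * ∑ j, |bh j| ≤ δ * ∑ j, |(bh - b) j| + lam * ∑ j, |b j|) :
    q + (lam - δ) * ∑ j ∈ Sᶜ, |(bh - b) j| ≤ (lam + δ) * ∑ j ∈ S, |(bh - b) j| := by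
  have h1 : ∀ f : d → ℝ, ∑ j, f j = ∑ j ∈ S, f j + ∑ j ∈ Sᶜ, f j := fun f =>
    (Finset.sum_add_sum_compl S f).symm
  rw [h1 (fun j => |bh j|), h1 (fun j => |b j|), h1 (fun j => |(bh - b) j|)] at h
  have h2 : ∑ j ∈ Sᶜ, |b j| = 0 := Finset.sum_eq_zero fun j hj => by
    rw [hS j (Finset.mem_compl.1 hj), abs_zero]
  have h3 : ∑ j ∈ Sᶜ, |bh j| = ∑ j ∈ Sᶜ, |(bh - b) j| := Finset.sum_congr rfl fun j hj => by
    rw [Pi.sub_apply, hS j (Finset.mem_compl.1 hj), sub_zero]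
  have h4 : ∑ j ∈ S, |b j| ≤ ∑ j ∈ S, |bh j| + ∑ j ∈ S, |(bh - b) j| := by
    rw [← Finset.sum_add_distrib]
    refine Finset.sum_le_sum fun j _ => ?_
    have := abs_sub_abs_le_abs_sub (b j) (bh j)
    rw [abs_sub_comm] at this
    simp only [Pi.sub_apply]
    linarith
  rw [h2, h3] at h
  nlinarith

/-! ### Irrepresentability implies compatibility -/

section Compatibility

variable {n : ℕ} {d : Type*} [Fintype d] [DecidableEq d]

/-- Duality: the maximal row sum of A is the ℓ₁ operator norm of its transpose. -/
lemma sum_abs_le_rowSumNorm {a b : Type*} [Fintype a] [Fintype b] (A : Matrix a b ℝ)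
    (x : a → ℝ) : ∑ j, |(Aᵀ *ᵥ x) j| ≤ rowSumNorm A * ∑ i, |x i| := by
  have h : ∀ i, ∑ j, |A i j| ≤ rowSumNorm A := fun i =>
    le_ciSup (f := fun i => ∑ j, |A i j|) (Set.finite_range _).bddAbove i
  calc ∑ j, |(Aᵀ *ᵥ x) j| ≤ ∑ j, ∑ i, |A i j| * |x i| := Finset.sum_le_sum fun j _ => by
        refine (Finset.abs_sum_le_sum_abs _ _).trans (le_of_eq ?_)
        exact Finset.sum_congr rfl fun i _ => abs_mul _ _
    _ = ∑ i, (∑ j, |A i j|) * |x i| := by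
        rw [Finset.sum_comm]
        exact Finset.sum_congr rfl fun i _ => (Finset.sum_mul _ _ _).symm
    _ ≤ ∑ i, rowSumNorm A * |x i| := Finset.sum_le_sum fun i _ =>
        mul_le_mul_of_nonneg_right (h i) (abs_nonneg _)
    _ = _ := by rw [Finset.mul_sum]

lemma mulVec_eq_cols_add_cols (W : Matrix (Fin n) d ℝ) (S : Finset d) (v : d → ℝ) :
    W *ᵥ v = cols W S *ᵥ (fun j => v j) + cols W Sᶜ *ᵥ fun j => v j := by
  ext i
  simp only [mulVec, dotProduct, cols, submatrix_apply, id, Pi.add_apply]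
  rw [Finset.sum_coe_sort S fun j => W i j * v j, Finset.sum_coe_sort Sᶜ fun j => W i j * v j,
    Finset.sum_add_sum_compl]

-- A spectral bound on the inverse Gram matrix M becomes a lower bound on the Gram matrix without
-- eigenvalues: ‖z‖² = ⟨AMz, Az⟩ and ‖AMz‖² = ⟨z, Mz⟩, so Cauchy–Schwarz suffices.
omit [Fintype d] in
lemma eucl_sq_le_of_restrictedStrongConvexity {W : Matrix (Fin n) d ℝ} {S : Finset d}
    {κinf κ₂ : ℝ} (hκ : 0 < κ₂) (h : RestrictedStrongConvexity W S κinf κ₂) (z : {j // j ∈ S} → ℝ) :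
    2 * κ₂ * n * eucl z ^ 2 ≤ eucl (cols W S *ᵥ z) ^ 2 := by
  obtain ⟨hdet, -, hspec⟩ := h
  set A := cols W S
  set M := (Aᵀ * A)⁻¹
  have h1 : n * (z ⬝ᵥ M *ᵥ z) ≤ 1 / (2 * κ₂) * eucl z ^ 2 := by
    calc n * (z ⬝ᵥ M *ᵥ z) = z ⬝ᵥ ((n : ℝ) • M) *ᵥ z := by
          rw [smul_mulVec, dotProduct_smul, smul_eq_mul]
      _ ≤ eucl z * eucl (((n : ℝ) • M) *ᵥ z) := (le_abs_self _).trans (abs_dotProduct_le _ _)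
      _ ≤ eucl z * (specNorm ((n : ℝ) • M) * eucl z) := by
          gcongr
          · exact eucl_nonneg z
          · exact norm_mulVec_le_specNorm _ _
      _ ≤ eucl z * (1 / (2 * κ₂) * eucl z) := by
          have := eucl_nonneg z
          gcongr
      _ = _ := by ring
  have h2 : eucl (A *ᵥ (M *ᵥ z)) ^ 2 = z ⬝ᵥ M *ᵥ z := by
    rw [eucl_sq, dotProduct_mulVec, ← mulVec_transpose, mulVec_mulVec, mulVec_mulVec,
      mul_nonsing_inv _ hdet, one_mulVec]
  have h3 : eucl z ^ 2 ≤ eucl (A *ᵥ (M *ᵥ z)) * eucl (A *ᵥ z) := by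
    refine le_trans (le_of_eq ?_) ((le_abs_self _).trans (abs_dotProduct_le _ _))
    rw [eucl_sq, dotProduct_mulVec, ← mulVec_transpose, mulVec_mulVec, mulVec_mulVec,
      mul_nonsing_inv _ hdet, one_mulVec]
  have h4 : n * (eucl z ^ 2) ^ 2 ≤ 1 / (2 * κ₂) * eucl z ^ 2 * eucl (A *ᵥ z) ^ 2 := by
    calc n * (eucl z ^ 2) ^ 2 ≤ n * (eucl (A *ᵥ (M *ᵥ z)) * eucl (A *ᵥ z)) ^ 2 := by gcongr
      _ = n * (z ⬝ᵥ M *ᵥ z) * eucl (A *ᵥ z) ^ 2 := by rw [mul_pow, h2]; ring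
      _ ≤ _ := by gcongr
  rcases (sq_nonneg (eucl z)).eq_or_lt with h0 | h0
  · rw [← h0, mul_zero]
    positivity
  · refine le_of_mul_le_mul_left (a := eucl z ^ 2) ?_ h0
    calc eucl z ^ 2 * (2 * κ₂ * n * eucl z ^ 2) = 2 * κ₂ * (n * (eucl z ^ 2) ^ 2) := by ring
      _ ≤ 2 * κ₂ * (1 / (2 * κ₂) * eucl z ^ 2 * eucl (A *ᵥ z) ^ 2) := by gcongr
      _ = _ := by field_simp

/-- Projecting Wv onto the columns in S gives W_S z with z = v_S + Tᵀv_{Sᶜ}, where T is the matrix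
of the irrepresentable condition. On the cone, Tᵀv_{Sᶜ} has ℓ₁ norm at most (1 - τ/2)‖v_S‖₁, so ‖z‖₁
≥ (τ/2)‖v_S‖₁; restricted strong convexity is then applied to z. -/
lemma compatibility {W : Matrix (Fin n) d ℝ} {S : Finset d} {κinf κ₂ τ : ℝ} (hκ : 0 < κ₂)
    (hτ : 0 < τ) (h : RestrictedStrongConvexity W S κinf κ₂) (hI : Irrepresentable W S τ)
    {v : d → ℝ} (hv : (1 - τ) * ∑ j ∈ Sᶜ, |v j| ≤ (1 - τ / 2) * ∑ j ∈ S, |v j|) :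
    n * (κ₂ * τ ^ 2 / 2) * (∑ j ∈ S, |v j|) ^ 2 ≤ S.card * eucl (W *ᵥ v) ^ 2 := by
  have hdet := h.1
  set A := cols W S with hA
  set Bc := cols W Sᶜ with hBc
  set vS : {j // j ∈ S} → ℝ := fun j => v j with hvS
  set vc : {j // j ∈ Sᶜ} → ℝ := fun j => v j with hvc
  set T := Bcᵀ * A * (Aᵀ * A)⁻¹ with hT
  set z := vS + Tᵀ *ᵥ vc with hz
  have hW : W *ᵥ v = A *ᵥ vS + Bc *ᵥ vc := mulVec_eq_cols_add_cols W S v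
  have h1 : A *ᵥ z = hatMatrix A *ᵥ (W *ᵥ v) := by
    rw [hW, mulVec_add (hatMatrix A), hatMatrix_mulVec_mulVec hdet, hz, mulVec_add,
      hatMatrix_mulVec A (Bc *ᵥ vc)]
    congr 2
    simp [hT, transpose_nonsing_inv, mulVec_mulVec, Matrix.mul_assoc]
  have h2 : 2 * κ₂ * n * eucl z ^ 2 ≤ eucl (W *ᵥ v) ^ 2 := by
    refine (eucl_sq_le_of_restrictedStrongConvexity hκ h z).trans ?_
    rw [← hA, h1]
    exact pow_le_pow_left₀ (eucl_nonneg _) (eucl_hatMatrix_le hdet _) 2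
  have hs1 : ∑ j, |vS j| = ∑ j ∈ S, |v j| := Finset.sum_coe_sort S fun j => |v j|
  have hs2 : ∑ j, |vc j| = ∑ j ∈ Sᶜ, |v j| := Finset.sum_coe_sort Sᶜ fun j => |v j|
  have h3 : ∑ j, |(Tᵀ *ᵥ vc) j| ≤ (1 - τ) * ∑ j ∈ Sᶜ, |v j| := by
    rw [← hs2]
    refine (sum_abs_le_rowSumNorm T vc).trans ?_
    exact mul_le_mul_of_nonneg_right hI (Finset.sum_nonneg fun _ _ => abs_nonneg _)
  have h4 : τ / 2 * ∑ j ∈ S, |v j| ≤ ∑ j, |z j| := by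
    have h5 : ∑ j, |vS j| ≤ ∑ j, |z j| + ∑ j, |(Tᵀ *ᵥ vc) j| := by
      rw [← Finset.sum_add_distrib]
      refine Finset.sum_le_sum fun j _ => ?_
      have : vS j = z j - (Tᵀ *ᵥ vc) j := by simp [hz]
      rw [this]
      exact abs_sub _ _
    rw [hs1] at h5
    linarith
  have h5 := sum_abs_le_sqrt_card_mul_eucl z
  rw [Fintype.card_coe] at h5
  have h6 : (τ / 2 * ∑ j ∈ S, |v j|) ^ 2 ≤ S.card * eucl z ^ 2 := by
    have h0 : 0 ≤ τ / 2 * ∑ j ∈ S, |v j| :=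
      mul_nonneg (by positivity) (Finset.sum_nonneg fun _ _ => abs_nonneg _)
    calc _ ≤ (√S.card * eucl z) ^ 2 := pow_le_pow_left₀ h0 (h4.trans h5) 2
      _ = _ := by rw [mul_pow, Real.sq_sqrt (by positivity)]
  calc n * (κ₂ * τ ^ 2 / 2) * (∑ j ∈ S, |v j|) ^ 2
      = 2 * κ₂ * n * (τ / 2 * ∑ j ∈ S, |v j|) ^ 2 := by ring
    _ ≤ 2 * κ₂ * n * (S.card * eucl z ^ 2) := by gcongr
    _ = S.card * (2 * κ₂ * n * eucl z ^ 2) := by ring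
    _ ≤ _ := by gcongr

end Compatibility

/-! ### Factor-adjusted designs -/

lemma abs_sum_mul_le {κ : Type*} [Fintype κ] {x y : κ → ℝ} {r s : ℝ}
    (hx : ∀ k, |x k| ≤ r) (hy : ∀ k, |y k| ≤ s) :
    |∑ k, x k * y k| ≤ Fintype.card κ * (r * s) := by
  calc |∑ k, x k * y k| ≤ ∑ k, |x k * y k| := Finset.abs_sum_le_sum_abs _ _
    _ ≤ ∑ _k : κ, r * s := Finset.sum_le_sum fun k _ => by
        rw [abs_mul]
        exact mul_le_mul (hx k) (hy k) (abs_nonneg _) ((abs_nonneg _).trans (hx k))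
    _ = _ := by simp

lemma abs_mulVec_le {κ d : Type*} [Fintype d] (M : Matrix κ d ℝ) (x : d → ℝ) {r : ℝ} {k : κ}
    (hM : ∀ j, |M k j| ≤ r) : |(M *ᵥ x) k| ≤ r * ∑ j, |x j| := by
  rw [Finset.mul_sum]
  refine (Finset.abs_sum_le_sum_abs _ _).trans (Finset.sum_le_sum fun j _ => ?_)
  rw [abs_mul]
  exact mul_le_mul_of_nonneg_right (hM j) (abs_nonneg _)

lemma eucl_mulVec_le_of_abs_le {κ : Type*} [Fintype κ] {M : Matrix κ κ ℝ} {N : ℝ} (hN : 0 ≤ N)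
    (hM : ∀ k l, |M k l| ≤ N) (x : κ → ℝ) :
    eucl (M *ᵥ x) ≤ Fintype.card κ * N * eucl x := by
  have h1 : ∀ k, |(M *ᵥ x) k| ≤ N * (√(Fintype.card κ) * eucl x) := fun k =>
    (abs_mulVec_le M x (hM k)).trans
      (mul_le_mul_of_nonneg_left (sum_abs_le_sqrt_card_mul_eucl x) hN)
  refine (eucl_le_sqrt_card_mul _
    (mul_nonneg hN (mul_nonneg (Real.sqrt_nonneg _) (eucl_nonneg x))) h1).trans (le_of_eq ?_)
  rw [show √(Fintype.card κ) * (N * (√(Fintype.card κ) * eucl x)) =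
    (√(Fintype.card κ) * √(Fintype.card κ)) * N * eucl x by ring,
    Real.mul_self_sqrt (by positivity)]

section FactorAdjusted

variable {n : ℕ} {d κ : Type*} [Fintype d] [Fintype κ] [DecidableEq κ]
  {Um : Matrix (Fin n) d ℝ} {Fm E : Matrix (Fin n) κ ℝ} {H : Matrix κ κ ℝ} {Γ : Matrix d κ ℝ}
  {f e υ ρ h N γ : ℝ}

omit [DecidableEq κ] in
/-- If the projected factors are a well-conditioned transformation of the factors up to a small
error, then they inherit the lower bound on the spectrum of the factors. -/
lemma projectedFactor_lower_bound (hf : 0 < f) (hN : 0 < N)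
    (hF : ∀ z, √n * f * eucl z ≤ eucl (Fm *ᵥ z)) (hE : ∀ k, eucl (fun i => E i k) ≤ √n * e)
    (he : 0 ≤ e) (hB : ∀ x, eucl x ≤ N * eucl (Hᵀ *ᵥ x))
    (hef : e * √(Fintype.card κ) ≤ f / (2 * N)) (x : κ → ℝ) :
    √n * (f / (2 * N)) * eucl x ≤ eucl ((Fm * Hᵀ + E) *ᵥ x) := by
  have h1 : eucl (Fm *ᵥ (Hᵀ *ᵥ x)) ≤ eucl ((Fm * Hᵀ + E) *ᵥ x) + eucl (E *ᵥ x) := by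
    have : Fm *ᵥ (Hᵀ *ᵥ x) = (Fm * Hᵀ + E) *ᵥ x - E *ᵥ x := by
      rw [add_mulVec, mulVec_mulVec]; abel
    rw [this]
    exact eucl_sub_le _ _
  have h2 : eucl (E *ᵥ x) ≤ √n * (f / (2 * N)) * eucl x := by
    calc eucl (E *ᵥ x) ≤ √n * e * ∑ k, |x k| := eucl_mulVec_le E x hE
      _ ≤ √n * e * (√(Fintype.card κ) * eucl x) := by
          gcongr
          exact sum_abs_le_sqrt_card_mul_eucl x
      _ = √n * (e * √(Fintype.card κ)) * eucl x := by ring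
      _ ≤ _ := by
          have := eucl_nonneg x
          gcongr
  have h3 : √n * (f / N) * eucl x ≤ eucl (Fm *ᵥ (Hᵀ *ᵥ x)) := by
    calc √n * (f / N) * eucl x ≤ √n * (f / N) * (N * eucl (Hᵀ *ᵥ x)) := by
          gcongr
          exact hB x
      _ = √n * f * eucl (Hᵀ *ᵥ x) := by field_simp
      _ ≤ _ := hF _
  have h4 : √n * (f / N) * eucl x = 2 * (√n * (f / (2 * N)) * eucl x) := by field_simp
  linarith

omit [DecidableEq κ] in
lemma abs_transpose_projectedFactor_mulVec_le {v : Fin n → ℝ} {r s : ℝ}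
    (hH : ∀ k l, |H k l| ≤ h) (hF : ∀ k, |∑ i, Fm i k * v i| ≤ r)
    (hE : ∀ k, |∑ i, E i k * v i| ≤ s) (k : κ) :
    |((Fm * Hᵀ + E)ᵀ *ᵥ v) k| ≤ Fintype.card κ * h * r + s := by
  have h1 : ((Fm * Hᵀ + E)ᵀ *ᵥ v) k = ∑ l, H k l * (∑ i, Fm i l * v i) + ∑ i, E i k * v i := by
    rw [transpose_add, transpose_mul, transpose_transpose, add_mulVec, ← mulVec_mulVec]
    rfl
  rw [h1, mul_assoc]
  exact (abs_add_le _ _).trans (add_le_add (abs_sum_mul_le (hH k) hF) (hE k))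

-- The common component 𝔽Γᵀ is rewritten through the observable matrix A = 𝔽Hᵀ + E, at the price of
-- the correction -E(ΓH⁻¹)ᵀ. The term in A is annihilated by I - P̂ in `adjusted_design_mulVec`.
omit [Fintype d] in
lemma design_eq (hH : IsUnit H.det) :
    Fm * Γᵀ + Um = Um - E * (Γ * H⁻¹)ᵀ + (Fm * Hᵀ + E) * (Γ * H⁻¹)ᵀ := by
  have h : Hᵀ * (Γ * H⁻¹)ᵀ = Γᵀ := by
    rw [← transpose_mul, Matrix.mul_assoc, nonsing_inv_mul _ hH, Matrix.mul_one]
  rw [Matrix.add_mul, Matrix.mul_assoc Fm, h]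
  abel

lemma adjusted_design_mulVec (hH : IsUnit H.det)
    (hA : IsUnit ((Fm * Hᵀ + E)ᵀ * (Fm * Hᵀ + E)).det) (x : d → ℝ) :
    (Fm * Γᵀ + Um - hatMatrix (Fm * Hᵀ + E) * (Fm * Γᵀ + Um)) *ᵥ x =
      (Um *ᵥ x - E *ᵥ ((Γ * H⁻¹)ᵀ *ᵥ x)) -
        hatMatrix (Fm * Hᵀ + E) *ᵥ (Um *ᵥ x - E *ᵥ ((Γ * H⁻¹)ᵀ *ᵥ x)) := by
  rw [design_eq (E := E) (Um := Um) (Fm := Fm) (Γ := Γ) hH]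
  set A := Fm * Hᵀ + E
  rw [Matrix.mul_add, ← Matrix.mul_assoc (hatMatrix A) A, hatMatrix_mul_self hA,
    add_sub_add_right_eq_sub, sub_mulVec, ← mulVec_mulVec _ (hatMatrix A), sub_mulVec,
    ← mulVec_mulVec]

/-- Transfers curvature from 𝕌 to the adjusted design. The loss has two sources: the correction
E(ΓH⁻¹)ᵀx, controlled by e, and the projection P̂𝕌x, controlled by the cross moments of 𝕌 with the
columns of 𝔽Hᵀ + E. -/
lemma eucl_idiosyncratic_le {c : ℝ} (hc : 0 < c) (hn : 0 < n) (hH : IsUnit H.det)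
    (hAc : ∀ x, √n * c * eucl x ≤ eucl ((Fm * Hᵀ + E) *ᵥ x))
    (hE : ∀ k, eucl (fun i => E i k) ≤ √n * e) (he : 0 ≤ e)
    (hU : ∀ j, eucl (fun i => Um i j) ≤ √n * υ)
    (hUF : ∀ j k, |∑ i, Um i j * Fm i k| ≤ n * ρ) (hρ : 0 ≤ ρ) (hHh : ∀ k l, |H k l| ≤ h)
    (hΓ : ∀ j k, |(Γ * H⁻¹) j k| ≤ γ) (hh : 0 ≤ h) (hυ : 0 ≤ υ) (x : d → ℝ) :
    eucl (Um *ᵥ x) ≤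
      eucl ((Fm * Γᵀ + Um - hatMatrix (Fm * Hᵀ + E) * (Fm * Γᵀ + Um)) *ᵥ x) +
        √n * ((Fintype.card κ * γ * e +
          √(Fintype.card κ) * (Fintype.card κ * h * ρ + υ * e) / c) * ∑ j, |x j|) := by
  have hn0 : (0 : ℝ) < n := by exact_mod_cast hn
  have hnn : √(n : ℝ) * √n = n := Real.mul_self_sqrt hn0.le
  have hsn : 0 < √(n : ℝ) := Real.sqrt_pos.2 hn0
  have hA := isUnit_det_gram_of_lower_bound (by positivity) hAc
  have hx : 0 ≤ ∑ j, |x j| := Finset.sum_nonneg fun _ _ => abs_nonneg _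
  rw [adjusted_design_mulVec hH hA]
  set A := Fm * Hᵀ + E with hAdef
  set w := E *ᵥ ((Γ * H⁻¹)ᵀ *ᵥ x) with hw
  have h1 : Um *ᵥ x = ((Um *ᵥ x - w) - hatMatrix A *ᵥ (Um *ᵥ x - w)) +
      (hatMatrix A *ᵥ (Um *ᵥ x) + (w - hatMatrix A *ᵥ w)) := by
    rw [mulVec_sub (hatMatrix A)]
    abel
  have h2 : eucl (w - hatMatrix A *ᵥ w) ≤ √n * (Fintype.card κ * γ * e * ∑ j, |x j|) := by
    refine (eucl_sub_hatMatrix_le hA w).trans ((eucl_mulVec_le E _ hE).trans ?_)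
    have : ∑ k, |((Γ * H⁻¹)ᵀ *ᵥ x) k| ≤ ∑ _k : κ, γ * ∑ j, |x j| :=
      Finset.sum_le_sum fun k _ => abs_mulVec_le _ _ fun j => hΓ j k
    rw [Finset.sum_const, Finset.card_univ, nsmul_eq_mul] at this
    calc √n * e * ∑ k, |((Γ * H⁻¹)ᵀ *ᵥ x) k|
        ≤ √n * e * (Fintype.card κ * (γ * ∑ j, |x j|)) := by gcongr
      _ = _ := by ring
  have h3 : ∀ k, |(Aᵀ *ᵥ (Um *ᵥ x)) k| ≤
      n * (Fintype.card κ * h * ρ + υ * e) * ∑ j, |x j| := fun k => by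
    rw [mulVec_mulVec]
    refine abs_mulVec_le _ _ fun j => ?_
    refine (abs_transpose_projectedFactor_mulVec_le (v := fun i => Um i j) (r := n * ρ)
      (s := n * (υ * e)) hHh (fun k => ?_) (fun k => ?_) k).trans (le_of_eq ?_)
    · simpa only [mul_comm] using hUF j k
    · calc _ ≤ eucl (fun i => E i k) * eucl fun i => Um i j := abs_dotProduct_le _ _
        _ ≤ (√n * e) * (√n * υ) :=
            mul_le_mul (hE k) (hU j) (eucl_nonneg _) (by positivity)
        _ = (√n * √n) * (υ * e) := by ring
        _ = _ := by rw [hnn]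
    · ring
  have h4 : eucl (hatMatrix A *ᵥ (Um *ᵥ x)) ≤
      √n * (√(Fintype.card κ) * (Fintype.card κ * h * ρ + υ * e) / c * ∑ j, |x j|) := by
    refine (eucl_hatMatrix_le_of_lower_bound hA (by positivity) hAc _).trans ?_
    rw [div_le_iff₀ (by positivity)]
    refine (eucl_le_sqrt_card_mul _ (by positivity) h3).trans (le_of_eq ?_)
    rw [show √(n : ℝ) * (√(Fintype.card κ) * (Fintype.card κ * h * ρ + υ * e) / c * ∑ j, |x j|) *
      (√n * c) = (√n * √n) * (√(Fintype.card κ) * (Fintype.card κ * h * ρ + υ * e) *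
        ∑ j, |x j|) by field_simp, hnn]
    ring
  rw [h1]
  refine (eucl_add_le _ _).trans ?_
  rw [← h1, add_mul, mul_add]
  gcongr
  refine (eucl_add_le _ _).trans ?_
  linarith

/-- With w the corresponding column of 𝕌 - E(ΓH⁻¹)ᵀ, the noise correlation is ⟨w, ε⟩ - ⟨w, P̂ε⟩. The
first term is a combination of cross moments; the second is at most ‖w‖‖P̂ε‖, and P̂ε is small
because ε is nearly orthogonal to the projected factors. -/
lemma abs_noise_adjusted_le {c r s : ℝ} (hc : 0 < c) (hn : 0 < n) (hH : IsUnit H.det)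
    (hAc : ∀ x, √n * c * eucl x ≤ eucl ((Fm * Hᵀ + E) *ᵥ x))
    (hE : ∀ k, eucl (fun i => E i k) ≤ √n * e) (he : 0 ≤ e)
    (hU : ∀ j, eucl (fun i => Um i j) ≤ √n * υ) (hHh : ∀ k l, |H k l| ≤ h)
    (hΓ : ∀ j k, |(Γ * H⁻¹) j k| ≤ γ) (hγ : 0 ≤ γ) (hh : 0 ≤ h) (hυ : 0 ≤ υ)
    {ε : Fin n → ℝ} (hr : 0 ≤ r) (hs : 0 ≤ s) (hUε : ∀ j, |∑ i, Um i j * ε i| ≤ n * r)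
    (hFε : ∀ k, |∑ i, Fm i k * ε i| ≤ n * r) (hEε : ∀ k, |∑ i, E i k * ε i| ≤ n * s) (j : d) :
    |∑ i, (Fm * Γᵀ + Um - hatMatrix (Fm * Hᵀ + E) * (Fm * Γᵀ + Um)) i j * ε i| ≤
      n * (r + Fintype.card κ * (γ * s) +
        (υ + Fintype.card κ * γ * e) *
          (√(Fintype.card κ) * (Fintype.card κ * h * r + s) / c)) := by
  classical
  have hn0 : (0 : ℝ) < n := by exact_mod_cast hn
  have hnn : √(n : ℝ) * √n = n := Real.mul_self_sqrt hn0.le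
  have hsn : 0 < √(n : ℝ) := Real.sqrt_pos.2 hn0
  have hA := isUnit_det_gram_of_lower_bound (by positivity) hAc
  have h0 := adjusted_design_mulVec (Um := Um) (Γ := Γ) hH hA (Pi.single j 1)
  rw [mulVec_single_one, mulVec_single_one, mulVec_single_one] at h0
  set A := Fm * Hᵀ + E with hAdef
  set g := E *ᵥ ((Γ * H⁻¹)ᵀ).col j with hg
  set w := Um.col j - g with hw
  have h1 : ∑ i, (Fm * Γᵀ + Um - hatMatrix A * (Fm * Γᵀ + Um)) i j * ε i =
      w ⬝ᵥ ε - w ⬝ᵥ hatMatrix A *ᵥ ε := by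
    rw [dotProduct_hatMatrix_mulVec, ← sub_dotProduct, ← h0]
    rfl
  have hg1 : ∑ k, |((Γ * H⁻¹)ᵀ).col j k| ≤ Fintype.card κ * γ := by
    calc _ ≤ ∑ _k : κ, γ := Finset.sum_le_sum fun k _ => hΓ j k
      _ = _ := by simp
  have h2 : |w ⬝ᵥ ε| ≤ n * (r + Fintype.card κ * (γ * s)) := by
    rw [hw, sub_dotProduct]
    refine (abs_sub _ _).trans ?_
    rw [mul_add]
    refine add_le_add (hUε j) ?_
    have : g ⬝ᵥ ε = ∑ k, (Γ * H⁻¹) j k * ∑ i, E i k * ε i := by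
      rw [hg, dotProduct_comm, dotProduct_mulVec, dotProduct_comm, ← mulVec_transpose]
      rfl
    rw [this]
    exact (abs_sum_mul_le (hΓ j) hEε).trans (le_of_eq (by ring))
  have h3 : eucl w ≤ √n * (υ + Fintype.card κ * γ * e) := by
    refine (eucl_sub_le _ _).trans ?_
    rw [mul_add]
    refine add_le_add (hU j) ((eucl_mulVec_le E _ hE).trans ?_)
    calc √n * e * ∑ k, |((Γ * H⁻¹)ᵀ).col j k| ≤ √n * e * (Fintype.card κ * γ) := by gcongr
      _ = _ := by ring
  have h4 : eucl (hatMatrix A *ᵥ ε) ≤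
      √n * (√(Fintype.card κ) * (Fintype.card κ * h * r + s) / c) := by
    refine (eucl_hatMatrix_le_of_lower_bound hA (by positivity) hAc _).trans ?_
    rw [div_le_iff₀ (by positivity)]
    refine (eucl_le_sqrt_card_mul _ (by positivity)
      (abs_transpose_projectedFactor_mulVec_le hHh hFε hEε)).trans (le_of_eq ?_)
    rw [show √(n : ℝ) * (√(Fintype.card κ) * (Fintype.card κ * h * r + s) / c) * (√n * c) =
      (√n * √n) * (√(Fintype.card κ) * (Fintype.card κ * h * r + s)) by field_simp, hnn]
    ring
  rw [h1]
  refine (abs_sub _ _).trans ?_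
  rw [mul_add]
  refine add_le_add h2 ((abs_dotProduct_le _ _).trans ?_)
  calc eucl w * eucl (hatMatrix A *ᵥ ε)
      ≤ (√n * (υ + Fintype.card κ * γ * e)) *
        (√n * (√(Fintype.card κ) * (Fintype.card κ * h * r + s) / c)) := by
        gcongr
        exact eucl_nonneg _
    _ = (√n * √n) * ((υ + Fintype.card κ * γ * e) *
        (√(Fintype.card κ) * (Fintype.card κ * h * r + s) / c)) := by ring
    _ = _ := by rw [hnn]

lemma abs_noise_rotated_le {r s : ℝ} (hHh : ∀ k l, |H k l| ≤ h) (hN : ∀ k l, |H⁻¹ k l| ≤ N)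
    {ε : Fin n → ℝ}
    (hFε : ∀ k, |∑ i, Fm i k * ε i| ≤ n * r) (hEε : ∀ k, |∑ i, E i k * ε i| ≤ n * s) (k : κ) :
    |∑ i, ((Fm * Hᵀ + E) * (H⁻¹)ᵀ) i k * ε i| ≤
      n * (Fintype.card κ * (N * (Fintype.card κ * h * r + s))) := by
  have h1 : ∑ i, ((Fm * Hᵀ + E) * (H⁻¹)ᵀ) i k * ε i =
      ∑ l, H⁻¹ k l * ((Fm * Hᵀ + E)ᵀ *ᵥ ε) l := by
    have : ∀ i, ((Fm * Hᵀ + E) * (H⁻¹)ᵀ) i k = ((Fm * Hᵀ + E) *ᵥ H⁻¹ k) i := fun i => rfl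
    simp only [this]
    change ((Fm * Hᵀ + E) *ᵥ H⁻¹ k) ⬝ᵥ ε = H⁻¹ k ⬝ᵥ ((Fm * Hᵀ + E)ᵀ *ᵥ ε)
    rw [dotProduct_mulVec, ← mulVec_transpose, transpose_transpose]
  rw [h1]
  refine (abs_sum_mul_le (hN k)
    (abs_transpose_projectedFactor_mulVec_le hHh hFε hEε)).trans (le_of_eq ?_)
  ring

end FactorAdjusted

/-- The `ℓ₁` error of the factor-adjusted lasso. -/
lemma sum_abs_le_of_compatibility {d : Type*} [Fintype d] [DecidableEq d] {S : Finset d}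
    {Δ : d → ℝ} {n s : ℕ} {u x q φ ω lam δ τ : ℝ} (hn : 0 < n) (hτ : 0 < τ) (hτ1 : τ < 1)
    (hφ : 0 < φ) (hδ : 0 ≤ δ) (hlam : 14 * δ / τ < lam)
    (hq : q = x ^ 2 / (2 * n))
    (hcone : q + (lam - δ) * ∑ j ∈ Sᶜ, |Δ j| ≤ (lam + δ) * ∑ j ∈ S, |Δ j|)
    (hcompat : (1 - τ) * ∑ j ∈ Sᶜ, |Δ j| ≤ (1 - τ / 2) * ∑ j ∈ S, |Δ j| →
      n * φ ^ 2 * (∑ j ∈ S, |Δ j|) ^ 2 ≤ s * u ^ 2)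
    (hu : 0 ≤ u) (hux : u ≤ x + √n * (ω * ∑ j, |Δ j|)) (hω : 0 ≤ ω) (hωs : 6 * √s * ω ≤ φ) :
    ∑ j, |Δ j| ≤ 48 / φ ^ 2 * (s * lam) := by
  have hn0 : (0 : ℝ) < n := by exact_mod_cast hn
  set s₁ := ∑ j ∈ S, |Δ j| with hs₁
  set s₂ := ∑ j ∈ Sᶜ, |Δ j| with hs₂
  have hs₁0 : 0 ≤ s₁ := Finset.sum_nonneg fun _ _ => abs_nonneg _
  have hs₂0 : 0 ≤ s₂ := Finset.sum_nonneg fun _ _ => abs_nonneg _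
  have hsum : ∑ j, |Δ j| = s₁ + s₂ := (Finset.sum_add_sum_compl S _).symm
  have hq0 : 0 ≤ q := by rw [hq]; positivity
  rw [div_lt_iff₀ hτ] at hlam
  have hlam0 : 0 < lam := by
    by_contra! h
    nlinarith
  have hδl : 14 * δ ≤ lam * τ := hlam.le
  have hδ' : δ ≤ lam / 14 := by nlinarith
  -- Since δ < λτ/14, the lasso cone has aperture 1 ± τ/14. This fits into the compatibility cone
  -- because (1 - τ)(1 + τ/14) ≤ (1 - τ/14)(1 - τ/2).
  have h1 : (1 - τ / 14) * s₂ ≤ (1 + τ / 14) * s₁ := by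
    have h2 : lam * ((1 - τ / 14) * s₂) ≤ lam * ((1 + τ / 14) * s₁) := by
      have h3 : δ * s₁ ≤ lam * τ / 14 * s₁ := by gcongr; linarith
      have h4 : δ * s₂ ≤ lam * τ / 14 * s₂ := by gcongr; linarith
      nlinarith
    exact le_of_mul_le_mul_left h2 hlam0
  have h2 : s₂ ≤ 2 * s₁ := by nlinarith
  have h3 : (1 - τ) * s₂ ≤ (1 - τ / 2) * s₁ := by
    have h4 : (1 - τ / 14) * ((1 - τ) * s₂) ≤ (1 - τ / 14) * ((1 - τ / 2) * s₁) := by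
      calc (1 - τ / 14) * ((1 - τ) * s₂) = (1 - τ) * ((1 - τ / 14) * s₂) := by ring
        _ ≤ (1 - τ) * ((1 + τ / 14) * s₁) := by gcongr
        _ = ((1 - τ) * (1 + τ / 14)) * s₁ := by ring
        _ ≤ ((1 - τ / 14) * (1 - τ / 2)) * s₁ :=
            mul_le_mul_of_nonneg_right (by nlinarith) hs₁0
        _ = _ := by ring
    exact le_of_mul_le_mul_left h4 (by linarith)
  have h4 : √n * (φ * s₁) ≤ √s * u := by
    refine abs_le_of_sq_le_sq' ?_ (by positivity) |>.2
    rw [mul_pow, mul_pow, mul_pow, Real.sq_sqrt (by positivity), Real.sq_sqrt (by positivity)]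
    linarith [hcompat h3]
  -- As ‖Δ‖₁ ≤ 3s₁ on the cone, the condition 6√s·ω ≤ φ makes the perturbation at most half of the
  -- left-hand side, where it is absorbed.
  have h5 : √n * (φ * s₁) ≤ 2 * (√s * x) := by
    have h6 : √s * u ≤ √s * (x + √n * (ω * ∑ j, |Δ j|)) := by gcongr
    have h7 : √s * (√n * (ω * ∑ j, |Δ j|)) ≤ √n * (φ * s₁) / 2 := by
      calc √s * (√n * (ω * ∑ j, |Δ j|)) ≤ √s * (√n * (ω * (3 * s₁))) := by
            rw [hsum]
            gcongr
            linarith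
        _ = √n * ((6 * √s * ω) * s₁) / 2 := by ring
        _ ≤ √n * (φ * s₁) / 2 := by gcongr
    rw [mul_add] at h6
    linarith
  have h6 : n * (φ ^ 2 * s₁ ^ 2) ≤ 4 * (s * x ^ 2) := by
    have h7 := pow_le_pow_left₀ (by positivity) h5 2
    rw [mul_pow, mul_pow, mul_pow, mul_pow, Real.sq_sqrt (by positivity),
      Real.sq_sqrt (by positivity)] at h7
    linarith
  have h7 : q ≤ 2 * lam * s₁ := by
    nlinarith [mul_nonneg (by linarith : 0 ≤ lam - δ) hs₂0]
  have h8 : x ^ 2 ≤ 2 * n * (2 * lam * s₁) := by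
    rw [hq, div_le_iff₀ (by positivity)] at h7
    linarith
  have h9 : φ ^ 2 * s₁ ≤ 16 * (s * lam) := by
    rcases hs₁0.eq_or_lt with h0 | h0
    · rw [← h0, mul_zero]; positivity
    · refine le_of_mul_le_mul_left (a := n * s₁) ?_ (by positivity)
      calc n * s₁ * (φ ^ 2 * s₁) = n * (φ ^ 2 * s₁ ^ 2) := by ring
        _ ≤ 4 * (s * x ^ 2) := h6
        _ ≤ 4 * (s * (2 * n * (2 * lam * s₁))) := by gcongr
        _ = _ := by ring
  -- The constant 48 is 3 · 16: ‖Δ‖₁ ≤ 3s₁ and φ²s₁ ≤ 16sλ.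
  rw [hsum, div_mul_eq_mul_div, le_div_iff₀ (by positivity)]
  nlinarith

/-! ### The matrix model in vectorised form -/

/-- The entries of a matrix as a vector. -/
def entries {a b : ℕ} (M : Matrix (Fin a) (Fin b) ℝ) : Fin a × Fin b → ℝ := fun q => M q.1 q.2

section Vectorise

variable {n a b a' b' : ℕ}

lemma stack_mul_mul (M : Matrix (Fin a') (Fin a) ℝ) (N : Matrix (Fin b') (Fin b) ℝ)
    (V : Fin n → Matrix (Fin a) (Fin b) ℝ) :
    stack (fun i => M * V i * Nᵀ) = stack V * (M ⊗ₖ N)ᵀ := by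
  ext i q
  simp only [stack, of_apply, mul_apply, transpose_apply, kroneckerMap_apply,
    ← Finset.univ_product_univ, Finset.sum_product, Finset.sum_mul]
  rw [Finset.sum_comm]
  exact Finset.sum_congr rfl fun _ _ => Finset.sum_congr rfl fun _ _ => by ring

lemma stack_add (V V' : Fin n → Matrix (Fin a) (Fin b) ℝ) :
    stack (fun i => V i + V' i) = stack V + stack V' := rfl

lemma stack_smul (r : ℝ) (V : Fin n → Matrix (Fin a) (Fin b) ℝ) :
    stack (fun i => r • V i) = r • stack V := rfl

lemma trInner_eq_stack_mulVec (V : Fin n → Matrix (Fin a) (Fin b) ℝ)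
    (M : Matrix (Fin a) (Fin b) ℝ) (i : Fin n) :
    trInner (V i) M = (stack V *ᵥ entries M) i := by
  simp only [trInner, trace, diag, mul_apply, transpose_apply, mulVec, dotProduct, stack, of_apply,
    entries, ← Finset.univ_product_univ, Finset.sum_product]
  exact Finset.sum_comm

lemma trInner_comm (M N : Matrix (Fin a) (Fin b) ℝ) : trInner M N = trInner N M := by
  rw [trInner, ← trace_transpose, transpose_mul, transpose_transpose, trInner]

lemma maxNorm_le_sum_abs (M : Matrix (Fin a) (Fin b) ℝ) : maxNorm M ≤ ∑ q, |entries M q| := by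
  refine (pi_norm_le_iff_of_nonneg (Finset.sum_nonneg fun _ _ => abs_nonneg _)).2 fun q => ?_
  exact Finset.single_le_sum (f := fun q => |entries M q|) (fun _ _ => abs_nonneg _)
    (Finset.mem_univ q)

end Vectorise

section Model

variable {n p₁ p₂ k₁ k₂ : ℕ} (R : Matrix (Fin p₁) (Fin k₁) ℝ) (C : Matrix (Fin p₂) (Fin k₂) ℝ)
  (W₁ : Matrix (Fin p₁) (Fin k₁) ℝ) (W₂ : Matrix (Fin p₂) (Fin k₂) ℝ)
  (F : Fin n → Matrix (Fin k₁) (Fin k₂) ℝ) (U : Fin n → Matrix (Fin p₁) (Fin p₂) ℝ)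

lemma stack_covariate : stack (covariate R C F U) = stack F * (R ⊗ₖ C)ᵀ + stack U := by
  rw [← stack_mul_mul, ← stack_add]
  rfl

lemma stack_factorHat_covariate : stack (factorHat W₁ W₂ (covariate R C F U)) =
    stack F * (transf W₁ R ⊗ₖ transf W₂ C)ᵀ + stack (factorHat W₁ W₂ U) := by
  rw [← stack_mul_mul, ← stack_add]
  congr 1
  ext1 i
  simp only [factorHat, covariate, transf, Matrix.mul_add, Matrix.add_mul, smul_add,
    Matrix.transpose_smul, Matrix.smul_mul, Matrix.mul_smul, smul_smul, transpose_mul,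
    transpose_transpose, Matrix.mul_assoc]
  congr 2
  rw [one_div_mul_one_div, mul_comm]

lemma stack_rotatedFactor (H₁ : Matrix (Fin k₁) (Fin k₁) ℝ) (H₂ : Matrix (Fin k₂) (Fin k₂) ℝ) :
    stack (rotatedFactor H₁ H₂ F) = stack F * ((H₁ ⊗ₖ H₂)⁻¹)ᵀ := by
  rw [inv_kronecker, ← stack_mul_mul]
  simp only [transpose_nonsing_inv]
  rfl

lemma stack_projResidual (X : Fin n → Matrix (Fin p₁) (Fin p₂) ℝ)
    (Fh : Fin n → Matrix (Fin k₁) (Fin k₂) ℝ) :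
    stack (projResidual X Fh) = stack X - hatMatrix (stack Fh) * stack X := rfl

/-- The only property of the residuals that the error bound needs. The accuracy of the
block-averaged loadings is irrelevant, and so is the convention 1/0 = 0. -/
lemma exists_stack_residual {X Uh : Fin n → Matrix (Fin p₁) (Fin p₂) ℝ}
    {Fh : Fin n → Matrix (Fin k₁) (Fin k₂) ℝ}
    (h : Uh = blockResidual X Fh ∨ Uh = projResidual X Fh) :
    ∃ G : Matrix (Fin k₁ × Fin k₂) (Fin p₁ × Fin p₂) ℝ, stack Uh = stack X - stack Fh * G := by
  rcases h with rfl | rfl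
  · set r := 1 / (entryMean (colLoadingHat (gammaTilde X Fh)) *
        entryMean (rowLoadingHat (gammaTilde X Fh))) with hr
    refine ⟨r • (rowLoadingHat (gammaTilde X Fh) ⊗ₖ colLoadingHat (gammaTilde X Fh))ᵀ, ?_⟩
    rw [Matrix.mul_smul, ← stack_mul_mul, ← stack_smul]
    rfl
  · refine ⟨((stack Fh)ᵀ * stack Fh)⁻¹ * (stack Fh)ᵀ * stack X, ?_⟩
    rw [stack_projResidual, hatMatrix]
    simp only [Matrix.mul_assoc]

lemma objective_eq (y : Fin n → ℝ) (Fh : Fin n → Matrix (Fin k₁) (Fin k₂) ℝ)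
    (Uh : Fin n → Matrix (Fin p₁) (Fin p₂) ℝ) (lam : ℝ)
    (A : Matrix (Fin k₁) (Fin k₂) ℝ) (B : Matrix (Fin p₁) (Fin p₂) ℝ) :
    objective y Fh Uh lam (A, B) =
      1 / (n : ℝ) / 2 * eucl (y - stack Fh *ᵥ entries A - stack Uh *ᵥ entries B) ^ 2 +
        lam * ∑ q, |entries B q| := by
  rw [objective, eucl_sq, dotProduct]
  congr 2
  · rw [div_div, mul_comm]
  · refine Finset.sum_congr rfl fun i _ => ?_
    rw [trInner_comm, trInner_comm B, trInner_eq_stack_mulVec, trInner_eq_stack_mulVec, sq]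
    rfl
  · rw [← Finset.univ_product_univ, Finset.sum_product]
    rfl

lemma response_eq (X : Fin n → Matrix (Fin p₁) (Fin p₂) ℝ) (B : Matrix (Fin p₁) (Fin p₂) ℝ)
    (ε : Fin n → ℝ) : response X B ε = stack X *ᵥ entries B + ε := by
  ext i
  rw [response, trInner_eq_stack_mulVec]
  rfl

lemma abs_sum_le_noiseLevel (hn : 0 < n) {d : Type*} [Fintype d] (W : Matrix (Fin n) d ℝ)
    (ε : Fin n → ℝ) (j : d) : |∑ i, W i j * ε i| ≤ n * noiseLevel W ε := by
  have hn0 : (0 : ℝ) < n := by exact_mod_cast hn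
  have h := norm_le_pi_norm (fun j => (1 / (n : ℝ)) * ∑ i, W i j * ε i) j
  rw [Real.norm_eq_abs, abs_mul, abs_of_pos (by positivity), mul_comm, mul_one_div,
    div_le_iff₀ hn0, mul_comm _ (n : ℝ)] at h
  exact h

lemma noiseLevel_le (hn : 0 < n) {d : Type*} [Fintype d] {W : Matrix (Fin n) d ℝ}
    {ε : Fin n → ℝ} {r : ℝ} (hr : 0 ≤ r) (h : ∀ j, |∑ i, W i j * ε i| ≤ n * r) :
    noiseLevel W ε ≤ r := by
  have hn0 : (0 : ℝ) < n := by exact_mod_cast hn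
  refine (pi_norm_le_iff_of_nonneg hr).2 fun j => ?_
  rw [Real.norm_eq_abs, abs_mul, abs_of_pos (by positivity), one_div, inv_mul_le_iff₀ hn0]
  exact h j

variable {R C F U} in
lemma compatibility_design {B : Matrix (Fin p₁) (Fin p₂) ℝ}
    {κinf κ₂ τ : ℝ} (hκ : 0 < κ₂) (hτ : 0 < τ)
    (h : RestrictedStrongConvexity (design U F) (supp (thetaStar R C B)) κinf κ₂)
    (hI : Irrepresentable (design U F) (supp (thetaStar R C B)) τ) {v : Fin p₁ × Fin p₂ → ℝ}
    (hv : (1 - τ) * ∑ j ∈ (supp (entries B))ᶜ, |v j| ≤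
      (1 - τ / 2) * ∑ j ∈ supp (entries B), |v j|) :
    n * (κ₂ * τ ^ 2 / 2) * (∑ j ∈ supp (entries B), |v j|) ^ 2 ≤
      (supp (thetaStar R C B)).card * eucl (stack U *ᵥ v) ^ 2 := by
  -- Padding by zeros on the factor coordinates gives [𝕌 𝔽]v' = 𝕌v and leaves both ℓ₁ sums
  -- unchanged, while the cardinality remains that of the full support S.
  set v' : (Fin p₁ × Fin p₂) ⊕ (Fin k₁ × Fin k₂) → ℝ := Sum.elim v 0 with hv'
  have h1 : ∑ j ∈ supp (thetaStar R C B), |v' j| = ∑ j ∈ supp (entries B), |v j| := by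
    rw [supp, supp, Finset.sum_filter, Finset.sum_filter, Fintype.sum_sum_type]
    simp only [hv', thetaStar, entries, Sum.elim_inl, Sum.elim_inr, Pi.zero_apply, abs_zero,
      ite_self, Finset.sum_const_zero, add_zero]
    exact Finset.sum_congr rfl fun _ _ => by congr
  have h2 : ∑ j ∈ (supp (thetaStar R C B))ᶜ, |v' j| = ∑ j ∈ (supp (entries B))ᶜ, |v j| := by
    have h3 := Finset.sum_add_sum_compl (supp (thetaStar R C B)) fun j => |v' j|
    have h4 := Finset.sum_add_sum_compl (supp (entries B)) fun j => |v j|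
    rw [Fintype.sum_sum_type] at h3
    simp only [hv', Sum.elim_inl, Sum.elim_inr, Pi.zero_apply, abs_zero, Finset.sum_const_zero,
      add_zero] at h3 h1 ⊢
    linarith
  have h3 : design U F *ᵥ v' = stack U *ᵥ v := by
    rw [design, hv', fromCols_mulVec_sumElim, mulVec_zero, add_zero]
  have h4 := compatibility hκ hτ h hI (v := v') (by rwa [h1, h2])
  rwa [h1, h3] at h4

lemma sqrt_mul_eucl_le_of_posSemidef {κ : Type*} [Fintype κ] [DecidableEq κ]
    {A : Matrix (Fin n) κ ℝ} {c : ℝ} (hc : 0 ≤ c) (hn : 0 < n)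
    (h : ((1 / (n : ℝ)) • (Aᵀ * A) - c • (1 : Matrix κ κ ℝ)).PosSemidef) (z : κ → ℝ) :
    √n * √c * eucl z ≤ eucl (A *ᵥ z) := by
  have hn0 : (0 : ℝ) < n := by exact_mod_cast hn
  have h1 := h.dotProduct_mulVec_nonneg z
  rw [star_trivial, sub_mulVec, dotProduct_sub, smul_mulVec, smul_mulVec, one_mulVec,
    dotProduct_smul, dotProduct_smul, ← mulVec_mulVec, dotProduct_mulVec, ← mulVec_transpose,
    transpose_transpose, ← eucl_sq, ← eucl_sq, smul_eq_mul, smul_eq_mul, one_div, sub_nonneg,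
    le_inv_mul_iff₀ hn0] at h1
  refine abs_le_of_sq_le_sq' ?_ (eucl_nonneg _) |>.2
  rw [mul_pow, mul_pow, Real.sq_sqrt hn0.le, Real.sq_sqrt hc]
  linarith

/-- Each entry is an average over p₁p₂ positions of bounded weights times the moments of 𝕌 with ε,
so the uniform moment bound carries over for any bounded weights. -/
lemma abs_sum_factorHat_mul_le (hp₁ : 0 < p₁) (hp₂ : 0 < p₂) {w r : ℝ} (hw : 0 ≤ w)
    (hW₁ : ∀ a α, |W₁ a α| ≤ w) (hW₂ : ∀ b β, |W₂ b β| ≤ w) {ε : Fin n → ℝ}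
    (hU : ∀ q, |∑ i, stack U i q * ε i| ≤ r) (k : Fin k₁ × Fin k₂) :
    |∑ i, stack (factorHat W₁ W₂ U) i k * ε i| ≤ w ^ 2 * r := by
  have hp : (0 : ℝ) < (p₁ : ℝ) * p₂ := by positivity
  have h1 : ∑ i, stack (factorHat W₁ W₂ U) i k * ε i =
      1 / ((p₁ : ℝ) * p₂) * ∑ q : Fin p₁ × Fin p₂,
        (W₁ q.1 k.1 * W₂ q.2 k.2) * ∑ i, stack U i q * ε i := by
    simp only [stack, of_apply, factorHat_apply, dotProduct, mulVec, Finset.mul_sum,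
      Finset.sum_mul, ← Finset.univ_product_univ, Finset.sum_product]
    rw [Finset.sum_comm]
    refine Finset.sum_congr rfl fun a _ => ?_
    rw [Finset.sum_comm]
    exact Finset.sum_congr rfl fun _ _ => Finset.sum_congr rfl fun _ _ => by ring
  rw [h1, abs_mul, abs_of_pos (by positivity)]
  have h2 : ∀ q : Fin p₁ × Fin p₂, |W₁ q.1 k.1 * W₂ q.2 k.2| ≤ w ^ 2 := fun q => by
    rw [abs_mul, sq]
    exact mul_le_mul (hW₁ _ _) (hW₂ _ _) (abs_nonneg _) hw
  refine (mul_le_mul_of_nonneg_left (abs_sum_mul_le h2 hU) (by positivity)).trans (le_of_eq ?_)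
  simp only [Fintype.card_prod, Fintype.card_fin]
  push_cast
  field_simp

end Model

/-! ### Bounds for a fixed sample -/

/-- Continuity of the determinant and of inversion at Λ turns convergence in probability into
uniform bounds on the transformation and its inverse. -/
lemma exists_maxNorm_sub_lt_imp {ι : Type*} [Fintype ι] [DecidableEq ι] {Λ : Matrix ι ι ℝ}
    (hΛ : IsUnit Λ.det) : ∃ e > 0, ∃ b > 0, ∀ M : Matrix ι ι ℝ, maxNorm (M - Λ) < e →
      IsUnit M.det ∧ (∀ i j, |M i j| ≤ b) ∧ ∀ i j, |M⁻¹ i j| ≤ b := by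
  have h1 : ∀ᶠ M in 𝓝 Λ, IsUnit M.det := by
    have : ∀ᶠ M in 𝓝 Λ, M.det ≠ 0 :=
      (continuous_id.matrix_det.continuousAt (x := Λ)).eventually_ne hΛ.ne_zero
    exact this.mono fun M hM => isUnit_iff_ne_zero.2 hM
  have hinv : ContinuousAt Inv.inv Λ := by
    refine continuousAt_matrix_inv Λ ?_
    rw [Ring.inverse_eq_inv']
    exact continuousAt_inv₀ hΛ.ne_zero
  set b : ℝ := ∑ i, ∑ j, (|Λ i j| + |Λ⁻¹ i j|) + 1 with hb
  have hle : ∀ i j, |Λ i j| + |Λ⁻¹ i j| < b := fun i j => by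
    have h2 : |Λ i j| + |Λ⁻¹ i j| ≤ ∑ j, (|Λ i j| + |Λ⁻¹ i j|) :=
      Finset.single_le_sum (f := fun j => |Λ i j| + |Λ⁻¹ i j|) (fun _ _ => by positivity)
        (Finset.mem_univ j)
    have h3 : ∑ j, (|Λ i j| + |Λ⁻¹ i j|) ≤ ∑ i, ∑ j, (|Λ i j| + |Λ⁻¹ i j|) :=
      Finset.single_le_sum (f := fun i => ∑ j, (|Λ i j| + |Λ⁻¹ i j|)) (fun _ _ => by positivity)
        (Finset.mem_univ i)
    linarith
  have h2 : ∀ᶠ M in 𝓝 Λ, ∀ i j, |M i j| < b := by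
    refine eventually_all.2 fun i => eventually_all.2 fun j => ?_
    have : ContinuousAt (fun M : Matrix ι ι ℝ => |M i j|) Λ :=
      (continuous_id.matrix_elem i j).abs.continuousAt
    exact this.eventually_lt_const (by linarith [hle i j, abs_nonneg (Λ⁻¹ i j)])
  have h3 : ∀ᶠ M in 𝓝 Λ, ∀ i j, |M⁻¹ i j| < b := by
    refine eventually_all.2 fun i => eventually_all.2 fun j => ?_
    have : ContinuousAt (fun M : Matrix ι ι ℝ => |M⁻¹ i j|) Λ :=
      ((continuous_id.matrix_elem i j).abs.continuousAt (x := Λ⁻¹)).comp hinv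
    exact this.eventually_lt_const (by linarith [hle i j, abs_nonneg (Λ i j)])
  obtain ⟨e, he, h⟩ := (Metric.eventually_nhds_iff (α := ι → ι → ℝ)).1 (h1.and (h2.and h3))
  refine ⟨e, he, b, by positivity, fun M hM => ?_⟩
  have hd : dist (α := ι → ι → ℝ) M Λ < e := by
    refine (dist_pi_lt_iff he).2 fun i => (dist_pi_lt_iff he).2 fun j => ?_
    rw [Real.dist_eq]
    exact (abs_le_maxNorm (M - Λ) i j).trans_lt hM
  obtain ⟨h4, h5, h6⟩ := h hd
  exact ⟨h4, fun i j => (h5 i j).le, fun i j => (h6 i j).le⟩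

lemma kronecker_comm {k₁ k₂ : ℕ} (M : Matrix (Fin k₁) (Fin k₁) ℝ) (N : Matrix (Fin k₂) (Fin k₂) ℝ) :
    M ⊗ₖ N = (N ⊗ₖ M).submatrix (Equiv.prodComm _ _) (Equiv.prodComm _ _) := by
  ext ⟨a, b⟩ ⟨c, d⟩
  simp [kroneckerMap_apply, mul_comm]

/-- Convergence is assumed for H₂ ⊗ H₁, whereas stacking by (row, column) pairs produces H₁ ⊗ H₂;
the two differ by a relabelling of indices. -/
lemma kronecker_comm_bounds {k₁ k₂ : ℕ} {M : Matrix (Fin k₁) (Fin k₁) ℝ}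
    {N : Matrix (Fin k₂) (Fin k₂) ℝ} {b : ℝ}
    (h : IsUnit (N ⊗ₖ M).det ∧ (∀ i j, |(N ⊗ₖ M) i j| ≤ b) ∧ ∀ i j, |(N ⊗ₖ M)⁻¹ i j| ≤ b) :
    IsUnit (M ⊗ₖ N).det ∧ (∀ i j, |(M ⊗ₖ N) i j| ≤ b) ∧ ∀ i j, |(M ⊗ₖ N)⁻¹ i j| ≤ b := by
  rw [kronecker_comm M N, det_submatrix_equiv_self, inv_submatrix_equiv]
  exact ⟨h.1, fun i j => h.2.1 _ _, fun i j => h.2.2 _ _⟩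

section Sample

variable {n p₁ p₂ k₁ k₂ : ℕ} {R : Matrix (Fin p₁) (Fin k₁) ℝ} {C : Matrix (Fin p₂) (Fin k₂) ℝ}
  {W₁ : Matrix (Fin p₁) (Fin k₁) ℝ} {W₂ : Matrix (Fin p₂) (Fin k₂) ℝ}
  {F : Fin n → Matrix (Fin k₁) (Fin k₂) ℝ} {U : Fin n → Matrix (Fin p₁) (Fin p₂) ℝ}
  {ε : Fin n → ℝ} {B : Matrix (Fin p₁) (Fin p₂) ℝ}
  {X Uh : Fin n → Matrix (Fin p₁) (Fin p₂) ℝ} {Fh : Fin n → Matrix (Fin k₁) (Fin k₂) ℝ}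
  {e υ ρ h N γ c : ℝ}

/-- Deterministic error bound: on the event that the projected factors are well conditioned, the
lasso error is controlled by the tuning parameter. -/
theorem maxNorm_sub_le (hX : X = covariate R C F U) (hFh : Fh = factorHat W₁ W₂ X)
    (hUh : Uh = blockResidual X Fh ∨ Uh = projResidual X Fh)
    (hc : 0 < c) (hn : 0 < n) (hH : IsUnit (transf W₁ R ⊗ₖ transf W₂ C).det)
    (hAc : ∀ x, √n * c * eucl x ≤ eucl (stack Fh *ᵥ x))
    (hE : ∀ k, eucl (fun i => stack (factorHat W₁ W₂ U) i k) ≤ √n * e) (he : 0 ≤ e)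
    (hU : ∀ j, eucl (fun i => stack U i j) ≤ √n * υ)
    (hUF : ∀ j k, |∑ i, stack U i j * stack F i k| ≤ n * ρ) (hρ : 0 ≤ ρ)
    (hHh : ∀ k l, |(transf W₁ R ⊗ₖ transf W₂ C) k l| ≤ h)
    (hΓ : ∀ j k, |((R ⊗ₖ C) * (transf W₁ R ⊗ₖ transf W₂ C)⁻¹) j k| ≤ γ)
    (hγ : 0 ≤ γ) (hh : 0 ≤ h) (hυ : 0 ≤ υ)
    {κinf κ₂ τ φ : ℝ} (hκ : 0 < κ₂) (hτ : 0 < τ) (hτ1 : τ < 1)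
    (hRSC : RestrictedStrongConvexity (design U F) (supp (thetaStar R C B)) κinf κ₂)
    (hIrr : Irrepresentable (design U F) (supp (thetaStar R C B)) τ)
    (hφ : 0 < φ) (hφ2 : φ ^ 2 = κ₂ * τ ^ 2 / 2)
    (hω : 6 * √(supp (thetaStar R C B)).card * (((k₁ * k₂ : ℕ) : ℝ) * γ * e +
      √((k₁ * k₂ : ℕ) : ℝ) * (((k₁ * k₂ : ℕ) : ℝ) * h * ρ + υ * e) / c) ≤ φ)
    {lam : ℝ} (hlam : 14 * noiseLevel (design (projResidual X Fh)
      (rotatedFactor (transf W₁ R) (transf W₂ C) Fh)) ε / τ < lam)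
    {Ah : Matrix (Fin k₁) (Fin k₂) ℝ} {Bh : Matrix (Fin p₁) (Fin p₂) ℝ}
    (hmin : ∀ θ, objective (response X B ε) Fh Uh lam (Ah, Bh) ≤
      objective (response X B ε) Fh Uh lam θ) :
    maxNorm (Bh - B) ≤ 48 / φ ^ 2 * ((supp (thetaStar R C B)).card * lam) := by
  have hn0 : (0 : ℝ) < n := by exact_mod_cast hn
  have hsn : 0 < √(n : ℝ) := Real.sqrt_pos.2 hn0
  have hXs : stack X = stack F * (R ⊗ₖ C)ᵀ + stack U := by rw [hX, stack_covariate]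
  have hFs : stack Fh = stack F * (transf W₁ R ⊗ₖ transf W₂ C)ᵀ + stack (factorHat W₁ W₂ U) := by
    rw [hFh, hX, stack_factorHat_covariate]
  have hA : IsUnit ((stack Fh)ᵀ * stack Fh).det :=
    isUnit_det_gram_of_lower_bound (c := √n * c) (by positivity) hAc
  obtain ⟨G, hG⟩ := exists_stack_residual hUh
  set δ := noiseLevel (design (projResidual X Fh)
      (rotatedFactor (transf W₁ R) (transf W₂ C) Fh)) ε with hδ
  have hδ0 : 0 ≤ δ := norm_nonneg _
  set Δ := entries Bh - entries B with hΔ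
  set x := (stack X - hatMatrix (stack Fh) * stack X) *ᵥ Δ with hx
  have h1 := lasso_basic_inequality hA (stack X) G (entries B) (entries Bh) (entries Ah) ε
    (r := 1 / n) (lam := lam) (by positivity) fun a b' => by
      have h := hmin (Matrix.of fun i j => a (i, j), Matrix.of fun i j => b' (i, j))
      rw [objective_eq, objective_eq, response_eq, hG] at h
      exact h
  -- Hölder's inequality; only the idiosyncratic coordinates of the noise level enter.
  have h2 : 1 / (n : ℝ) * (x ⬝ᵥ ε) ≤ δ * ∑ j, |Δ j| := by
    have h3 : x ⬝ᵥ ε = ∑ j, Δ j * ∑ i, stack (projResidual X Fh) i j * ε i := by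
      rw [hx, ← stack_projResidual, dotProduct_comm, dotProduct_mulVec, dotProduct_comm,
        ← mulVec_transpose]
      rfl
    have h4 : x ⬝ᵥ ε ≤ ∑ j, |Δ j| * (n * δ) := by
      rw [h3]
      refine Finset.sum_le_sum fun j _ => (le_abs_self _).trans ?_
      rw [abs_mul]
      exact mul_le_mul_of_nonneg_left (abs_sum_le_noiseLevel hn (design (projResidual X Fh)
        (rotatedFactor (transf W₁ R) (transf W₂ C) Fh)) ε (Sum.inl j)) (abs_nonneg _)
    rw [← Finset.sum_mul] at h4
    rw [one_div, inv_mul_le_iff₀ hn0]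
    linarith
  have hlam0 : 0 ≤ lam := le_trans (by positivity) hlam.le
  have h3 := lasso_cone (S := supp (entries B)) (b := entries B) (bh := entries Bh)
    (q := 1 / (n : ℝ) / 2 * eucl x ^ 2) (lam := lam) (δ := δ)
    (fun j hj => by simpa [supp] using hj) hlam0 (by linarith)
  have hux := eucl_idiosyncratic_le (Γ := R ⊗ₖ C) (x := Δ) hc hn hH
    (fun x => by rw [← hFs]; exact hAc x) hE he hU hUF hρ hHh hΓ hh hυ
  rw [← hFs, ← hXs, Fintype.card_prod, Fintype.card_fin, Fintype.card_fin] at hux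
  have h4 := sum_abs_le_of_compatibility (S := supp (entries B)) (Δ := Δ) (n := n)
    (s := (supp (thetaStar R C B)).card) (u := eucl (stack U *ᵥ Δ)) (x := eucl x)
    (q := 1 / (n : ℝ) / 2 * eucl x ^ 2) (φ := φ) (lam := lam) (δ := δ) (τ := τ)
    hn hτ hτ1 hφ hδ0 hlam (by field_simp) h3
    (fun hv => by rw [hφ2]; exact compatibility_design hκ hτ hRSC hIrr hv)
    (eucl_nonneg _) hux (by positivity) hω
  exact (maxNorm_le_sum_abs _).trans h4

/-- The noise level of the estimated design. -/
theorem noiseLevel_estimated_le (hX : X = covariate R C F U) (hFh : Fh = factorHat W₁ W₂ X)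
    (hc : 0 < c) (hn : 0 < n) (hp₁ : 0 < p₁) (hp₂ : 0 < p₂)
    (hH : IsUnit (transf W₁ R ⊗ₖ transf W₂ C).det)
    (hAc : ∀ x, √n * c * eucl x ≤ eucl (stack Fh *ᵥ x))
    (hE : ∀ k, eucl (fun i => stack (factorHat W₁ W₂ U) i k) ≤ √n * e) (he : 0 ≤ e) (he1 : e ≤ 1)
    (hU : ∀ j, eucl (fun i => stack U i j) ≤ √n * υ)
    (hHh : ∀ k l, |(transf W₁ R ⊗ₖ transf W₂ C) k l| ≤ h)
    (hN : ∀ k l, |(transf W₁ R ⊗ₖ transf W₂ C)⁻¹ k l| ≤ N)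
    (hΓ : ∀ j k, |((R ⊗ₖ C) * (transf W₁ R ⊗ₖ transf W₂ C)⁻¹) j k| ≤ γ)
    (hγ : 0 ≤ γ) (hh : 0 ≤ h) (hυ : 0 ≤ υ) (hN0 : 0 ≤ N) {w r : ℝ} (hw : 0 ≤ w)
    (hW₁ : ∀ a α, |W₁ a α| ≤ w) (hW₂ : ∀ b β, |W₂ b β| ≤ w) (hr : 0 ≤ r)
    (hUε : ∀ j, |∑ i, stack U i j * ε i| ≤ n * r) (hFε : ∀ k, |∑ i, stack F i k * ε i| ≤ n * r) :
    noiseLevel (design (projResidual X Fh)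
      (rotatedFactor (transf W₁ R) (transf W₂ C) Fh)) ε ≤
      (1 + ((k₁ * k₂ : ℕ) : ℝ) * (γ * w ^ 2) +
        (υ + ((k₁ * k₂ : ℕ) : ℝ) * γ) *
          (√((k₁ * k₂ : ℕ) : ℝ) * (((k₁ * k₂ : ℕ) : ℝ) * h + w ^ 2) / c) +
        ((k₁ * k₂ : ℕ) : ℝ) * (N * (((k₁ * k₂ : ℕ) : ℝ) * h + w ^ 2))) * r := by
  have hn0 : (0 : ℝ) < n := by exact_mod_cast hn
  have hXs : stack X = stack F * (R ⊗ₖ C)ᵀ + stack U := by rw [hX, stack_covariate]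
  have hFs : stack Fh = stack F * (transf W₁ R ⊗ₖ transf W₂ C)ᵀ + stack (factorHat W₁ W₂ U) := by
    rw [hFh, hX, stack_factorHat_covariate]
  have hEε : ∀ k, |∑ i, stack (factorHat W₁ W₂ U) i k * ε i| ≤ n * (w ^ 2 * r) := fun k =>
    (abs_sum_factorHat_mul_le W₁ W₂ U hp₁ hp₂ hw hW₁ hW₂ hUε k).trans (le_of_eq (by ring))
  have hK : Fintype.card (Fin k₁ × Fin k₂) = k₁ * k₂ := by simp
  refine noiseLevel_le hn (by positivity) fun j => ?_
  rcases j with j | k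
  · have h1 := abs_noise_adjusted_le (Γ := R ⊗ₖ C) hc hn hH
      (fun x => by rw [← hFs]; exact hAc x) hE he hU hHh hΓ hγ hh hυ (ε := ε) hr
      (by positivity : 0 ≤ w ^ 2 * r) hUε hFε hEε j
    rw [← hFs, ← hXs, ← stack_projResidual, hK] at h1
    refine h1.trans (mul_le_mul_of_nonneg_left ?_ hn0.le)
    have h2 : (υ + ((k₁ * k₂ : ℕ) : ℝ) * γ * e) * (√((k₁ * k₂ : ℕ) : ℝ) *
          (((k₁ * k₂ : ℕ) : ℝ) * h * r + w ^ 2 * r) / c) ≤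
        (υ + ((k₁ * k₂ : ℕ) : ℝ) * γ) * (√((k₁ * k₂ : ℕ) : ℝ) *
          (((k₁ * k₂ : ℕ) : ℝ) * h * r + w ^ 2 * r) / c) := by
      refine mul_le_mul_of_nonneg_right (add_le_add le_rfl
        (mul_le_of_le_one_right (by positivity) he1)) (by positivity)
    have h3 : 0 ≤ ((k₁ * k₂ : ℕ) : ℝ) * (N * (((k₁ * k₂ : ℕ) : ℝ) * h + w ^ 2)) := by
      positivity
    refine (add_le_add le_rfl h2).trans ?_
    refine le_trans (le_of_eq ?_) (mul_le_mul_of_nonneg_right (le_add_of_nonneg_right h3) hr)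
    ring
  · have h1 := abs_noise_rotated_le (Fm := stack F) (E := stack (factorHat W₁ W₂ U)) hHh hN
      (ε := ε) hFε hEε k
    rw [← hFs, ← stack_rotatedFactor, hK] at h1
    refine h1.trans (mul_le_mul_of_nonneg_left ?_ hn0.le)
    have h3 : 0 ≤ (1 + ((k₁ * k₂ : ℕ) : ℝ) * (γ * w ^ 2) +
        (υ + ((k₁ * k₂ : ℕ) : ℝ) * γ) *
          (√((k₁ * k₂ : ℕ) : ℝ) * (((k₁ * k₂ : ℕ) : ℝ) * h + w ^ 2) / c)) := by
      positivity
    refine le_trans (le_of_eq ?_) (mul_le_mul_of_nonneg_right (le_add_of_nonneg_left h3) hr)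
    ring

end Sample

section Sample

variable {n p₁ p₂ k₁ k₂ : ℕ} {R : Matrix (Fin p₁) (Fin k₁) ℝ} {C : Matrix (Fin p₂) (Fin k₂) ℝ}
  {W₁ : Matrix (Fin p₁) (Fin k₁) ℝ} {W₂ : Matrix (Fin p₂) (Fin k₂) ℝ}
  {F : Fin n → Matrix (Fin k₁) (Fin k₂) ℝ} {U : Fin n → Matrix (Fin p₁) (Fin p₂) ℝ}
  {ε : Fin n → ℝ} {B : Matrix (Fin p₁) (Fin p₂) ℝ}
  {X Uh : Fin n → Matrix (Fin p₁) (Fin p₂) ℝ} {Fh : Fin n → Matrix (Fin k₁) (Fin k₂) ℝ}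

lemma stack_factorHat_lower_bound (hX : X = covariate R C F U) (hFh : Fh = factorHat W₁ W₂ X)
    (hn : 0 < n) {f b e : ℝ} (hf : 0 < f) (hb : 0 ≤ b)
    (hgram : ((1 / (n : ℝ)) • ((stack F)ᵀ * stack F) -
      f • (1 : Matrix (Fin k₁ × Fin k₂) (Fin k₁ × Fin k₂) ℝ)).PosSemidef)
    (hH : IsUnit (transf W₁ R ⊗ₖ transf W₂ C).det)
    (hHi : ∀ k l, |(transf W₁ R ⊗ₖ transf W₂ C)⁻¹ k l| ≤ b)
    (hE : ∀ k, eucl (fun i => stack (factorHat W₁ W₂ U) i k) ≤ √n * e) (he : 0 ≤ e)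
    (hef : e * √((k₁ * k₂ : ℕ) : ℝ) ≤ √f / (2 * (((k₁ * k₂ : ℕ) : ℝ) * b + 1)))
    (x : Fin k₁ × Fin k₂ → ℝ) :
    √n * (√f / (2 * (((k₁ * k₂ : ℕ) : ℝ) * b + 1))) * eucl x ≤ eucl (stack Fh *ᵥ x) := by
  have hK : Fintype.card (Fin k₁ × Fin k₂) = k₁ * k₂ := by simp
  rw [hFh, hX, stack_factorHat_covariate]
  refine projectedFactor_lower_bound (Real.sqrt_pos.2 hf) (by positivity)
    (sqrt_mul_eucl_le_of_posSemidef hf.le hn hgram) hE he (fun x => ?_) (by rwa [hK]) x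
  set H := transf W₁ R ⊗ₖ transf W₂ C with hHdef
  have h1 : x = (H⁻¹)ᵀ *ᵥ (Hᵀ *ᵥ x) := by
    rw [mulVec_mulVec, ← transpose_mul, mul_nonsing_inv _ hH, transpose_one, one_mulVec]
  calc eucl x = eucl ((H⁻¹)ᵀ *ᵥ (Hᵀ *ᵥ x)) := by rw [← h1]
    _ ≤ ((k₁ * k₂ : ℕ) : ℝ) * b * eucl (Hᵀ *ᵥ x) := by
        rw [← hK]
        exact eucl_mulVec_le_of_abs_le hb (fun k l => hHi l k) _
    _ ≤ _ := mul_le_mul_of_nonneg_right (by linarith) (eucl_nonneg _)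

lemma eucl_le_sqrt_mul {m : ℕ} {v : Fin m → ℝ} {υ : ℝ} (hυ : 0 ≤ υ)
    (h : ∑ i, v i * v i ≤ m * υ ^ 2) : eucl v ≤ √m * υ := by
  refine abs_le_of_sq_le_sq' ?_ (by positivity) |>.2
  rw [eucl_sq, mul_pow, Real.sq_sqrt (by positivity)]
  exact h

/-- The lasso error in terms of the empirical cross moments. -/
theorem maxNorm_sub_le_of_moments (hX : X = covariate R C F U) (hFh : Fh = factorHat W₁ W₂ X)
    (hUh : Uh = blockResidual X Fh ∨ Uh = projResidual X Fh)
    (hn : 0 < n) (hp₁ : 0 < p₁) (hp₂ : 0 < p₂) {f b e c γ L w υ ρ r : ℝ} (hf : 0 < f) (hb : 0 ≤ b)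
    (hgram : ((1 / (n : ℝ)) • ((stack F)ᵀ * stack F) -
      f • (1 : Matrix (Fin k₁ × Fin k₂) (Fin k₁ × Fin k₂) ℝ)).PosSemidef)
    (hH : IsUnit (transf W₁ R ⊗ₖ transf W₂ C).det)
    (hHh : ∀ k l, |(transf W₁ R ⊗ₖ transf W₂ C) k l| ≤ b)
    (hHi : ∀ k l, |(transf W₁ R ⊗ₖ transf W₂ C)⁻¹ k l| ≤ b)
    (hE : ∀ k, eucl (fun i => stack (factorHat W₁ W₂ U) i k) ≤ √n * e) (he : 0 ≤ e) (he1 : e ≤ 1)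
    (hc : c = √f / (2 * (((k₁ * k₂ : ℕ) : ℝ) * b + 1)))
    (hef : e * √((k₁ * k₂ : ℕ) : ℝ) ≤ c)
    (hL : 0 ≤ L) (hR : ∀ a α, |R a α| ≤ L) (hC : ∀ b β, |C b β| ≤ L)
    (hγ : γ = ((k₁ * k₂ : ℕ) : ℝ) * (L ^ 2 * b))
    (hw : 0 ≤ w) (hW₁ : ∀ a α, |W₁ a α| ≤ w) (hW₂ : ∀ b β, |W₂ b β| ≤ w)
    {κinf κ₂ τ φ : ℝ} (hκ : 0 < κ₂) (hτ : 0 < τ) (hτ1 : τ < 1)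
    (hRSC : RestrictedStrongConvexity (design U F) (supp (thetaStar R C B)) κinf κ₂)
    (hIrr : Irrepresentable (design U F) (supp (thetaStar R C B)) τ)
    (hφ : 0 < φ) (hφ2 : φ ^ 2 = κ₂ * τ ^ 2 / 2) (hυ : 0 ≤ υ) (hρ : 0 ≤ ρ) (hr : 0 ≤ r)
    (hmom : (supp (thetaStar R C B)).card ≠ 0 →
      (∀ j, |∑ i, stack U i j * stack U i j| ≤ n * υ ^ 2) ∧
      (∀ j k, |∑ i, stack U i j * stack F i k| ≤ n * ρ) ∧
      (∀ j, |∑ i, stack U i j * ε i| ≤ n * r) ∧ ∀ k, |∑ i, stack F i k * ε i| ≤ n * r)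
    (hω : 6 * √(supp (thetaStar R C B)).card * (((k₁ * k₂ : ℕ) : ℝ) * γ * e +
      √((k₁ * k₂ : ℕ) : ℝ) * (((k₁ * k₂ : ℕ) : ℝ) * b * ρ + υ * e) / c) ≤ φ)
    {lam : ℝ} (hlam : 14 * noiseLevel (design (projResidual X Fh)
      (rotatedFactor (transf W₁ R) (transf W₂ C) Fh)) ε / τ < lam)
    {Ah : Matrix (Fin k₁) (Fin k₂) ℝ} {Bh : Matrix (Fin p₁) (Fin p₂) ℝ}
    (hmin : ∀ θ, objective (response X B ε) Fh Uh lam (Ah, Bh) ≤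
      objective (response X B ε) Fh Uh lam θ) {M : ℝ} (hM : 0 ≤ M)
    (hlamM : lam ≤ M * noiseLevel (design (projResidual X Fh)
      (rotatedFactor (transf W₁ R) (transf W₂ C) Fh)) ε) :
    maxNorm (Bh - B) ≤ 48 / φ ^ 2 * ((supp (thetaStar R C B)).card * (M *
      ((1 + ((k₁ * k₂ : ℕ) : ℝ) * (γ * w ^ 2) +
        (υ + ((k₁ * k₂ : ℕ) : ℝ) * γ) *
          (√((k₁ * k₂ : ℕ) : ℝ) * (((k₁ * k₂ : ℕ) : ℝ) * b + w ^ 2) / c) +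
        ((k₁ * k₂ : ℕ) : ℝ) * (b * (((k₁ * k₂ : ℕ) : ℝ) * b + w ^ 2))) * r))) := by
  have hsf : 0 < √f := Real.sqrt_pos.2 hf
  have hc0 : 0 < c := by rw [hc]; positivity
  have hγ0 : 0 ≤ γ := by rw [hγ]; positivity
  have hAc : ∀ x, √n * c * eucl x ≤ eucl (stack Fh *ᵥ x) := by
    rw [hc] at hef ⊢
    exact stack_factorHat_lower_bound hX hFh hn hf hb hgram hH hHi hE he hef
  have hΓ : ∀ j k, |((R ⊗ₖ C) * (transf W₁ R ⊗ₖ transf W₂ C)⁻¹) j k| ≤ γ := fun j k => by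
    have h1 : ∀ l, |(R ⊗ₖ C) j l| ≤ L ^ 2 := fun l => by
      rw [kroneckerMap_apply, abs_mul, sq]
      exact mul_le_mul (hR _ _) (hC _ _) (abs_nonneg _) hL
    rw [mul_apply, hγ]
    simpa using abs_sum_mul_le h1 fun l => hHi l k
  -- With empty support nothing controls log(p₁p₂)/n, so moment bounds may fail. The smallness
  -- condition is then vacuous, crude sums serve as υ and ρ, and the error bound is zero.
  by_cases hs : (supp (thetaStar R C B)).card = 0
  · have hsn : 1 ≤ √(n : ℝ) := Real.one_le_sqrt.2 (by exact_mod_cast hn)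
    have hn1 : (1 : ℝ) ≤ n := by exact_mod_cast hn
    have hnn : ∀ j k, 0 ≤ |∑ i, stack U i j * stack F i k| := fun _ _ => abs_nonneg _
    have h := maxNorm_sub_le (υ := ∑ j, eucl fun i => stack U i j)
      (ρ := ∑ j, ∑ k, |∑ i, stack U i j * stack F i k|) hX hFh hUh hc0 hn hH hAc hE he
      (fun j => by
        have h1 : eucl (fun i => stack U i j) ≤ ∑ j, eucl fun i => stack U i j :=
          Finset.single_le_sum (f := fun j => eucl fun i => stack U i j)
            (fun _ _ => eucl_nonneg _) (Finset.mem_univ j)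
        nlinarith [eucl_nonneg fun i => stack U i j])
      (fun j k => by
        have h1 : |∑ i, stack U i j * stack F i k| ≤ ∑ k, |∑ i, stack U i j * stack F i k| :=
          Finset.single_le_sum (f := fun k => |∑ i, stack U i j * stack F i k|)
            (fun _ _ => hnn _ _) (Finset.mem_univ k)
        have h2 : ∑ k, |∑ i, stack U i j * stack F i k| ≤
            ∑ j, ∑ k, |∑ i, stack U i j * stack F i k| :=
          Finset.single_le_sum (f := fun j => ∑ k, |∑ i, stack U i j * stack F i k|)
            (fun _ _ => Finset.sum_nonneg fun _ _ => hnn _ _) (Finset.mem_univ j)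
        nlinarith [hnn j k])
      (Finset.sum_nonneg fun _ _ => Finset.sum_nonneg fun _ _ => hnn _ _) hHh hΓ hγ0 hb
      (Finset.sum_nonneg fun _ _ => eucl_nonneg _) hκ hτ hτ1 hRSC hIrr hφ hφ2
      (by rw [hs]; simpa using hφ.le) hlam hmin
    rw [hs] at h ⊢
    simpa using h
  obtain ⟨hUU, hUF, hUε, hFε⟩ := hmom hs
  have hUυ : ∀ j, eucl (fun i => stack U i j) ≤ √n * υ := fun j =>
    eucl_le_sqrt_mul hυ ((le_abs_self _).trans (hUU j))
  refine (maxNorm_sub_le hX hFh hUh hc0 hn hH hAc hE he hUυ hUF hρ hHh hΓ hγ0 hb hυ hκ hτ hτ1 hRSC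
    hIrr hφ hφ2 hω hlam hmin).trans ?_
  have hδ := noiseLevel_estimated_le hX hFh hc0 hn hp₁ hp₂ hH hAc hE he he1 hUυ hHh hHi hΓ hγ0 hb hυ
    hb hw hW₁ hW₂ hr hUε hFε
  exact mul_le_mul_of_nonneg_left (mul_le_mul_of_nonneg_left
    (hlamM.trans (mul_le_mul_of_nonneg_left hδ hM)) (by positivity)) (by positivity)

end Sample

/-! ### Passage to stochastic orders and asymptotic rates -/

lemma isBigOp_of_whp {Ω : ℕ → Type*} [∀ ν, MeasurableSpace (Ω ν)] {μ : ∀ ν, Measure (Ω ν)}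
    {Y r lam δ : ∀ ν, Ω ν → ℝ} (hlam : IsBigOp μ lam δ) (hδ : ∀ ν ω, 0 ≤ δ ν ω) {D : ℝ}
    (h : WHP μ fun ν ω => ∀ M, 0 ≤ M → lam ν ω ≤ M * δ ν ω → |Y ν ω| ≤ M * D * r ν ω) :
    IsBigOp μ Y r := by
  intro η hη
  have hη2 : 0 < η / 2 := ENNReal.half_pos hη.ne'
  obtain ⟨M, hM⟩ := hlam (η / 2) hη2
  refine ⟨|M| * D, ?_⟩
  filter_upwards [hM, ENNReal.tendsto_nhds_zero.1 h (η / 2) hη2] with ν h1 h2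
  rw [← ENNReal.add_halves η]
  refine (measure_mono fun ω hω => ?_).trans ((measure_union_le _ _).trans (add_le_add h1 h2))
  simp only [Set.mem_ofPred_eq, Set.mem_union] at hω ⊢
  by_contra! hcon
  have h3 : lam ν ω ≤ |M| * δ ν ω := (le_abs_self _).trans (hcon.1.trans
    (mul_le_mul_of_nonneg_right (le_abs_self M) (hδ ν ω)))
  exact absurd (hcon.2 _ (abs_nonneg M) h3) (not_le.2 hω)

lemma exists_pos_le_one_mul_le (a b : ℝ) {s t : ℝ} (hs : 0 < s) (ht : 0 < t) :
    ∃ x, 0 < x ∧ x ≤ 1 ∧ a * x ≤ s ∧ b * x ≤ t := by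
  have h : ∀ d : ℝ, Tendsto (fun x : ℝ => d * x) (𝓝[>] 0) (𝓝 0) := fun d => by
    have : Tendsto (fun x : ℝ => d * x) (𝓝 0) (𝓝 (d * 0)) :=
      (continuous_const.mul continuous_id).tendsto 0
    rw [mul_zero] at this
    exact this.mono_left nhdsWithin_le_nhds
  have h1 := (h 1).eventually_le_const one_pos
  simp only [one_mul] at h1
  exact (((eventually_mem_nhdsWithin.and h1).and (((h a).eventually_le_const hs).and
    ((h b).eventually_le_const ht))).exists).imp fun x hx => ⟨hx.1.1, hx.1.2, hx.2⟩

/-- One of p₁/p₂ and p₂/p₁ is at least 1, so the aspect-ratio factor only enlarges the rate. -/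
lemma mul_sqrt_le_rate {s n p₁ p₂ : ℕ} (hp₁ : 0 < p₁) (hp₂ : 0 < p₂) :
    s * √(Real.log ((p₁ : ℝ) * p₂) / n) ≤ rate s n p₁ p₂ := by
  have h1 : (1 : ℝ) ≤ (p₁ : ℝ) * p₂ := by exact_mod_cast Nat.mul_pos hp₁ hp₂
  have h2 : 0 ≤ s * Real.log ((p₁ : ℝ) * p₂) / n := by
    have := Real.log_nonneg h1
    positivity
  have h3 : (1 : ℝ) ≤ √(max ((p₁ : ℝ) / p₂) ((p₂ : ℝ) / p₁)) := by
    refine Real.one_le_sqrt.2 (le_max_iff.2 ?_)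
    rw [one_le_div (by positivity), one_le_div (by positivity)]
    exact le_total _ _
  rw [rate]
  have h4 : 0 ≤ s * √(Real.log ((p₁ : ℝ) * p₂) / n) := by positivity
  nlinarith

/-- The products of the coordinates of independent observations concentrate uniformly. -/
lemma whp_cross_moments {Ω : ℕ → Type*} [∀ ν, MeasurableSpace (Ω ν)]
    {μ : ∀ ν, Measure (Ω ν)} [∀ ν, IsProbabilityMeasure (μ ν)]
    {n : ℕ → ℕ} {p : ℕ → ℝ} (hn : Tendsto n atTop atTop) (hp : Tendsto p atTop atTop)
    {T : ℕ → Type*} [∀ ν, MeasurableSpace (T ν)] {V : ∀ ν, Fin (n ν) → Ω ν → T ν}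
    (hV : ∀ ν i, Measurable (V ν i))
    (hind : ∀ ν, iIndepFun (V ν) (μ ν))
    {Q : ℕ → Type*} [∀ ν, Fintype (Q ν)] {k : ℝ}
    (hQ : ∀ᶠ ν in atTop, (Fintype.card (Q ν) : ℝ) ≤ k * p ν)
    {X Y : ∀ ν, Q ν → T ν → ℝ} {c : ℝ≥0} (hc : 0 < c)
    (hXm : ∀ ν q, Measurable (X ν q)) (hYm : ∀ ν q, Measurable (Y ν q))
    (hX : ∀ ν q i, HasSubgaussianMGF (fun ω => X ν q (V ν i ω)) c (μ ν))
    (hY : ∀ ν q i, HasSubgaussianMGF (fun ω => Y ν q (V ν i ω)) c (μ ν))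
    {m : ℕ → ℝ} (hm : ∀ ν q i, |∫ ω, X ν q (V ν i ω) * Y ν q (V ν i ω) ∂(μ ν)| ≤ m ν)
    {A : ℕ → Prop} (hA : ∀ᶠ ν in atTop, A ν → Real.log (p ν) / n ν ≤ 1) :
    WHP μ fun ν ω => A ν → ∀ q, |∑ i, X ν q (V ν i ω) * Y ν q (V ν i ω)| ≤
      n ν * (m ν + 64 * c * √(Real.log (p ν) / n ν)) :=
  whp_forall_abs_sum_mul_le (X := fun ν q i ω => X ν q (V ν i ω))
    (Y := fun ν q i ω => Y ν q (V ν i ω)) hn hp hQ hc (fun ν q i => (hXm ν q).comp (hV ν i))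
    (fun ν q i => (hYm ν q).comp (hV ν i)) hX hY
    (fun ν q => (hind ν).comp (fun _ t => X ν q t * Y ν q t) fun _ => (hXm ν q).mul (hYm ν q)) hm hA

section Sparsity

variable {s n : ℕ → ℕ} {p : ℕ → ℝ}

lemma tendsto_sparsity_add_one_div (hp : Tendsto p atTop atTop)
    (hS : Tendsto (fun ν => (s ν : ℝ) * (Real.log (p ν) / n ν + 1 / p ν)) atTop (𝓝 0)) :
    Tendsto (fun ν => ((s ν : ℝ) + 1) / p ν) atTop (𝓝 0) := by
  have h : Tendsto (fun ν => (s ν : ℝ) * (Real.log (p ν) / n ν + 1 / p ν) + 1 / p ν) atTop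
      (𝓝 (0 + 0)) := hS.add (hp.const_div_atTop 1)
  rw [add_zero] at h
  refine squeeze_zero' ?_ ?_ h
  · filter_upwards [hp.eventually_ge_atTop 1] with ν h1
    positivity
  · filter_upwards [hp.eventually_ge_atTop 1] with ν h1
    have := Real.log_nonneg h1
    have h2 : 0 ≤ (s ν : ℝ) * (Real.log (p ν) / n ν) := by positivity
    rw [add_div, mul_add, mul_one_div]
    linarith

lemma tendsto_sqrt_sparsity_mul (hp : Tendsto p atTop atTop)
    (hS : Tendsto (fun ν => (s ν : ℝ) * (Real.log (p ν) / n ν + 1 / p ν)) atTop (𝓝 0)) :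
    Tendsto (fun ν => √(s ν : ℝ) * √(Real.log (p ν) / n ν)) atTop (𝓝 0) := by
  have h : Tendsto (fun ν => √((s ν : ℝ) * (Real.log (p ν) / n ν + 1 / p ν))) atTop (𝓝 (√0)) :=
    (Real.continuous_sqrt.tendsto 0).comp hS
  rw [Real.sqrt_zero] at h
  refine squeeze_zero' (Eventually.of_forall fun ν => by positivity) ?_ h
  filter_upwards [hp.eventually_ge_atTop 1] with ν h1
  rw [← Real.sqrt_mul (by positivity)]
  refine Real.sqrt_le_sqrt (mul_le_mul_of_nonneg_left ?_ (by positivity))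
  have : 0 ≤ 1 / p ν := by positivity
  linarith

lemma eventually_log_div_le_one (hp : Tendsto p atTop atTop)
    (hS : Tendsto (fun ν => (s ν : ℝ) * (Real.log (p ν) / n ν + 1 / p ν)) atTop (𝓝 0)) :
    ∀ᶠ ν in atTop, s ν ≠ 0 → Real.log (p ν) / n ν ≤ 1 := by
  filter_upwards [hp.eventually_ge_atTop 1, hS.eventually_le_const one_pos] with ν h1 h2 hs
  have h3 : (1 : ℝ) ≤ s ν := by exact_mod_cast Nat.one_le_iff_ne_zero.2 hs
  have h4 := Real.log_nonneg h1
  have h5 : 0 ≤ 1 / p ν := by positivity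
  have h6 : 0 ≤ Real.log (p ν) / n ν := by positivity
  nlinarith

end Sparsity

/-- The empirical cross moments of factors, idiosyncratic components and noise. -/
lemma whp_moments {Ω : ℕ → Type*} [∀ ν, MeasurableSpace (Ω ν)] {μ : ∀ ν, Measure (Ω ν)}
    [∀ ν, IsProbabilityMeasure (μ ν)] {k₁ k₂ : ℕ} {n p₁ p₂ : ℕ → ℕ}
    (hn : Tendsto n atTop atTop) (hp₁ : Tendsto p₁ atTop atTop) (hp₂ : Tendsto p₂ atTop atTop)
    {F : ∀ ν, Ω ν → Fin (n ν) → Matrix (Fin k₁) (Fin k₂) ℝ}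
    {U : ∀ ν, Ω ν → Fin (n ν) → Matrix (Fin (p₁ ν)) (Fin (p₂ ν)) ℝ}
    {ε : ∀ ν, Ω ν → Fin (n ν) → ℝ}
    (hFm : ∀ ν i a b, Measurable fun ω => F ν ω i a b)
    (hUm : ∀ ν i a b, Measurable fun ω => U ν ω i a b)
    (hεm : ∀ ν i, Measurable fun ω => ε ν ω i)
    (hindep : ∀ ν, iIndepFun (fun (i : Fin (n ν)) (ω : Ω ν) =>
      ((fun q : Fin k₁ × Fin k₂ => F ν ω i q.1 q.2),
        (fun q : Fin (p₁ ν) × Fin (p₂ ν) => U ν ω i q.1 q.2), ε ν ω i)) (μ ν))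
    {K : ℝ≥0} {c₀ : ℝ}
    (hF : ∀ ν i, FAMAR.WeaklyCorrelatedSubGaussian (μ ν) K c₀ fun ω => F ν ω i)
    (hU : ∀ ν i, FAMAR.WeaklyCorrelatedSubGaussian (μ ν) K c₀ fun ω => U ν ω i)
    {c₁ : ℝ}
    (hFU : ∀ ν i a b a' b', |∫ ω, F ν ω i a b * U ν ω i a' b' ∂(μ ν)| ≤ c₁ / Real.sqrt (n ν))
    {σ : ℝ≥0}
    (hε : ∀ ν i, HasSubgaussianMGF (fun ω => ε ν ω i) (σ ^ 2) (μ ν))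
    (hεF : ∀ ν i a b, ∫ ω, ε ν ω i * F ν ω i a b ∂(μ ν) = 0)
    (hεU : ∀ ν i a b, ∫ ω, ε ν ω i * U ν ω i a b ∂(μ ν) = 0)
    {A : ℕ → Prop}
    (hℓ1 : ∀ᶠ ν in atTop, A ν → Real.log ((p₁ ν : ℝ) * p₂ ν) / n ν ≤ 1) :
    ∃ υ D r : ℝ, 0 ≤ υ ∧ 0 ≤ D ∧ 0 ≤ r ∧ WHP μ fun ν ω => A ν →
      (∀ j, |∑ i, stack (U ν ω) i j * stack (U ν ω) i j| ≤ n ν * υ ^ 2) ∧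
      (∀ j k, |∑ i, stack (U ν ω) i j * stack (F ν ω) i k| ≤
        n ν * (D * √(Real.log ((p₁ ν : ℝ) * p₂ ν) / n ν))) ∧
      (∀ j, |∑ i, stack (U ν ω) i j * ε ν ω i| ≤
        n ν * (r * √(Real.log ((p₁ ν : ℝ) * p₂ ν) / n ν))) ∧
      ∀ k, |∑ i, stack (F ν ω) i k * ε ν ω i| ≤
        n ν * (r * √(Real.log ((p₁ ν : ℝ) * p₂ ν) / n ν)) := by
  have hp : Tendsto (fun ν => (p₁ ν : ℝ) * p₂ ν) atTop atTop :=
    (tendsto_natCast_atTop_atTop.comp hp₁).atTop_mul_atTop₀ (tendsto_natCast_atTop_atTop.comp hp₂)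
  have hlog : ∀ᶠ ν in atTop, 1 ≤ Real.log ((p₁ ν : ℝ) * p₂ ν) :=
    (Real.tendsto_log_atTop.comp hp).eventually_ge_atTop 1
  set a : ℝ≥0 := K * Real.toNNReal (c₀ ^ 4) + σ ^ 2 + 1 with ha
  have ha0 : 0 < a := by positivity
  have hFa : ∀ ν i j k, HasSubgaussianMGF (fun ω => F ν ω i j k) a (μ ν) := fun ν i j k =>
    ((hF ν i).entry j k).mono (by rw [ha, add_assoc]; exact le_self_add)
  have hUa : ∀ ν i j k, HasSubgaussianMGF (fun ω => U ν ω i j k) a (μ ν) := fun ν i j k =>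
    ((hU ν i).entry j k).mono (by rw [ha, add_assoc]; exact le_self_add)
  have hεa : ∀ ν i, HasSubgaussianMGF (fun ω => ε ν ω i) a (μ ν) := fun ν i =>
    (hε ν i).mono (by rw [ha, add_right_comm]; exact le_add_self)
  set V : ∀ ν, Fin (n ν) → Ω ν → (Fin k₁ × Fin k₂ → ℝ) × (Fin (p₁ ν) × Fin (p₂ ν) → ℝ) × ℝ :=
    fun ν i ω => ((fun q : Fin k₁ × Fin k₂ => F ν ω i q.1 q.2),
      (fun q : Fin (p₁ ν) × Fin (p₂ ν) => U ν ω i q.1 q.2), ε ν ω i) with hV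
  have hVm : ∀ ν i, Measurable (V ν i) := fun ν i =>
    (measurable_pi_lambda _ fun q : Fin k₁ × Fin k₂ => hFm ν i q.1 q.2).prodMk
      ((measurable_pi_lambda _ fun q : Fin (p₁ ν) × Fin (p₂ ν) => hUm ν i q.1 q.2).prodMk (hεm ν i))
  have hUU := whp_cross_moments (Q := fun ν => Fin (p₁ ν) × Fin (p₂ ν)) (k := 1)
    (X := fun ν q t => t.2.1 q) (Y := fun ν q t => t.2.1 q) (m := fun _ => 8 * a)
    hn hp hVm hindep (Eventually.of_forall fun ν => by simp) ha0
    (fun ν q => by fun_prop) (fun ν q => by fun_prop) (fun ν q i => hUa ν i q.1 q.2)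
    (fun ν q i => hUa ν i q.1 q.2)
    (fun ν q i => abs_integral_mul_le (hUa ν i q.1 q.2) (hUa ν i q.1 q.2)) hℓ1
  have hUF := whp_cross_moments
    (Q := fun ν => (Fin (p₁ ν) × Fin (p₂ ν)) × Fin k₁ × Fin k₂) (k := (k₁ * k₂ : ℕ))
    (X := fun ν q t => t.1 q.2) (Y := fun ν q t => t.2.1 q.1) (m := fun ν => c₁ / √(n ν))
    hn hp hVm hindep (Eventually.of_forall fun ν => by simp [mul_comm]) ha0
    (fun ν q => by fun_prop) (fun ν q => by fun_prop) (fun ν q i => hFa ν i q.2.1 q.2.2)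
    (fun ν q i => hUa ν i q.1.1 q.1.2)
    (fun ν q i => hFU ν i q.2.1 q.2.2 q.1.1 q.1.2) hℓ1
  have hUε := whp_cross_moments (Q := fun ν => Fin (p₁ ν) × Fin (p₂ ν)) (k := 1)
    (X := fun ν q t => t.2.2) (Y := fun ν q t => t.2.1 q) (m := fun _ => 0)
    hn hp hVm hindep (Eventually.of_forall fun ν => by simp) ha0
    (fun ν q => by fun_prop) (fun ν q => by fun_prop) (fun ν q i => hεa ν i)
    (fun ν q i => hUa ν i q.1 q.2)
    (fun ν q i => (abs_eq_zero.2 (hεU ν i q.1 q.2)).le) hℓ1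
  have hFε := whp_cross_moments (Q := fun ν => Fin k₁ × Fin k₂) (k := (k₁ * k₂ : ℕ))
    (X := fun ν q t => t.2.2) (Y := fun ν q t => t.1 q) (m := fun _ => 0)
    hn hp hVm hindep ((hp.eventually_ge_atTop 1).mono fun ν h => by
      rw [Fintype.card_prod, Fintype.card_fin, Fintype.card_fin]
      exact le_mul_of_one_le_right (Nat.cast_nonneg _) h) ha0
    (fun ν q => by fun_prop) (fun ν q => by fun_prop) (fun ν q i => hεa ν i)
    (fun ν q i => hFa ν i q.1 q.2)
    (fun ν q i => (abs_eq_zero.2 (hεF ν i q.1 q.2)).le) hℓ1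
  -- 72a is the second-moment bound 8a plus the deviation 64a√ℓ with ℓ ≤ 1. The term |c₁| accounts
  -- for the means c₁/√n, dominated by |c₁|√ℓ once log(p₁p₂) ≥ 1.
  refine ⟨√(72 * a), |c₁| + 64 * a, 64 * a, by positivity, by positivity, by positivity, ?_⟩
  refine (hUU.and (hUF.and (hUε.and hFε))).mono' ?_
  filter_upwards [hlog, hℓ1, hn.eventually_ge_atTop 1] with ν hlog hℓ1 hn0 ω hω hs
  obtain ⟨hUU, hUF, hUε, hFε⟩ := hω
  have hnν : (0 : ℝ) < n ν := by exact_mod_cast hn0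
  set ℓ : ℝ := Real.log ((p₁ ν : ℝ) * p₂ ν) / n ν with hℓ
  refine ⟨fun j => ?_, fun j k => ?_, fun j => ?_, fun k => ?_⟩
  · refine (hUU hs j).trans (mul_le_mul_of_nonneg_left ?_ hnν.le)
    rw [Real.sq_sqrt (by positivity)]
    have h1 : √ℓ ≤ 1 := Real.sqrt_le_one.2 (hℓ1 hs)
    have h2 : (0 : ℝ) < a := ha0
    nlinarith
  · have hmean : c₁ / √(n ν) ≤ |c₁| * √ℓ := by
      rw [hℓ, Real.sqrt_div (zero_le_one.trans hlog), mul_div_assoc']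
      refine div_le_div_of_nonneg_right ?_ (Real.sqrt_nonneg _)
      exact (le_abs_self _).trans
        (le_mul_of_one_le_right (abs_nonneg _) (Real.one_le_sqrt.2 hlog))
    simp only [mul_comm (stack (U ν ω) _ _)]
    exact (hUF hs (j, k)).trans (mul_le_mul_of_nonneg_left (by linarith) hnν.le)
  · have h := hUε hs j
    rw [zero_add] at h
    simp only [mul_comm (stack (U ν ω) _ _)]
    exact h
  · have h := hFε hs k
    rw [zero_add] at h
    simp only [mul_comm (stack (F ν ω) _ _)]
    exact h

lemma whp_eucl_factorHat_le {Ω : ℕ → Type*} [∀ ν, MeasurableSpace (Ω ν)]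
    {μ : ∀ ν, Measure (Ω ν)} [∀ ν, IsProbabilityMeasure (μ ν)]
    {k₁ k₂ : ℕ} {n p₁ p₂ : ℕ → ℕ} (hn : Tendsto n atTop atTop)
    (hp₁ : Tendsto p₁ atTop atTop) (hp₂ : Tendsto p₂ atTop atTop) {K : ℝ≥0} {c w : ℝ}
    {U : ∀ ν, Ω ν → Fin (n ν) → Matrix (Fin (p₁ ν)) (Fin (p₂ ν)) ℝ}
    (hU : ∀ ν i, WeaklyCorrelatedSubGaussian (μ ν) K c fun ω => U ν ω i)
    (hUm : ∀ ν i a b, Measurable fun ω => U ν ω i a b)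
    {W₁ : ∀ ν, Ω ν → Matrix (Fin (p₁ ν)) (Fin k₁) ℝ}
    {W₂ : ∀ ν, Ω ν → Matrix (Fin (p₂ ν)) (Fin k₂) ℝ}
    (hW₁m : ∀ ν a b, Measurable fun ω => W₁ ν ω a b)
    (hW₂m : ∀ ν a b, Measurable fun ω => W₂ ν ω a b)
    (hind : ∀ ν i, IndepFun (fun ω => ((fun q : Fin (p₁ ν) × Fin k₁ => W₁ ν ω q.1 q.2),
        (fun q : Fin (p₂ ν) × Fin k₂ => W₂ ν ω q.1 q.2)))
      (fun ω (q : Fin (p₁ ν) × Fin (p₂ ν)) => U ν ω i q.1 q.2) (μ ν))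
    (hW : WHP μ fun ν ω => maxNorm (W₁ ν ω) < w ∧ maxNorm (W₂ ν ω) < w) {s : ℕ → ℕ}
    (hs : Tendsto (fun ν => ((s ν : ℝ) + 1) / ((p₁ ν : ℝ) * p₂ ν)) atTop (𝓝 0))
    {x : ℝ} (hx : 0 < x) :
    WHP μ fun ν ω => ∀ k, eucl (fun i => stack (factorHat (W₁ ν ω) (W₂ ν ω) (U ν ω)) i k) ≤
      √(n ν) * (x / √((s ν : ℝ) + 1)) := by
  refine (whp_factorHat_sq_le hn hp₁ hp₂ hU hUm hW₁m hW₂m hind hW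
    (r := fun ν => (s ν : ℝ) + 1) (fun ν => by positivity) hs (e := x ^ 2) (by positivity)).mono' ?_
  filter_upwards [hn.eventually_ge_atTop 1] with ν hn0 ω hE k
  have hnν : (0 : ℝ) < n ν := by exact_mod_cast hn0
  refine eucl_le_sqrt_mul (by positivity) ?_
  have h := hE k.1 k.2
  have hs0 : (0 : ℝ) < (s ν : ℝ) + 1 := by positivity
  rw [div_pow, Real.sq_sqrt hs0.le, mul_div_assoc', le_div_iff₀ hs0]
  rw [one_div, mul_comm, mul_assoc, inv_mul_le_iff₀ hnν] at h
  simp only [← sq]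
  exact h

lemma sparsity_scale_bounds {s : ℕ} {x e : ℝ} (hx : 0 ≤ x) (he : e = x / √((s : ℝ) + 1)) :
    0 ≤ e ∧ e ≤ x ∧ √(s : ℝ) * e ≤ x := by
  have hs1 : 1 ≤ √((s : ℝ) + 1) := Real.one_le_sqrt.2 (by linarith [Nat.cast_nonneg (α := ℝ) s])
  refine ⟨by rw [he]; positivity, by rw [he]; exact div_le_self hx hs1, ?_⟩
  rw [he, mul_div_assoc', div_le_iff₀ (by positivity), mul_comm]
  exact mul_le_mul_of_nonneg_left (Real.sqrt_le_sqrt (by linarith)) hx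

end FAMAR

theorem mainTheorem9
    {Ω : ℕ → Type*} [∀ ν, MeasurableSpace (Ω ν)] (μ : ∀ ν, Measure (Ω ν))
    [∀ ν, IsProbabilityMeasure (μ ν)]
    -- dimensions; everything is indexed by `ν → ∞`, the factor dimensions stay fixed
    (k₁ k₂ : ℕ) (n p₁ p₂ : ℕ → ℕ)
    (hn : Tendsto n atTop atTop) (hp₁ : Tendsto p₁ atTop atTop) (hp₂ : Tendsto p₂ atTop atTop)
    -- loadings and regression coefficient
    (R : ∀ ν, Matrix (Fin (p₁ ν)) (Fin k₁) ℝ) (C : ∀ ν, Matrix (Fin (p₂ ν)) (Fin k₂) ℝ)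
    (B : ∀ ν, Matrix (Fin (p₁ ν)) (Fin (p₂ ν)) ℝ)
    -- factors, idiosyncratic components, noise, projection matrices
    (F : ∀ ν, Ω ν → Fin (n ν) → Matrix (Fin k₁) (Fin k₂) ℝ)
    (U : ∀ ν, Ω ν → Fin (n ν) → Matrix (Fin (p₁ ν)) (Fin (p₂ ν)) ℝ)
    (ε : ∀ ν, Ω ν → Fin (n ν) → ℝ)
    (W₁ : ∀ ν, Ω ν → Matrix (Fin (p₁ ν)) (Fin k₁) ℝ)
    (W₂ : ∀ ν, Ω ν → Matrix (Fin (p₂ ν)) (Fin k₂) ℝ)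
    -- measurability
    (hFm : ∀ ν i a b, Measurable fun ω => F ν ω i a b)
    (hUm : ∀ ν i a b, Measurable fun ω => U ν ω i a b)
    (hεm : ∀ ν i, Measurable fun ω => ε ν ω i)
    (hW₁m : ∀ ν a b, Measurable fun ω => W₁ ν ω a b)
    (hW₂m : ∀ ν a b, Measurable fun ω => W₂ ν ω a b)
    -- the observations `(F_i, U_i, ε_i)` are independent over `i`
    (hindep : ∀ ν, iIndepFun (fun (i : Fin (n ν)) (ω : Ω ν) =>
      ((fun q : Fin k₁ × Fin k₂ => F ν ω i q.1 q.2),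
        (fun q : Fin (p₁ ν) × Fin (p₂ ν) => U ν ω i q.1 q.2), ε ν ω i)) (μ ν))
    -- the projection matrices are independent of the observations
    (hWindep : ∀ ν, IndepFun
      (fun ω => ((fun q : Fin (p₁ ν) × Fin k₁ => W₁ ν ω q.1 q.2),
        (fun q : Fin (p₂ ν) × Fin k₂ => W₂ ν ω q.1 q.2)))
      (fun ω (i : Fin (n ν)) => ((fun q : Fin k₁ × Fin k₂ => F ν ω i q.1 q.2),
        (fun q : Fin (p₁ ν) × Fin (p₂ ν) => U ν ω i q.1 q.2), ε ν ω i)) (μ ν))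
    -- sub-Gaussian, weakly correlated factors and idiosyncratic components
    (K : ℝ≥0) (c₀ : ℝ)
    (hF : ∀ ν i, FAMAR.WeaklyCorrelatedSubGaussian (μ ν) K c₀ fun ω => F ν ω i)
    (hU : ∀ ν i, FAMAR.WeaklyCorrelatedSubGaussian (μ ν) K c₀ fun ω => U ν ω i)
    -- factors and idiosyncratic components are (asymptotically) uncorrelated
    (c₁ : ℝ)
    (hFU : ∀ ν i a b a' b', |∫ ω, F ν ω i a b * U ν ω i a' b' ∂(μ ν)| ≤ c₁ / Real.sqrt (n ν))
    -- sub-Gaussian noise, uncorrelated with `(F_i, U_i)`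
    (σ : ℝ≥0)
    (hε : ∀ ν i, HasSubgaussianMGF (fun ω => ε ν ω i) (σ ^ 2) (μ ν))
    (hεF : ∀ ν i a b, ∫ ω, ε ν ω i * F ν ω i a b ∂(μ ν) = 0)
    (hεU : ∀ ν i a b, ∫ ω, ε ν ω i * U ν ω i a b ∂(μ ν) = 0)
    -- bounded loadings
    (cL : ℝ) (hR : ∀ ν a b, |R ν a b| ≤ cL) (hC : ∀ ν a b, |C ν a b| ≤ cL)
    -- the spectrum of the factor Gram matrix is bounded away from zero and infinity
    (cF CF : ℝ) (hcF : 0 < cF)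
    (hGram : FAMAR.WHP μ fun ν ω =>
      ((1 / (n ν : ℝ)) • ((FAMAR.stack (F ν ω))ᵀ * FAMAR.stack (F ν ω)) -
        cF • (1 : Matrix (Fin k₁ × Fin k₂) (Fin k₁ × Fin k₂) ℝ)).PosSemidef ∧
      (CF • (1 : Matrix (Fin k₁ × Fin k₂) (Fin k₁ × Fin k₂) ℝ) -
        (1 / (n ν : ℝ)) • ((FAMAR.stack (F ν ω))ᵀ * FAMAR.stack (F ν ω))).PosSemidef)
    -- diversified projections: bounded entries, and `H₂ ⊗ H₁` converges in probability to an
    -- invertible matrix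
    (cW : ℝ)
    (hW : FAMAR.WHP μ fun ν ω => FAMAR.maxNorm (W₁ ν ω) < cW ∧ FAMAR.maxNorm (W₂ ν ω) < cW)
    (Λ : Matrix (Fin k₂ × Fin k₁) (Fin k₂ × Fin k₁) ℝ) (hΛ : IsUnit Λ.det)
    (hH : ∀ e : ℝ, 0 < e → FAMAR.WHP μ fun ν ω =>
      FAMAR.maxNorm (FAMAR.transf (W₂ ν ω) (C ν) ⊗ₖ FAMAR.transf (W₁ ν ω) (R ν) - Λ) < e)
    -- restricted strong convexity and irrepresentable condition for the true design `[𝕌 𝔽]`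
    (κinf κ₂ τ : ℝ) (hκinf : 0 < κinf) (hκ₂ : κinf < κ₂) (hτ₀ : 0 < τ) (hτ₁ : τ < 1)
    (hRSC : FAMAR.WHP μ fun ν ω => FAMAR.RestrictedStrongConvexity
      (FAMAR.design (U ν ω) (F ν ω)) (FAMAR.supp (FAMAR.thetaStar (R ν) (C ν) (B ν))) κinf κ₂)
    (hIrr : FAMAR.WHP μ fun ν ω => FAMAR.Irrepresentable
      (FAMAR.design (U ν ω) (F ν ω)) (FAMAR.supp (FAMAR.thetaStar (R ν) (C ν) (B ν))) τ)
    -- sparsity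
    (hS : Tendsto (fun ν => ((FAMAR.supp (FAMAR.thetaStar (R ν) (C ν) (B ν))).card : ℝ) *
      (Real.log ((p₁ ν : ℝ) * p₂ ν) / n ν + 1 / ((p₁ ν : ℝ) * p₂ ν))) atTop (𝓝 0))
    -- observed covariates and responses, projected factors, estimated residuals
    (X : ∀ ν, Ω ν → Fin (n ν) → Matrix (Fin (p₁ ν)) (Fin (p₂ ν)) ℝ)
    (hX : ∀ ν ω, X ν ω = FAMAR.covariate (R ν) (C ν) (F ν ω) (U ν ω))
    (y : ∀ ν, Ω ν → Fin (n ν) → ℝ)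
    (hy : ∀ ν ω, y ν ω = FAMAR.response (X ν ω) (B ν) (ε ν ω))
    (Fh : ∀ ν, Ω ν → Fin (n ν) → Matrix (Fin k₁) (Fin k₂) ℝ)
    (hFh : ∀ ν ω, Fh ν ω = FAMAR.factorHat (W₁ ν ω) (W₂ ν ω) (X ν ω))
    (Uh : ∀ ν, Ω ν → Fin (n ν) → Matrix (Fin (p₁ ν)) (Fin (p₂ ν)) ℝ)
    (hUh : (∀ ν ω, Uh ν ω = FAMAR.blockResidual (X ν ω) (Fh ν ω)) ∨
      (∀ ν ω, Uh ν ω = FAMAR.projResidual (X ν ω) (Fh ν ω)))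
    -- noise level of the rotated estimated design
    (δ : ∀ ν, Ω ν → ℝ)
    (hδ : ∀ ν ω, δ ν ω = FAMAR.noiseLevel
      (FAMAR.design (FAMAR.projResidual (X ν ω) (Fh ν ω))
        (FAMAR.rotatedFactor (FAMAR.transf (W₁ ν ω) (R ν)) (FAMAR.transf (W₂ ν ω) (C ν))
          (Fh ν ω))) (ε ν ω))
    -- tuning parameter: `lam > 14 δ / τ` and `lam ≍ δ`
    (lam : ∀ ν, Ω ν → ℝ)
    (hlam₁ : FAMAR.WHP μ fun ν ω => 14 * δ ν ω / τ < lam ν ω)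
    (hlam₂ : FAMAR.IsBigOp μ lam δ)
    -- the estimator
    (Ah : ∀ ν, Ω ν → Matrix (Fin k₁) (Fin k₂) ℝ)
    (Bh : ∀ ν, Ω ν → Matrix (Fin (p₁ ν)) (Fin (p₂ ν)) ℝ)
    (hmin : FAMAR.WHP μ fun ν ω => ∀ θ, FAMAR.objective (y ν ω) (Fh ν ω) (Uh ν ω) (lam ν ω)
      (Ah ν ω, Bh ν ω) ≤ FAMAR.objective (y ν ω) (Fh ν ω) (Uh ν ω) (lam ν ω) θ) :
    FAMAR.IsBigOp μ (fun ν ω => FAMAR.maxNorm (Bh ν ω - B ν))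
      (fun ν _ => FAMAR.rate
        (FAMAR.supp (FAMAR.thetaStar (R ν) (C ν) (B ν))).card (n ν) (p₁ ν) (p₂ ν)) := by
  have hκ₂0 : 0 < κ₂ := hκinf.trans hκ₂
  have hp : Tendsto (fun ν => (p₁ ν : ℝ) * p₂ ν) atTop atTop :=
    (tendsto_natCast_atTop_atTop.comp hp₁).atTop_mul_atTop₀ (tendsto_natCast_atTop_atTop.comp hp₂)
  set s : ℕ → ℕ := fun ν => (FAMAR.supp (FAMAR.thetaStar (R ν) (C ν) (B ν))).card with hs
  have hℓ1 : ∀ᶠ ν in atTop, s ν ≠ 0 → Real.log ((p₁ ν : ℝ) * p₂ ν) / n ν ≤ 1 :=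
    FAMAR.eventually_log_div_le_one hp hS
  obtain ⟨υ, D, r, hυ, hD, hr, hmom⟩ := FAMAR.whp_moments hn hp₁ hp₂ hFm hUm hεm hindep hF hU hFU hε
    hεF hεU hℓ1
  obtain ⟨e₀, he₀, b, hb, hΛb⟩ := FAMAR.exists_maxNorm_sub_lt_imp hΛ
  set kk : ℝ := ((k₁ * k₂ : ℕ) : ℝ) with hkk
  obtain ⟨c, hc⟩ : ∃ c, c = √cF / (2 * (kk * b + 1)) := ⟨_, rfl⟩
  have hsf : 0 < √cF := Real.sqrt_pos.2 hcF
  have hkk0 : 0 ≤ kk := Nat.cast_nonneg _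
  have hc0 : 0 < c := by rw [hc]; positivity
  obtain ⟨γ, hγ⟩ : ∃ γ, γ = kk * (|cL| ^ 2 * b) := ⟨_, rfl⟩
  have hγ0 : 0 ≤ γ := by rw [hγ]; positivity
  obtain ⟨φ, hφ0, hφ2⟩ : ∃ φ : ℝ, 0 < φ ∧ φ ^ 2 = κ₂ * τ ^ 2 / 2 :=
    ⟨√(κ₂ * τ ^ 2 / 2), Real.sqrt_pos.2 (by positivity), Real.sq_sqrt (by positivity)⟩
  -- The constant x is the tolerance for the projected idiosyncratic part, whose scale is e = x/√(s
  -- + 1). It is chosen so that the terms in e and the term in ρ (`hsmall`) each use φ/12 of the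
  -- perturbation budget φ/6, and so that E cannot spoil the conditioning of F̂.
  obtain ⟨x, hx0, hx1, hxφ, hxc⟩ := FAMAR.exists_pos_le_one_mul_le (kk * γ + √kk * υ / c) (√kk)
    (s := φ / 12) (t := c) (by positivity) hc0
  have hE := FAMAR.whp_eucl_factorHat_le hn hp₁ hp₂ hU hUm hW₁m hW₂m
    (fun ν i => (hWindep ν).comp (φ := id) (ψ := fun t : Fin (n ν) →
      (Fin k₁ × Fin k₂ → ℝ) × (Fin (p₁ ν) × Fin (p₂ ν) → ℝ) × ℝ => (t i).2.1)
      measurable_id (by fun_prop)) hW (FAMAR.tendsto_sparsity_add_one_div hp hS) hx0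
  have hsmall : ∀ᶠ ν in atTop, √kk * (kk * b * D) / c *
      (√(s ν : ℝ) * √(Real.log ((p₁ ν : ℝ) * p₂ ν) / n ν)) ≤ φ / 12 := by
    have h := (FAMAR.tendsto_sqrt_sparsity_mul hp hS).const_mul (√kk * (kk * b * D) / c)
    rw [mul_zero] at h
    exact h.eventually_le_const (by positivity)
  have hn0 := hn.eventually_ge_atTop 1
  have hp₁0 := hp₁.eventually_ge_atTop 1
  have hp₂0 := hp₂.eventually_ge_atTop 1
  -- The bound is proved for all M with λ ≤ Mδ on one event, because the M supplied by λ = O_p(δ)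
  -- depends on the probability level.
  refine FAMAR.isBigOp_of_whp hlam₂ (fun ν ω => by rw [hδ]; exact norm_nonneg _)
    (D := 48 / φ ^ 2 * ((1 + kk * (γ * |cW| ^ 2) + (υ + kk * γ) *
      (√kk * (kk * b + |cW| ^ 2) / c) + kk * (b * (kk * b + |cW| ^ 2))) * r)) ?_
  refine FAMAR.WHP.mono' (hmom.and ((hE.and (hGram.and (hW.and
    (hH e₀ he₀)))).and ((hRSC.and hIrr).and (hlam₁.and hmin)))) ?_
  filter_upwards [hn0, hp₁0, hp₂0, hsmall] with ν hn0 hp₁0 hp₂0 hsmall ω hω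
  obtain ⟨hmom, ⟨hE, ⟨hGram, -⟩, ⟨hW₁, hW₂⟩, hH⟩, ⟨hRSC, hIrr⟩, hlam₁, hmin⟩ := hω
  intro M hM hlamM
  set ℓ : ℝ := Real.log ((p₁ ν : ℝ) * p₂ ν) / n ν with hℓ
  obtain ⟨hHu, hHb, hHi⟩ := FAMAR.kronecker_comm_bounds (hΛb _ hH)
  obtain ⟨e, he⟩ : ∃ e, e = x / √((s ν : ℝ) + 1) := ⟨_, rfl⟩
  obtain ⟨he0, hex, hse⟩ := FAMAR.sparsity_scale_bounds hx0.le he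
  rw [← he] at hE
  have hW₁' : ∀ a α, |W₁ ν ω a α| ≤ |cW| := fun a α =>
    (FAMAR.abs_le_maxNorm _ _ _).trans (hW₁.le.trans (le_abs_self _))
  have hW₂' : ∀ a α, |W₂ ν ω a α| ≤ |cW| := fun a α =>
    (FAMAR.abs_le_maxNorm _ _ _).trans (hW₂.le.trans (le_abs_self _))
  have hmain := FAMAR.maxNorm_sub_le_of_moments (hX ν ω) (hFh ν ω)
    (hUh.imp (fun h => h ν ω) fun h => h ν ω) hn0 hp₁0 hp₂0 hcF hb.le hGram hHu hHb hHi hE he0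
    (hex.trans hx1) hc (((mul_comm _ _).trans_le
      (mul_le_mul_of_nonneg_left hex (Real.sqrt_nonneg _))).trans hxc) (abs_nonneg cL)
    (fun a α => (hR ν a α).trans (le_abs_self _)) (fun a α => (hC ν a α).trans (le_abs_self _)) hγ
    (abs_nonneg cW) hW₁' hW₂' hκ₂0 hτ₀ hτ₁ hRSC hIrr hφ0 hφ2 (υ := υ) (ρ := D * √ℓ)
    (r := r * √ℓ) (ε := ε ν ω) (lam := lam ν ω) (Ah := Ah ν ω) (Bh := Bh ν ω) (M := M)
    hυ (by positivity) (by positivity) hmom ?_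
    (by rw [← hδ]; exact hlam₁) (fun θ => ?_) hM (by rw [← hδ]; exact hlamM)
  · rw [abs_of_nonneg (by exact norm_nonneg _)]
    refine hmain.trans ?_
    have hrate := FAMAR.mul_sqrt_le_rate (s := s ν) (n := n ν) hp₁0 hp₂0
    set D' : ℝ := 1 + kk * (γ * |cW| ^ 2) + (υ + kk * γ) *
      (√kk * (kk * b + |cW| ^ 2) / c) + kk * (b * (kk * b + |cW| ^ 2)) with hD'
    have hD0 : 0 ≤ D' := by positivity
    calc _ = M * (48 / φ ^ 2 * (D' * r)) * (s ν * √ℓ) := by ring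
      _ ≤ _ := mul_le_mul_of_nonneg_left hrate (by positivity)
  · have h1 := mul_le_mul_of_nonneg_left hse (by positivity : 0 ≤ kk * γ + √kk * υ / c)
    calc _ = 6 * ((kk * γ + √kk * υ / c) * (√(s ν : ℝ) * e) +
          √kk * (kk * b * D) / c * (√(s ν : ℝ) * √ℓ)) := by ring
      _ ≤ φ := by linarith
  · have h := hmin θ
    rwa [hy] at h
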